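/- For $u_0:\mathbb{R}^d\to\mathbb{R}$ let $$P_y(x)=c_d\,\frac{y}{(|x|^2+y^2)^{(d+1)/2}},\qquad c_d=\frac{\Gamma\left(\frac{d+1}{2}\right)}{\pi^{(d+1)/2}},\qquad x\in\mathbb{R}^d,\ y>0,$$ be the Poisson kernel of the upper half-space, and let $$u^\star(x)=\sup_{y>0}\,(|u_0|*P_y)(x)\in[0,\infty]$$ be the Poisson maximal function of $u_0$. Write $W^{1,p}(\mathbb{R}^d)$ for the space of functions in $L^p(\mathbb{R}^d)$ whose weak gradient is in $L^p$, $\|\nabla f\|_p$ for the $L^p$-norm of the Euclidean length $|\nabla f|$ of the weak gradient (for $d=1$, $f'$ is the weak derivative), and $V(f)$ for the total variation of $f:\mathbb{R}\to\mathbb{R}$, that is, the supremum of $\sum_i|f(x_{i+1})-f(x_i)|$ over all finite sequences $x_1\le x_2\le\dots\le x_N$. Then the following hold. (i) Let $1<p\le\infty$ and $u_0\in W^{1,p}(\mathbb{R})$. Then $u^\star$ is finite everywhere, $u^\star\in W^{1,p}(\mathbb{R})$ and $\|(u^\star)'\|_p\le\|u_0'\|_p$. (ii) Let $u_0\in W^{1,1}(\mathbb{R})$.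 Then $u^\star$ is finite everywhere, $u^\star\in L^\infty(\mathbb{R})$, and $u^\star$ has a weak derivative $(u^\star)'$ that satisfies $\|(u^\star)'\|_1\le\|u_0'\|_1$. (iii) Let $u_0$ be of bounded variation on $\mathbb{R}$, that is, $V(u_0)<\infty$. Then $u^\star$ is finite everywhere and of bounded variation on $\mathbb{R}$, and $V(u^\star)\le V(u_0)$. (iv) Let $d>1$ and $u_0\in W^{1,p}(\mathbb{R}^d)$ for $p=2$ or $p=\infty$. Then $u^\star$ is finite almost everywhere, $u^\star\in W^{1,p}(\mathbb{R}^d)$ and $\|\nabla u^\star\|_p\le\|\nabla u_0\|_p$. -/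

import Mathlib

open MeasureTheory Set
open scoped ENNReal ContDiff

section PoissonMaximal

variable {E : Type*} [NormedAddCommGroup E] [InnerProductSpace ℝ E] [MeasureSpace E]

/-- The Poisson kernel of the upper half-space over a `d`-dimensional Euclidean space,
`P_y(x) = c_d * y / (|x|^2 + y^2)^((d+1)/2)` with `c_d = Γ((d+1)/2) / π^((d+1)/2)`,
where `d` is the dimension of `E`. -/
noncomputable def halfSpacePoissonKernel (y : ℝ) (x : E) : ℝ :=
  Real.Gamma (((Module.finrank ℝ E : ℝ) + 1) / 2)
      / Real.pi ^ (((Module.finrank ℝ E : ℝ) + 1) / 2)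
    * (y / (‖x‖ ^ 2 + y ^ 2) ^ (((Module.finrank ℝ E : ℝ) + 1) / 2))

/-- The convolution `(|u| * P_y)(x) = ∫ |u z| P_y(x - z) dz`. The integrand is nonnegative, so the
integral always exists in `[0, ∞]`. -/
noncomputable def poissonExtensionAbs (u : E → ℝ) (y : ℝ) (x : E) : ℝ≥0∞ :=
  ∫⁻ z, ENNReal.ofReal (|u z| * halfSpacePoissonKernel y (x - z))

/-- The Poisson maximal function `x ↦ sup_{y > 0} (|u| * P_y)(x)`, with values in `[0, ∞]`. -/
noncomputable def poissonMaximal (u : E → ℝ) (x : E) : ℝ≥0∞ :=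
  ⨆ (y : ℝ) (_ : 0 < y), poissonExtensionAbs u y x

/-- `G` is a weak gradient of `u`: both are locally integrable and, for all test functions
`φ ∈ C_c^∞(E)` and all directions `v`, one has `∫ u ∂_v φ = - ∫ ⟨G, v⟩ φ`. For `E = ℝ` this says
that `G` is the weak derivative of `u`. -/
structure HasWeakGradient (u : E → ℝ) (G : E → E) : Prop where
  locallyIntegrable : LocallyIntegrable u volume
  locallyIntegrable_grad : LocallyIntegrable G volume
  integral_eq : ∀ φ : E → ℝ, ContDiff ℝ ∞ φ → HasCompactSupport φ → ∀ v : E,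
    ∫ x, u x * fderiv ℝ φ x v = - ∫ x, inner ℝ (G x) v * φ x

/-- The Sobolev space `W^{1,p}(E)`: functions in `L^p` with a weak gradient in `L^p`. -/
def MemW1 (p : ℝ≥0∞) (u : E → ℝ) : Prop :=
  MemLp u p volume ∧ ∃ G : E → E, HasWeakGradient u G ∧ MemLp G p volume

end PoissonMaximal

/-! ### Second differences on a line, and the Harnack inequality for the Poisson kernel. -/

section Kernel

/-! Let V(x, y) be the Poisson extension of |u₀|. It is harmonic in the half-space, and since P_y is
a probability density, Jensen's inequality shows that no V(·, y) has more energy than u₀. Fix ε > 0,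
put f = V(·, ε) and let g ≥ f be the supremum of V(·, y) over y ≥ ε (`poissonMaximalFrom`).

The point is that g is subharmonic wherever g > f (`poissonMaximalFrom_second_differences`). If the
supremum at x is attained at some y, then y > ε, so V(x, ·) has an interior maximum there. Its
second y-derivative is then nonpositive, hence the Laplacian of V(·, y) at x is nonnegative, and g
touches V(·, y) from above at x. If the supremum is only approached as y → ∞, the Harnack inequality
makes x a global minimum of g.

A function that is subharmonic off its contact set with f has no more energy than f. On the line, g
is convex on detached intervals, and the argument works for every even convex density ψ
(`PartialEnergy.le_of_contactData`): ψ(t) = |t| gives the variation, |t|^p the norm of the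
derivative, and (|t| - M)⁺ with large M absolute continuity. In higher dimension with p = 2, the
integral of |∇g|² is at most that of |∇f|² plus twice that of ∇g · ∇(g - f), and the last integral
is that of -Δg (g - f) ≤ 0 (`differenceEnergy_le_of_second_differences`). Then ε → 0. For p = ∞
translations suffice: the maximal function inherits the Lipschitz constant of u₀.

Derivatives of g are not available beforehand, so everything is phrased through chords and second
differences, with an error of order r³ for step r that disappears when the step is refined. The L^p
bounds for finite p > 1 come from the Hardy–Littlewood weak-type inequality. -/

theorem second_difference_ge {h h1 h2 : ℝ → ℝ} {r M : ℝ} (hr : 0 ≤ r)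
    (hd : ∀ t ∈ Icc (-r) r, HasDerivAt h (h1 t) t)
    (hd1 : ∀ t ∈ Icc (-r) r, HasDerivAt h1 (h2 t) t)
    (hM : ∀ t ∈ Icc (-r) r, |h2 t - h2 0| ≤ M) :
    r ^ 2 * (h2 0 - M) ≤ h r + h (-r) - 2 * h 0 := by
  have neg_mem : ∀ t ∈ Icc 0 r, -t ∈ Icc (-r) r := fun t ht => ⟨by linarith [ht.2], by linarith [ht.1]⟩
  have pos_mem : ∀ t ∈ Icc 0 r, t ∈ Icc (-r) r := fun t ht => ⟨by linarith [ht.1], by linarith [ht.2]⟩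
  have dneg : ∀ t : ℝ, HasDerivAt (fun t : ℝ => -t) (-1) t := fun t => hasDerivAt_neg t
  -- Subtracting the parabola `t ^ 2 * (h2 0 - M)` from `h t + h (-t)` leaves a function whose first
  -- derivative vanishes at 0 and whose second derivative is nonnegative on `[0, r]`.
  have D1 : ∀ t ∈ Icc 0 r, HasDerivAt (fun t => h1 t - h1 (-t) - 2 * t * (h2 0 - M))
      (h2 t + h2 (-t) - 2 * (h2 0 - M)) t := by
    intro t ht
    have A := hd1 t (pos_mem t ht)
    have B : HasDerivAt (fun t => h1 (-t)) (h2 (-t) * (-1)) t :=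
      (hd1 (-t) (neg_mem t ht)).comp t (dneg t)
    have C : HasDerivAt (fun t : ℝ => 2 * t * (h2 0 - M)) (2 * 1 * (h2 0 - M)) t :=
      ((hasDerivAt_id t).const_mul 2).mul_const _
    exact ((A.sub B).sub C).congr_deriv (by ring)
  have D0 : ∀ t ∈ Icc 0 r, HasDerivAt (fun t => h t + h (-t) - t ^ 2 * (h2 0 - M))
      (h1 t - h1 (-t) - 2 * t * (h2 0 - M)) t := by
    intro t ht
    have A := hd t (pos_mem t ht)
    have B : HasDerivAt (fun t => h (-t)) (h1 (-t) * (-1)) t :=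
      (hd (-t) (neg_mem t ht)).comp t (dneg t)
    have C : HasDerivAt (fun t : ℝ => t ^ 2 * (h2 0 - M)) (2 * t * (h2 0 - M)) t := by
      simpa using (hasDerivAt_pow 2 t).mul_const (h2 0 - M)
    exact ((A.add B).sub C).congr_deriv (by ring)
  have M1 : MonotoneOn (fun t => h1 t - h1 (-t) - 2 * t * (h2 0 - M)) (Icc 0 r) := by
    refine monotoneOn_of_deriv_nonneg (convex_Icc 0 r)
      (fun t ht => (D1 t ht).continuousAt.continuousWithinAt)
      (fun t ht => (D1 t (interior_subset ht)).differentiableAt.differentiableWithinAt) ?_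
    intro t ht
    have ht' := interior_subset ht
    rw [(D1 t ht').deriv]
    have a1 := abs_le.1 (hM t (pos_mem t ht'))
    have a2 := abs_le.1 (hM (-t) (neg_mem t ht'))
    linarith [a1.1, a2.1]
  have M0 : MonotoneOn (fun t => h t + h (-t) - t ^ 2 * (h2 0 - M)) (Icc 0 r) := by
    refine monotoneOn_of_deriv_nonneg (convex_Icc 0 r)
      (fun t ht => (D0 t ht).continuousAt.continuousWithinAt)
      (fun t ht => (D0 t (interior_subset ht)).differentiableAt.differentiableWithinAt) ?_
    intro t ht
    have ht' := interior_subset ht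
    rw [(D0 t ht').deriv]
    have := M1 (left_mem_Icc.2 hr) ht' ht'.1
    simpa using this
  have := M0 (left_mem_Icc.2 hr) (right_mem_Icc.2 hr) hr
  simp only [neg_zero] at this
  nlinarith

theorem second_difference_ge_of_third {h h1 h2 h3 : ℝ → ℝ} {r M : ℝ} (hr : 0 ≤ r)
    (hd : ∀ t ∈ Icc (-r) r, HasDerivAt h (h1 t) t)
    (hd1 : ∀ t ∈ Icc (-r) r, HasDerivAt h1 (h2 t) t)
    (hd2 : ∀ t ∈ Icc (-r) r, HasDerivAt h2 (h3 t) t)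
    (hM : ∀ t ∈ Icc (-r) r, |h3 t| ≤ M) :
    r ^ 2 * (h2 0 - M * r) ≤ h r + h (-r) - 2 * h 0 := by
  have h0 : (0 : ℝ) ∈ Icc (-r) r := ⟨by linarith, hr⟩
  have hM0 : 0 ≤ M := (abs_nonneg _).trans (hM 0 h0)
  refine second_difference_ge hr hd hd1 fun t ht => ?_
  have := (convex_Icc (-r) r).norm_image_sub_le_of_norm_hasDerivWithin_le
    (fun s hs => (hd2 s hs).hasDerivWithinAt) (fun s hs => by simpa using hM s hs) h0 ht
  simp only [Real.norm_eq_abs, sub_zero] at this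
  exact this.trans (mul_le_mul_of_nonneg_left (abs_le.2 ⟨ht.1, ht.2⟩) hM0)

variable {E : Type*} [NormedAddCommGroup E] [InnerProductSpace ℝ E]

theorem halfSpacePoissonKernel_pos {y : ℝ} (hy : 0 < y) (x : E) :
    0 < halfSpacePoissonKernel y x := by
  unfold halfSpacePoissonKernel
  have : 0 < Real.Gamma (((Module.finrank ℝ E : ℝ) + 1) / 2) := Real.Gamma_pos_of_pos (by positivity)
  positivity

theorem continuous_halfSpacePoissonKernel {y : ℝ} (hy : 0 < y) :
    Continuous (fun x : E => halfSpacePoissonKernel y x) := by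
  unfold halfSpacePoissonKernel
  refine continuous_const.mul (continuous_const.div ?_ fun x => by positivity)
  exact (by fun_prop : Continuous fun x : E => ‖x‖ ^ 2 + y ^ 2).rpow_const
    fun x => Or.inl (by positivity)

/-- The normalizing constant of the Poisson kernel. -/
noncomputable def poissonConst (E : Type*) [NormedAddCommGroup E] [InnerProductSpace ℝ E] : ℝ :=
  Real.Gamma (((Module.finrank ℝ E : ℝ) + 1) / 2) / Real.pi ^ (((Module.finrank ℝ E : ℝ) + 1) / 2)

theorem poissonConst_pos : 0 < poissonConst E := by
  unfold poissonConst
  have : 0 < Real.Gamma (((Module.finrank ℝ E : ℝ) + 1) / 2) := Real.Gamma_pos_of_pos (by positivity)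
  positivity

theorem halfSpacePoissonKernel_eq_sqrt (y : ℝ) (x : E) :
    halfSpacePoissonKernel y x =
      poissonConst E * (y / √(‖x‖ ^ 2 + y ^ 2) ^ (Module.finrank ℝ E + 1)) := by
  unfold halfSpacePoissonKernel poissonConst
  rw [Real.rpow_div_two_eq_sqrt _ (by positivity : 0 ≤ ‖x‖ ^ 2 + y ^ 2)]
  norm_cast

theorem halfSpacePoissonKernel_eq_rpow_neg (y : ℝ) (x : E) :
    halfSpacePoissonKernel y x =
      poissonConst E * (y * (‖x‖ ^ 2 + y ^ 2) ^ (-(((Module.finrank ℝ E : ℝ) + 1) / 2))) := by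
  unfold halfSpacePoissonKernel poissonConst
  rw [Real.rpow_neg (by positivity)]
  rfl

/-- A Harnack inequality for the Poisson kernel. -/
theorem halfSpacePoissonKernel_harnack {y y' δ : ℝ} (hy : 0 < y) (x x' : E)
    (h : ‖x' - x‖ + |y' - y| ≤ δ) (hδ : δ ≤ y) :
    (1 - δ / y) ^ (Module.finrank ℝ E + 2) * halfSpacePoissonKernel y x ≤
      halfSpacePoissonKernel y' x' := by
  set d := Module.finrank ℝ E
  have hδ0 : 0 ≤ δ := le_trans (by positivity) h
  rw [halfSpacePoissonKernel_eq_sqrt, halfSpacePoissonKernel_eq_sqrt]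
  set ρ := √(‖x‖ ^ 2 + y ^ 2) with hρ
  set ρ' := √(‖x'‖ ^ 2 + y' ^ 2) with hρ'
  have hρ2 : ρ ^ 2 = ‖x‖ ^ 2 + y ^ 2 := Real.sq_sqrt (by positivity)
  have hρ0 : 0 < ρ := Real.sqrt_pos.2 (by positivity)
  have hyρ : y ≤ ρ := Real.le_sqrt_of_sq_le (by nlinarith [sq_nonneg ‖x‖])
  have hxρ : ‖x‖ ≤ ρ := Real.le_sqrt_of_sq_le (by nlinarith [sq_nonneg y])
  have hx' : ‖x'‖ ≤ ‖x‖ + ‖x' - x‖ := by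
    simpa using norm_add_le x (x' - x)
  have hy' : |y'| ≤ y + |y' - y| := by
    have := abs_add_le y (y' - y)
    simpa [abs_of_pos hy] using this
  -- `ρ` and `ρ'` are the Euclidean norms of `(x, y)` and `(x', y')`, so this is the triangle
  -- inequality.
  have hρρ : ρ' ≤ ρ + δ := by
    refine Real.sqrt_le_iff.2 ⟨by positivity, ?_⟩
    have e1 : ‖x'‖ ^ 2 ≤ (‖x‖ + ‖x' - x‖) ^ 2 := by gcongr
    have e2 : y' ^ 2 ≤ (y + |y' - y|) ^ 2 := by rw [← sq_abs y']; gcongr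
    have e3 : (ρ + (‖x' - x‖ + |y' - y|)) ^ 2 ≤ (ρ + δ) ^ 2 := by gcongr
    nlinarith [norm_nonneg (x' - x), abs_nonneg (y' - y), norm_nonneg x,
      mul_nonneg (norm_nonneg (x' - x)) (abs_nonneg (y' - y)),
      mul_nonneg (norm_nonneg (x' - x)) (sub_nonneg.2 hxρ),
      mul_nonneg (abs_nonneg (y' - y)) (sub_nonneg.2 hyρ)]
  set t := δ / y with ht
  have ht0 : 0 ≤ t := by positivity
  have ht1 : t ≤ 1 := (div_le_one hy).2 hδ
  have hty : δ = t * y := by rw [ht]; field_simp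
  have hy1 : (1 - t) * y ≤ y' := by
    have := (abs_le.1 ((le_add_of_nonneg_left (norm_nonneg (x' - x))).trans h)).1
    nlinarith
  -- If `t = 1`, the level `y'` may be 0, but the left side vanishes. Otherwise the numerator costs
  -- one factor `1 - t`, and each of the `d + 1` powers of the norm in the denominator costs one
  -- more; hence the exponent `d + 2`.
  rcases eq_or_lt_of_le ht1 with h1 | h1
  · rw [h1] at hy1 ⊢
    have : 0 ≤ y' := by linarith
    simp only [sub_self, ne_eq, Nat.add_eq_zero_iff, OfNat.ofNat_ne_zero, and_false,
      not_false_eq_true, zero_pow, zero_mul]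
    exact mul_nonneg poissonConst_pos.le (by positivity)
  · have hy'0 : 0 < y' := lt_of_lt_of_le (mul_pos (by linarith) hy) hy1
    have hρ'0 : 0 < ρ' := Real.sqrt_pos.2 (by positivity)
    have hρρ' : ρ' ≤ ρ * (1 + t) := by nlinarith
    have hmain : (1 - t) * ρ' ≤ ρ := by
      calc (1 - t) * ρ' ≤ (1 - t) * (ρ * (1 + t)) := by gcongr
        _ = ρ * (1 - t ^ 2) := by ring
        _ ≤ ρ := by nlinarith [sq_nonneg t]
    have hpow : ((1 - t) * ρ') ^ (d + 1) ≤ ρ ^ (d + 1) := by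
      gcongr
    rw [mul_left_comm]
    refine mul_le_mul_of_nonneg_left ?_ poissonConst_pos.le
    rw [mul_div_assoc', div_le_div_iff₀ (by positivity) (by positivity)]
    calc (1 - t) ^ (d + 2) * y * ρ' ^ (d + 1) = ((1 - t) * y) * ((1 - t) * ρ') ^ (d + 1) := by
          rw [mul_pow]; ring
      _ ≤ y' * ρ ^ (d + 1) := by
        gcongr

theorem halfSpacePoissonKernel_le_two_pow {y y' : ℝ} (hy : 0 < y) (x x' : E)
    (h : ‖x' - x‖ + |y' - y| ≤ y / 2) :
    halfSpacePoissonKernel y x ≤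
      2 ^ (Module.finrank ℝ E + 2) * halfSpacePoissonKernel y' x' := by
  have := halfSpacePoissonKernel_harnack hy x x' h (by linarith)
  rw [show 1 - y / 2 / y = (1 / 2 : ℝ) by field_simp; norm_num, one_div, inv_pow,
    inv_mul_le_iff₀ (by positivity)] at this
  exact this

end Kernel

/-! ### Harmonicity of the Poisson kernel in terms of second differences. -/

section KernelSecondDifference

variable {E : Type*} [NormedAddCommGroup E] [InnerProductSpace ℝ E]

/-- The quotient of the third horizontal derivative by the kernel has this shape, with `k` the norm
of the point of the half-space and `s` the component of its horizontal part along the direction. -/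
theorem abs_cubic_div_le {k s y A B C : ℝ} (hy : 0 < y) (hyk : y ≤ k) (hs : |s| ≤ k)
    (hA : 0 ≤ A) (hB : 0 ≤ B) (hC : C = A + B) :
    |A * s / k ^ 4 - B * s ^ 3 / k ^ 6| ≤ C / y ^ 3 := by
  have hk : 0 < k := hy.trans_le hyk
  have h1 : |A * s / k ^ 4| ≤ A / y ^ 3 := by
    rw [abs_div, abs_mul, abs_of_nonneg hA, abs_of_pos (by positivity : 0 < k ^ 4)]
    calc A * |s| / k ^ 4 ≤ A * k / k ^ 4 := by gcongr
      _ = A / k ^ 3 := by field_simp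
      _ ≤ A / y ^ 3 := by gcongr
  have h2 : |B * s ^ 3 / k ^ 6| ≤ B / y ^ 3 := by
    rw [abs_div, abs_mul, abs_of_nonneg hB, abs_pow, abs_of_pos (by positivity : 0 < k ^ 6)]
    calc B * |s| ^ 3 / k ^ 6 ≤ B * k ^ 3 / k ^ 6 := by gcongr
      _ = B / k ^ 3 := by field_simp
      _ ≤ B / y ^ 3 := by gcongr
  calc _ ≤ |A * s / k ^ 4| + |B * s ^ 3 / k ^ 6| := abs_sub _ _
    _ ≤ A / y ^ 3 + B / y ^ 3 := add_le_add h1 h2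
    _ = C / y ^ 3 := by rw [hC]; ring

/-- A constant controlling the third derivatives of the Poisson kernel. -/
noncomputable def poissonThirdConst (E : Type*) [NormedAddCommGroup E] [InnerProductSpace ℝ E] : ℝ :=
  -- The bracket is `3(d+1) + 6(d+1)(d+3) + (d+1)(d+3)(d+5)`, the coefficients of the third vertical
  -- derivative; they dominate the horizontal ones. The factor 8 pays for levels as low as `y / 2`,
  -- and the power of 2 is the Harnack constant.
  let a := ((Module.finrank ℝ E : ℝ) + 1) / 2
  8 * (6 * a + 24 * a * (a + 1) + 8 * a * (a + 1) * (a + 2)) * 2 ^ (Module.finrank ℝ E + 2)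

theorem poissonThirdConst_nonneg : 0 ≤ poissonThirdConst E := by
  unfold poissonThirdConst
  positivity

/-- The large bracket is the exact second derivative along `e`. The third derivative is the kernel
at a nearby point times a factor bounded by a multiple of `1 / y ^ 3`, and the Harnack inequality
moves the kernel back to `x`. An error proportional to the kernel itself survives integration
against `|u|`. -/
theorem poisson_second_difference_horizontal {y r : ℝ} (hy : 0 < y) (hr : 0 ≤ r) (hry : r ≤ y / 2)
    (x e : E) (he : ‖e‖ = 1) :
    r ^ 2 * (poissonConst E * (y * (-((Module.finrank ℝ E : ℝ) + 1)
        * (‖x‖ ^ 2 + y ^ 2) ^ (-(((Module.finrank ℝ E : ℝ) + 1) / 2) - 1)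
        + ((Module.finrank ℝ E : ℝ) + 1) * ((Module.finrank ℝ E : ℝ) + 3) * inner ℝ x e ^ 2
          * (‖x‖ ^ 2 + y ^ 2) ^ (-(((Module.finrank ℝ E : ℝ) + 1) / 2) - 1 - 1)))
        - poissonThirdConst E / y ^ 3 * halfSpacePoissonKernel y x * r) ≤
      halfSpacePoissonKernel y (x + r • e) + halfSpacePoissonKernel y (x - r • e)
        - 2 * halfSpacePoissonKernel y x := by
  set d : ℝ := (Module.finrank ℝ E : ℝ) with hd
  set a : ℝ := (d + 1) / 2 with ha
  have ha0 : 0 ≤ a := by positivity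
  set b : ℝ := inner ℝ x e with hb
  set c := poissonConst E with hc
  have hc0 : 0 < c := poissonConst_pos
  let Q : ℝ → ℝ := fun t => ‖x + t • e‖ ^ 2 + y ^ 2
  have hQ : ∀ t, Q t = ‖x‖ ^ 2 + 2 * t * b + t ^ 2 + y ^ 2 := by
    intro t
    simp only [Q]
    rw [norm_add_sq_real, inner_smul_right, norm_smul, he]
    simp [hb]; ring
  have hQy : ∀ t, y ^ 2 ≤ Q t := fun t => by simp only [Q]; nlinarith [sq_nonneg ‖x + t • e‖]
  have hQ0 : ∀ t, 0 < Q t := fun t => (by positivity : 0 < y ^ 2).trans_le (hQy t)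
  have hbx : b ^ 2 ≤ ‖x‖ ^ 2 := by
    have := abs_real_inner_le_norm x e
    rw [he, mul_one] at this
    exact sq_le_sq.2 (by simpa [hb] using this)
  have hsQ : ∀ t, (b + t) ^ 2 ≤ Q t := fun t => by rw [hQ]; nlinarith [sq_nonneg y]
  have dQ : ∀ t, HasDerivAt Q (2 * (b + t)) t := by
    intro t
    have h : Q = fun t => ‖x‖ ^ 2 + 2 * t * b + t ^ 2 + y ^ 2 := funext hQ
    rw [h]
    have := ((((hasDerivAt_id t).const_mul (2 : ℝ)).mul_const b).const_add (‖x‖ ^ 2)).add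
      (hasDerivAt_pow 2 t) |>.add_const (y ^ 2)
    exact this.congr_deriv (by simp; ring)
  have dQp : ∀ (p t : ℝ), HasDerivAt (fun t => Q t ^ p) (2 * (b + t) * p * Q t ^ (p - 1)) t :=
    fun p t => (dQ t).rpow_const (Or.inl (hQ0 t).ne')
  have ds : ∀ t : ℝ, HasDerivAt (fun t => b + t) 1 t := fun t => (hasDerivAt_id t).const_add b
  have key := second_difference_ge_of_third (r := r)
    (h := fun t => c * (y * Q t ^ (-a)))
    (h1 := fun t => c * (y * (-(d + 1) * (b + t) * Q t ^ (-a - 1))))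
    (h2 := fun t => c * (y * (-(d + 1) * Q t ^ (-a - 1)
      + (d + 1) * (d + 3) * (b + t) ^ 2 * Q t ^ (-a - 1 - 1))))
    (h3 := fun t => c * (y * (3 * (d + 1) * (d + 3) * (b + t) * Q t ^ (-a - 1 - 1)
      - (d + 1) * (d + 3) * (d + 5) * (b + t) ^ 3 * Q t ^ (-a - 1 - 1 - 1))))
    (M := poissonThirdConst E / y ^ 3 * halfSpacePoissonKernel y x) hr
    (fun t _ => by
      refine (((dQp (-a) t).const_mul y).const_mul c).congr_deriv ?_
      rw [ha]; ring)
    (fun t _ => by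
      refine (((((ds t).const_mul (-(d + 1))).mul (dQp (-a - 1) t)).const_mul y).const_mul c).congr_deriv ?_
      rw [ha]; ring)
    (fun t _ => by
      refine (((((dQp (-a - 1) t).const_mul (-(d + 1))).add
        (((((ds t).pow 2).const_mul ((d + 1) * (d + 3))).mul
          (dQp (-a - 1 - 1) t)))).const_mul y).const_mul c).congr_deriv ?_
      simp only [Pi.pow_apply]
      rw [ha]; push_cast; ring)
    (fun t ht => by
      have hk : √(Q t) ^ 2 = Q t := Real.sq_sqrt (hQ0 t).le
      have hcub := abs_cubic_div_le (k := √(Q t)) (s := b + t) (A := 3 * (d + 1) * (d + 3))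
        (B := (d + 1) * (d + 3) * (d + 5)) (C := 3 * (d + 1) * (d + 3) + (d + 1) * (d + 3) * (d + 5))
        hy (Real.le_sqrt_of_sq_le (hQy t)) (Real.abs_le_sqrt (hsQ t)) (by positivity) (by positivity) rfl
      have hP : halfSpacePoissonKernel y (x + t • e) = c * (y * Q t ^ (-a)) :=
        halfSpacePoissonKernel_eq_rpow_neg y _
      have hcmp : halfSpacePoissonKernel y (x + t • e) ≤
          2 ^ (Module.finrank ℝ E + 2) * halfSpacePoissonKernel y x := by
        apply halfSpacePoissonKernel_le_two_pow hy
        rw [sub_self, abs_zero, add_zero, ← norm_neg]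
        simp only [neg_sub, add_sub_cancel_left, norm_smul, he, mul_one, Real.norm_eq_abs]
        exact (abs_le.2 ⟨ht.1, ht.2⟩).trans hry
      have e : c * (y * (3 * (d + 1) * (d + 3) * (b + t) * Q t ^ (-a - 1 - 1)
          - (d + 1) * (d + 3) * (d + 5) * (b + t) ^ 3 * Q t ^ (-a - 1 - 1 - 1))) =
          c * (y * Q t ^ (-a)) * (3 * (d + 1) * (d + 3) * (b + t) / √(Q t) ^ 4
            - (d + 1) * (d + 3) * (d + 5) * (b + t) ^ 3 / √(Q t) ^ 6) := by
        rw [show √(Q t) ^ 4 = Q t * Q t by rw [← hk]; ring_nf; rw [hk],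
          show √(Q t) ^ 6 = Q t * Q t * Q t by rw [← hk]; ring_nf; rw [hk],
          Real.rpow_sub_one (hQ0 t).ne' (-a - 1 - 1), Real.rpow_sub_one (hQ0 t).ne' (-a - 1),
          Real.rpow_sub_one (hQ0 t).ne' (-a)]
        have := (hQ0 t).ne'
        field_simp
      rw [e, abs_mul, ← hP, abs_of_pos (halfSpacePoissonKernel_pos hy _)]
      calc _ ≤ 2 ^ (Module.finrank ℝ E + 2) * halfSpacePoissonKernel y x *
            ((3 * (d + 1) * (d + 3) + (d + 1) * (d + 3) * (d + 5)) / y ^ 3) :=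
            mul_le_mul hcmp hcub (abs_nonneg _) (by have := halfSpacePoissonKernel_pos hy x; positivity)
        _ = (3 * (d + 1) * (d + 3) + (d + 1) * (d + 3) * (d + 5)) * 2 ^ (Module.finrank ℝ E + 2)
            / y ^ 3 * halfSpacePoissonKernel y x := by ring
        _ ≤ _ := by
          refine mul_le_mul_of_nonneg_right ?_ (halfSpacePoissonKernel_pos hy x).le
          gcongr
          unfold poissonThirdConst
          simp only
          rw [← hd, ← ha]
          gcongr
          have : d = 2 * a - 1 := by rw [ha]; ring
          have h1 : 0 ≤ a * (a + 1) := by positivity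
          have h2 : 0 ≤ a * (a + 1) * (a + 2) := by positivity
          rw [this]
          nlinarith)
  simp only [hQ, add_zero, mul_zero, ne_eq, OfNat.ofNat_ne_zero, not_false_eq_true, zero_pow,
    zero_mul] at key
  rw [halfSpacePoissonKernel_eq_rpow_neg y (x + r • e), halfSpacePoissonKernel_eq_rpow_neg y (x - r • e)]
  have e2 := hQ (-r)
  have e1 := hQ r
  simp only [Q, neg_smul, ← sub_eq_add_neg] at e1 e2
  rw [e1, e2]
  refine key.trans (le_of_eq ?_)
  rw [halfSpacePoissonKernel_eq_rpow_neg y x]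

theorem poisson_second_difference_vertical {y r : ℝ} (hy : 0 < y) (hr : 0 ≤ r) (hry : r ≤ y / 4)
    (x : E) :
    r ^ 2 * (poissonConst E * (-3 * ((Module.finrank ℝ E : ℝ) + 1) * y
        * (‖x‖ ^ 2 + y ^ 2) ^ (-(((Module.finrank ℝ E : ℝ) + 1) / 2) - 1)
        + ((Module.finrank ℝ E : ℝ) + 1) * ((Module.finrank ℝ E : ℝ) + 3) * y ^ 3
          * (‖x‖ ^ 2 + y ^ 2) ^ (-(((Module.finrank ℝ E : ℝ) + 1) / 2) - 1 - 1))
        - poissonThirdConst E / y ^ 3 * halfSpacePoissonKernel y x * r) ≤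
      halfSpacePoissonKernel (y + r) x + halfSpacePoissonKernel (y - r) x
        - 2 * halfSpacePoissonKernel y x := by
  set d : ℝ := (Module.finrank ℝ E : ℝ) with hd
  set a : ℝ := (d + 1) / 2 with ha
  have ha0 : 0 ≤ a := by positivity
  set c := poissonConst E with hc
  have hc0 : 0 < c := poissonConst_pos
  let Q : ℝ → ℝ := fun t => ‖x‖ ^ 2 + (y + t) ^ 2
  have hys : ∀ t ∈ Icc (-r) r, y / 2 ≤ y + t := fun t ht => by linarith [ht.1]
  have hQy : ∀ t, (y + t) ^ 2 ≤ Q t := fun t => by simp only [Q]; nlinarith [sq_nonneg ‖x‖]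
  have hs0 : ∀ t ∈ Icc (-r) r, 0 < y + t := fun t ht => by linarith [hys t ht]
  have hQ0 : ∀ t ∈ Icc (-r) r, 0 < Q t := fun t ht => by
    have := hs0 t ht
    exact (by positivity : 0 < (y + t) ^ 2).trans_le (hQy t)
  have ds : ∀ t : ℝ, HasDerivAt (fun t => y + t) 1 t := fun t => (hasDerivAt_id t).const_add y
  have dQ : ∀ t, HasDerivAt Q (2 * (y + t)) t := fun t =>
    (((ds t).pow 2).const_add (‖x‖ ^ 2)).congr_deriv (by simp)
  have dQp : ∀ (p t : ℝ), t ∈ Icc (-r) r →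
      HasDerivAt (fun t => Q t ^ p) (2 * (y + t) * p * Q t ^ (p - 1)) t :=
    fun p t ht => (dQ t).rpow_const (Or.inl (hQ0 t ht).ne')
  have key := second_difference_ge_of_third (r := r)
    (h := fun t => c * ((y + t) * Q t ^ (-a)))
    (h1 := fun t => c * (Q t ^ (-a) - (d + 1) * (y + t) ^ 2 * Q t ^ (-a - 1)))
    (h2 := fun t => c * (-3 * (d + 1) * (y + t) * Q t ^ (-a - 1)
      + (d + 1) * (d + 3) * (y + t) ^ 3 * Q t ^ (-a - 1 - 1)))
    (h3 := fun t => c * (-3 * (d + 1) * Q t ^ (-a - 1)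
      + 6 * (d + 1) * (d + 3) * (y + t) ^ 2 * Q t ^ (-a - 1 - 1)
      - (d + 1) * (d + 3) * (d + 5) * (y + t) ^ 4 * Q t ^ (-a - 1 - 1 - 1)))
    (M := poissonThirdConst E / y ^ 3 * halfSpacePoissonKernel y x) hr
    (fun t ht => by
      refine (((ds t).mul (dQp (-a) t ht)).const_mul c).congr_deriv ?_
      rw [ha]; ring)
    (fun t ht => by
      refine (((dQp (-a) t ht).sub
        ((((ds t).pow 2).const_mul (d + 1)).mul (dQp (-a - 1) t ht))).const_mul c).congr_deriv ?_
      simp only [Pi.pow_apply]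
      rw [ha]; push_cast; ring)
    (fun t ht => by
      refine (((((ds t).const_mul (-3 * (d + 1))).mul (dQp (-a - 1) t ht)).add
        ((((ds t).pow 3).const_mul ((d + 1) * (d + 3))).mul
          (dQp (-a - 1 - 1) t ht))).const_mul c).congr_deriv ?_
      simp only [Pi.pow_apply]
      rw [ha]; push_cast; ring)
    (fun t ht => by
      have hQt := hQ0 t ht
      have hst := hs0 t ht
      have hP : halfSpacePoissonKernel (y + t) x = c * ((y + t) * Q t ^ (-a)) :=
        halfSpacePoissonKernel_eq_rpow_neg _ _
      have hcmp : halfSpacePoissonKernel (y + t) x ≤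
          2 ^ (Module.finrank ℝ E + 2) * halfSpacePoissonKernel y x := by
        -- The Harnack inequality is applied from level `y + t` to level `y`. The restriction `r ≤ y
        -- / 4` keeps `|t|` below half of `y + t`.
        have h := halfSpacePoissonKernel_harnack hst (δ := |t|) x x (y' := y) (by simp) (by
          rw [abs_le]; constructor <;> linarith [ht.1, ht.2])
        have h2 : (1 / 2 : ℝ) ≤ 1 - |t| / (y + t) := by
          rw [le_sub_comm, div_le_iff₀ hst]
          rcases abs_cases t with h | h <;> linarith [ht.1, ht.2]
        have h3 : (1 / 2 : ℝ) ^ (Module.finrank ℝ E + 2) ≤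
          (1 - |t| / (y + t)) ^ (Module.finrank ℝ E + 2) := by gcongr
        have h4 := (mul_le_mul_of_nonneg_right h3 (halfSpacePoissonKernel_pos hst x).le).trans h
        rwa [one_div, inv_pow, inv_mul_le_iff₀ (by positivity)] at h4
      set R := (y + t) ^ 2 / Q t with hR
      have hR0 : 0 ≤ R := by positivity
      have hR1 : R ≤ 1 := (div_le_one hQt).2 (hQy t)
      have e : c * (-3 * (d + 1) * Q t ^ (-a - 1)
          + 6 * (d + 1) * (d + 3) * (y + t) ^ 2 * Q t ^ (-a - 1 - 1)
          - (d + 1) * (d + 3) * (d + 5) * (y + t) ^ 4 * Q t ^ (-a - 1 - 1 - 1)) =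
          c * ((y + t) * Q t ^ (-a)) * ((R * (-3 * (d + 1) + 6 * (d + 1) * (d + 3) * R
            - (d + 1) * (d + 3) * (d + 5) * R ^ 2)) / (y + t) ^ 3) := by
        rw [Real.rpow_sub_one hQt.ne' (-a - 1 - 1), Real.rpow_sub_one hQt.ne' (-a - 1),
          Real.rpow_sub_one hQt.ne' (-a), hR]
        field_simp
      have hd0 : 0 ≤ d := by positivity
      have hcub : |R * (-3 * (d + 1) + 6 * (d + 1) * (d + 3) * R
            - (d + 1) * (d + 3) * (d + 5) * R ^ 2)| ≤
            3 * (d + 1) + 6 * (d + 1) * (d + 3) + (d + 1) * (d + 3) * (d + 5) := by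
        have k1 : 0 ≤ (d + 1) * (d + 3) := by positivity
        have k2 : 0 ≤ (d + 1) * (d + 3) * (d + 5) := by positivity
        have k3 : R ^ 2 ≤ 1 := by nlinarith
        rw [abs_mul, abs_of_nonneg hR0]
        refine (mul_le_of_le_one_left (abs_nonneg _) hR1).trans (abs_le.2 ⟨?_, ?_⟩)
        · nlinarith [mul_nonneg k1 hR0, mul_nonneg k2 (sub_nonneg.2 k3)]
        · nlinarith [mul_nonneg k1 (sub_nonneg.2 hR1), mul_nonneg k2 (sq_nonneg R)]
      have hcub2 : |(R * (-3 * (d + 1) + 6 * (d + 1) * (d + 3) * R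
            - (d + 1) * (d + 3) * (d + 5) * R ^ 2)) / (y + t) ^ 3| ≤
            8 * (3 * (d + 1) + 6 * (d + 1) * (d + 3) + (d + 1) * (d + 3) * (d + 5)) / y ^ 3 := by
        rw [abs_div, abs_of_pos (by positivity : 0 < (y + t) ^ 3),
          div_le_div_iff₀ (by positivity) (by positivity)]
        have h8 : y ^ 3 ≤ 8 * (y + t) ^ 3 := by
          have : (y / 2) ^ 3 ≤ (y + t) ^ 3 := by have := hys t ht; gcongr
          nlinarith
        calc _ ≤ (3 * (d + 1) + 6 * (d + 1) * (d + 3) + (d + 1) * (d + 3) * (d + 5))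
              * (8 * (y + t) ^ 3) := by gcongr
          _ = _ := by ring
      rw [e, abs_mul, ← hP, abs_of_pos (halfSpacePoissonKernel_pos hst _)]
      calc _ ≤ 2 ^ (Module.finrank ℝ E + 2) * halfSpacePoissonKernel y x *
            (8 * (3 * (d + 1) + 6 * (d + 1) * (d + 3) + (d + 1) * (d + 3) * (d + 5)) / y ^ 3) :=
            mul_le_mul hcmp hcub2 (abs_nonneg _) (by have := halfSpacePoissonKernel_pos hy x; positivity)
        _ = poissonThirdConst E / y ^ 3 * halfSpacePoissonKernel y x := by
          unfold poissonThirdConst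
          simp only
          rw [← hd]; ring)
  simp only [Q, add_zero, ← sub_eq_add_neg] at key
  rw [halfSpacePoissonKernel_eq_rpow_neg (y + r) x, halfSpacePoissonKernel_eq_rpow_neg (y - r) x]
  refine key.trans (le_of_eq ?_)
  rw [halfSpacePoissonKernel_eq_rpow_neg y x]

/-- Harmonicity of the Poisson kernel, in the form of a bound for its second differences. -/
theorem poisson_second_differences {ι : Type*} [Fintype ι] (b : OrthonormalBasis ι ℝ E) {y r s : ℝ}
    (hy : 0 < y) (hr : 0 < r) (hry : r ≤ y / 2) (hs : 0 < s) (hsy : s ≤ y / 4) (x : E) :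
    0 ≤ (∑ i, (halfSpacePoissonKernel y (x + r • b i) + halfSpacePoissonKernel y (x - r • b i)
        - 2 * halfSpacePoissonKernel y x)) / r ^ 2
      + (halfSpacePoissonKernel (y + s) x + halfSpacePoissonKernel (y - s) x
        - 2 * halfSpacePoissonKernel y x) / s ^ 2
      + poissonThirdConst E / y ^ 3 * (Fintype.card ι * r + s) * halfSpacePoissonKernel y x := by
  have V := poisson_second_difference_vertical hy hs.le hsy x
  have H := Finset.sum_le_sum fun i (_ : i ∈ Finset.univ) =>
    poisson_second_difference_horizontal hy hr.le hry x (b i) (b.orthonormal.1 i)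
  rw [← Finset.mul_sum, mul_comm, ← le_div_iff₀ (by positivity)] at H
  rw [mul_comm, ← le_div_iff₀ (by positivity)] at V
  rw [Finset.sum_sub_distrib, ← Finset.mul_sum, ← Finset.mul_sum, Finset.sum_add_distrib,
    ← Finset.sum_mul, ← Finset.sum_mul, ← Finset.mul_sum] at H
  have hsum : ∑ i, inner ℝ x (b i) ^ 2 = ‖x‖ ^ 2 := by
    have := b.sum_sq_norm_inner_left x
    simpa [sq_abs] using this
  have hcard : (Fintype.card ι : ℝ) = Module.finrank ℝ E := by
    rw [Module.finrank_eq_card_basis b.toBasis]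
  rw [hsum] at H
  simp only [Finset.sum_const, Finset.card_univ, nsmul_eq_mul] at H
  have hq : 0 < ‖x‖ ^ 2 + y ^ 2 := by positivity
  rw [Real.rpow_sub_one hq.ne' (_ - 1)] at H V
  rw [hcard] at H ⊢
  -- This is harmonicity itself: the horizontal second derivatives, summed over the basis, cancel
  -- the vertical one.
  have hV : ∀ (d A : ℝ), y * (d * (-(d + 1) * A) + (d + 1) * (d + 3) * ‖x‖ ^ 2 * (A / (‖x‖ ^ 2 + y ^ 2)))
      + (-3 * (d + 1) * y * A + (d + 1) * (d + 3) * y ^ 3 * (A / (‖x‖ ^ 2 + y ^ 2))) = 0 := by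
    intro d A
    field_simp
    ring
  have := congrArg (poissonConst E * ·) (hV (Module.finrank ℝ E)
    ((‖x‖ ^ 2 + y ^ 2) ^ (-(((Module.finrank ℝ E : ℝ) + 1) / 2) - 1)))
  simp only [mul_add, mul_zero] at this H V ⊢
  linarith

end KernelSecondDifference

/-! ### Poisson extensions and the truncated maximal function: total mass, Harnack inequality,
continuity. -/

section PoissonExtension

open Filter Topology

/-- The Bochner integral of a non-integrable function is 0 by default, so a positive value certifies
integrability. -/
theorem lintegral_ofReal_of_integral_eq {α : Type*} [MeasurableSpace α] {μ : Measure α} {f : α → ℝ}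
    {c : ℝ} (hf : 0 ≤ᵐ[μ] f) (hc : 0 < c) (h : ∫ x, f x ∂μ = c) :
    ∫⁻ x, ENNReal.ofReal (f x) ∂μ = ENNReal.ofReal c := by
  have hi : Integrable f μ := by
    by_contra hi
    rw [integral_undef hi] at h
    exact hc.ne h
  rw [← h, ofReal_integral_eq_lintegral_ofReal hi hf]

variable {E : Type*} [NormedAddCommGroup E] [InnerProductSpace ℝ E] [FiniteDimensional ℝ E]
  [MeasurableSpace E] [BorelSpace E]

theorem integral_add_sub_two_mul {α : Type*} [MeasurableSpace α] {μ : Measure α} {f g h : α → ℝ}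
    (hf : Integrable f μ) (hg : Integrable g μ) (hh : Integrable h μ) :
    ∫ x, (f x + g x - 2 * h x) ∂μ = ∫ x, f x ∂μ + ∫ x, g x ∂μ - 2 * ∫ x, h x ∂μ := by
  have := integral_sub (hf.add hg) (hh.const_mul 2)
  rw [integral_add' hf hg, integral_const_mul] at this
  exact this

theorem lintegral_rpow_mul_exp_eq {a q : ℝ} (ha : 0 < a) (hq : 0 < q) :
    ∫⁻ t in Ioi (0 : ℝ), ENNReal.ofReal (t ^ (a - 1) * Real.exp (-(q * t))) =
      ENNReal.ofReal (Real.Gamma a * q ^ (-a)) := by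
  refine lintegral_ofReal_of_integral_eq ?_ ?_ ?_
  · filter_upwards [ae_restrict_mem measurableSet_Ioi] with t ht
    have : (0 : ℝ) < t := ht
    exact mul_nonneg (Real.rpow_nonneg this.le _) (Real.exp_pos _).le
  · exact mul_pos (Real.Gamma_pos_of_pos ha) (Real.rpow_pos_of_pos hq _)
  · rw [Real.integral_rpow_mul_exp_neg_mul_Ioi ha hq, one_div, Real.inv_rpow hq.le,
      Real.rpow_neg hq.le, mul_comm]

/-- The Poisson kernel has total mass one. -/
theorem lintegral_halfSpacePoissonKernel {y : ℝ} (hy : 0 < y) :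
    ∫⁻ z : E, ENNReal.ofReal (halfSpacePoissonKernel y z) = 1 := by
  set d : ℝ := (Module.finrank ℝ E : ℝ) with hd
  set a : ℝ := (d + 1) / 2 with ha
  have hd0 : 0 ≤ d := by positivity
  have ha0 : 0 < a := by positivity
  have hG : 0 < Real.Gamma a := Real.Gamma_pos_of_pos ha0
  have hpi := Real.pi_pos
  -- Subordination: the kernel is a Gamma integral of Gaussians. By Tonelli the Gaussians are
  -- integrated in `z` first, which leaves the Gamma integral with exponent 1/2.
  have e1 : ∀ z : E, ENNReal.ofReal (halfSpacePoissonKernel y z) =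
      ENNReal.ofReal (y / Real.pi ^ a) * ∫⁻ t in Ioi (0 : ℝ),
        ENNReal.ofReal (t ^ (a - 1) * Real.exp (-((‖z‖ ^ 2 + y ^ 2) * t))) := by
    intro z
    rw [lintegral_rpow_mul_exp_eq ha0 (by positivity), ← ENNReal.ofReal_mul (by positivity),
      halfSpacePoissonKernel_eq_rpow_neg]
    congr 1
    unfold poissonConst
    rw [← hd, ← ha]
    ring
  simp_rw [e1]
  have meas : Measurable (fun p : E × ℝ =>
      ENNReal.ofReal (p.2 ^ (a - 1) * Real.exp (-((‖p.1‖ ^ 2 + y ^ 2) * p.2)))) := by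
    fun_prop
  rw [lintegral_const_mul _ meas.lintegral_prod_right', lintegral_lintegral_swap meas.aemeasurable]
  have e2 : ∀ t ∈ Ioi (0 : ℝ), ∫⁻ z : E,
      ENNReal.ofReal (t ^ (a - 1) * Real.exp (-((‖z‖ ^ 2 + y ^ 2) * t))) =
      ENNReal.ofReal (Real.pi ^ (d / 2)) *
        ENNReal.ofReal (t ^ ((1 / 2 : ℝ) - 1) * Real.exp (-(y ^ 2 * t))) := by
    intro t ht
    have ht : (0 : ℝ) < t := ht
    rw [← ENNReal.ofReal_mul (by positivity)]
    refine lintegral_ofReal_of_integral_eq (.of_forall fun z => ?_) (by positivity) ?_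
    · positivity
    · have : ∀ z : E, t ^ (a - 1) * Real.exp (-((‖z‖ ^ 2 + y ^ 2) * t)) =
          (t ^ (a - 1) * Real.exp (-(y ^ 2 * t))) * Real.exp (-t * ‖z‖ ^ 2) := by
        intro z
        rw [mul_assoc, ← Real.exp_add]
        ring_nf
      simp_rw [this]
      rw [integral_const_mul, GaussianFourier.integral_rexp_neg_mul_sq_norm ht, ← hd,
        Real.div_rpow hpi.le ht.le, show (1 / 2 : ℝ) - 1 = a - 1 - d / 2 by rw [ha]; ring,
        Real.rpow_sub ht (a - 1)]
      ring
  rw [setLIntegral_congr_fun measurableSet_Ioi e2, lintegral_const_mul _ (by fun_prop),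
    lintegral_rpow_mul_exp_eq (by norm_num) (by positivity), ← ENNReal.ofReal_mul (by positivity),
    ← ENNReal.ofReal_mul (by positivity), Real.Gamma_one_half_eq, Real.sqrt_eq_rpow]
  rw [ENNReal.ofReal_eq_one, Real.rpow_neg (by positivity), ← Real.sqrt_eq_rpow (y ^ 2),
    Real.sqrt_sq hy.le]
  have : Real.pi ^ a = Real.pi ^ (d / 2) * Real.pi ^ (1 / 2 : ℝ) := by
    rw [← Real.rpow_add hpi]; congr 1; rw [ha]; ring
  rw [this]
  field_simp

theorem integrable_halfSpacePoissonKernel {y : ℝ} (hy : 0 < y) :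
    Integrable (fun z : E => halfSpacePoissonKernel y z) := by
  refine ⟨(continuous_halfSpacePoissonKernel hy).aestronglyMeasurable, ?_⟩
  rw [hasFiniteIntegral_iff_ofReal (.of_forall fun z => (halfSpacePoissonKernel_pos hy z).le),
    lintegral_halfSpacePoissonKernel hy]
  exact ENNReal.one_lt_top

theorem integral_halfSpacePoissonKernel {y : ℝ} (hy : 0 < y) :
    ∫ z : E, halfSpacePoissonKernel y z = 1 := by
  rw [integral_eq_lintegral_of_nonneg_ae
    (.of_forall fun z => (halfSpacePoissonKernel_pos hy z).le)
    (continuous_halfSpacePoissonKernel hy).aestronglyMeasurable,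
    lintegral_halfSpacePoissonKernel hy, ENNReal.toReal_one]

/-- Harnack inequality for Poisson extensions. -/
theorem poissonExtensionAbs_harnack (u : E → ℝ) {y y' δ : ℝ} (hy : 0 < y) (x x' : E)
    (h : ‖x' - x‖ + |y' - y| ≤ δ) (hδ : δ ≤ y) :
    ENNReal.ofReal ((1 - δ / y) ^ (Module.finrank ℝ E + 2)) * poissonExtensionAbs u y x ≤
      poissonExtensionAbs u y' x' := by
  unfold poissonExtensionAbs
  refine (lintegral_const_mul_le _ _).trans (lintegral_mono fun z => ?_)
  rw [← ENNReal.ofReal_mul (pow_nonneg (by rw [sub_nonneg, div_le_one hy]; exact hδ) _)]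
  refine ENNReal.ofReal_le_ofReal ?_
  rw [mul_left_comm]
  refine mul_le_mul_of_nonneg_left ?_ (abs_nonneg _)
  exact halfSpacePoissonKernel_harnack hy _ _ (by simpa using h) hδ

/-- The truncated Poisson maximal function, in which only the levels `y ≥ ε` are used. -/
noncomputable def poissonMaximalFrom (u : E → ℝ) (ε : ℝ) (x : E) : ℝ≥0∞ :=
  ⨆ (y : ℝ) (_ : ε ≤ y), poissonExtensionAbs u y x

theorem poissonExtensionAbs_le_from (u : E → ℝ) {ε y : ℝ} (h : ε ≤ y) (x : E) :
    poissonExtensionAbs u y x ≤ poissonMaximalFrom u ε x :=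
  le_iSup₂_of_le y h le_rfl

theorem poissonMaximalFrom_le (u : E → ℝ) {ε : ℝ} (hε : 0 < ε) (x : E) :
    poissonMaximalFrom u ε x ≤ poissonMaximal u x :=
  iSup₂_le fun y hy => le_iSup₂_of_le y (hε.trans_le hy) le_rfl

theorem poissonMaximalFrom_anti (u : E → ℝ) {ε ε' : ℝ} (h : ε ≤ ε') (x : E) :
    poissonMaximalFrom u ε' x ≤ poissonMaximalFrom u ε x :=
  iSup₂_le fun y hy => le_iSup₂_of_le y (h.trans hy) le_rfl

theorem tendsto_poissonMaximalFrom (u : E → ℝ) (x : E) :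
    Tendsto (fun k : ℕ => poissonMaximalFrom u (1 / ((k : ℝ) + 1)) x) atTop (𝓝 (poissonMaximal u x)) := by
  have hmono : Monotone (fun k : ℕ => poissonMaximalFrom u (1 / ((k : ℝ) + 1)) x) := by
    intro k l hkl
    apply poissonMaximalFrom_anti
    gcongr
  convert tendsto_atTop_iSup hmono using 2
  refine le_antisymm (iSup₂_le fun y hy => ?_) (iSup_le fun k => poissonMaximalFrom_le u (by positivity) x)
  obtain ⟨k, hk⟩ := exists_nat_one_div_lt hy
  exact le_iSup_of_le k (poissonExtensionAbs_le_from u hk.le x)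

/-- All levels `y ≥ ε` share the Harnack factor of the lowest one. This is the advantage of
truncating. -/
theorem poissonMaximalFrom_harnack (u : E → ℝ) {ε δ : ℝ} (hε : 0 < ε) (x x' : E)
    (h : ‖x' - x‖ ≤ δ) (hδ : δ ≤ ε) :
    ENNReal.ofReal ((1 - δ / ε) ^ (Module.finrank ℝ E + 2)) * poissonMaximalFrom u ε x ≤
      poissonMaximalFrom u ε x' := by
  have hδ0 : 0 ≤ δ := (norm_nonneg _).trans h
  rw [poissonMaximalFrom]
  simp_rw [ENNReal.mul_iSup]
  refine iSup₂_le fun y hy => ?_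
  have hy0 := hε.trans_le hy
  refine le_trans ?_ ((poissonExtensionAbs_harnack u hy0 x x' (y' := y) (δ := δ) (by simpa using h)
    (hδ.trans hy)).trans (poissonExtensionAbs_le_from u hy x'))
  gcongr
  rw [sub_nonneg, div_le_one hε]; exact hδ

theorem lowerSemicontinuous_of_harnack {X : Type*} [NormedAddCommGroup X] {F : X → ℝ≥0∞} {y : ℝ} (hy : 0 < y) {n : ℕ}
    (hF : ∀ x x', ‖x' - x‖ ≤ y → ENNReal.ofReal ((1 - ‖x' - x‖ / y) ^ n) * F x ≤ F x') :
    LowerSemicontinuous F := by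
  intro x b hb
  have hc : Continuous fun x' : X => (1 - ‖x' - x‖ / y) ^ n := by fun_prop
  have h1 : Tendsto (fun x' : X => ENNReal.ofReal ((1 - ‖x' - x‖ / y) ^ n) * F x) (𝓝 x)
      (𝓝 (F x)) := by
    have := ENNReal.Tendsto.mul_const (b := F x)
      (ENNReal.tendsto_ofReal (hc.tendsto x)) (Or.inl (by simp))
    simpa using this
  filter_upwards [h1.eventually (lt_mem_nhds hb), Metric.ball_mem_nhds x hy] with x' h2 h3
  refine h2.trans_le (hF x x' ?_)
  rw [Metric.mem_ball, dist_eq_norm] at h3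
  exact h3.le

theorem lowerSemicontinuous_poissonExtensionAbs (u : E → ℝ) {y : ℝ} (hy : 0 < y) :
    LowerSemicontinuous (poissonExtensionAbs u y) :=
  lowerSemicontinuous_of_harnack hy fun x x' h =>
    poissonExtensionAbs_harnack u hy x x' (y' := y) (by simp) h

theorem lowerSemicontinuous_poissonMaximalFrom (u : E → ℝ) {ε : ℝ} (hε : 0 < ε) :
    LowerSemicontinuous (poissonMaximalFrom u ε) :=
  lowerSemicontinuous_of_harnack hε fun x x' h => poissonMaximalFrom_harnack u hε x x' le_rfl h

theorem lowerSemicontinuous_poissonMaximal (u : E → ℝ) : LowerSemicontinuous (poissonMaximal u) :=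
  lowerSemicontinuous_biSup fun _ hy => lowerSemicontinuous_poissonExtensionAbs u hy

/-- The inequality, used in both directions, squeezes `F x'` between `F x` times and divided by a
factor that tends to 1. -/
theorem continuous_toReal_of_harnack {X : Type*} [NormedAddCommGroup X] {F : X → ℝ≥0∞} {y : ℝ} (hy : 0 < y) {n : ℕ}
    (hF : ∀ x x', ‖x' - x‖ ≤ y → ENNReal.ofReal ((1 - ‖x' - x‖ / y) ^ n) * F x ≤ F x')
    (hfin : ∀ x, F x ≠ ⊤) : Continuous fun x => (F x).toReal := by
  have hR : ∀ x x', ‖x' - x‖ ≤ y → (1 - ‖x' - x‖ / y) ^ n * (F x).toReal ≤ (F x').toReal := by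
    intro x x' h
    have := ENNReal.toReal_mono (hfin x') (hF x x' h)
    rwa [ENNReal.toReal_mul, ENNReal.toReal_ofReal (pow_nonneg
      (by rw [sub_nonneg, div_le_one hy]; exact h) _)] at this
  refine continuous_iff_continuousAt.2 fun x => ?_
  have hc : Continuous fun x' : X => (1 - ‖x' - x‖ / y) ^ n := by fun_prop
  have hc1 := hc.tendsto x
  simp only [sub_self, norm_zero, zero_div, sub_zero, one_pow] at hc1
  refine tendsto_of_tendsto_of_tendsto_of_le_of_le'
    (g := fun x' => (1 - ‖x' - x‖ / y) ^ n * (F x).toReal)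
    (h := fun x' => (F x).toReal / (1 - ‖x' - x‖ / y) ^ n) ?_ ?_ ?_ ?_
  · simpa using hc1.mul_const (F x).toReal
  · have := (tendsto_const_nhds (x := (F x).toReal)).div hc1 one_ne_zero
    rw [div_one] at this
    exact this
  · filter_upwards [Metric.ball_mem_nhds x hy] with x' h
    rw [Metric.mem_ball, dist_eq_norm] at h
    exact hR x x' h.le
  · filter_upwards [Metric.ball_mem_nhds x hy] with x' h
    rw [Metric.mem_ball, dist_eq_norm] at h
    have := hR x' x (by rw [norm_sub_rev]; exact h.le)
    rw [norm_sub_rev] at this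
    rw [le_div_iff₀ (pow_pos (by rw [sub_pos, div_lt_one hy]; exact h) _), mul_comm]
    exact this

theorem continuous_poissonMaximalFrom (u : E → ℝ) {ε : ℝ} (hε : 0 < ε)
    (hfin : ∀ x, poissonMaximalFrom u ε x ≠ ⊤) :
    Continuous fun x => (poissonMaximalFrom u ε x).toReal :=
  continuous_toReal_of_harnack hε (fun x x' h => poissonMaximalFrom_harnack u hε x x' le_rfl h) hfin

theorem continuous_poissonExtensionAbs (u : E → ℝ) {y : ℝ} (hy : 0 < y)
    (hfin : ∀ x, poissonExtensionAbs u y x ≠ ⊤) :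
    Continuous fun x => (poissonExtensionAbs u y x).toReal :=
  continuous_toReal_of_harnack hy
    (fun x x' h => poissonExtensionAbs_harnack u hy x x' (y' := y) (by simp) h) hfin

theorem integrable_poissonExtensionAbs {u : E → ℝ} (hu : AEStronglyMeasurable u volume) {y : ℝ}
    (hy : 0 < y) {x : E} (hfin : poissonExtensionAbs u y x ≠ ⊤) :
    Integrable (fun z => |u z| * halfSpacePoissonKernel y (x - z)) := by
  refine ⟨(hu.norm.mul ((continuous_halfSpacePoissonKernel hy).comp
    (continuous_const.sub continuous_id)).aestronglyMeasurable), ?_⟩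
  rw [hasFiniteIntegral_iff_ofReal (.of_forall fun z =>
    mul_nonneg (abs_nonneg _) (halfSpacePoissonKernel_pos hy _).le)]
  exact hfin.lt_top

theorem toReal_poissonExtensionAbs {u : E → ℝ} (hu : AEStronglyMeasurable u volume) {y : ℝ}
    (hy : 0 < y) (x : E) :
    (poissonExtensionAbs u y x).toReal = ∫ z, |u z| * halfSpacePoissonKernel y (x - z) := by
  rw [integral_eq_lintegral_of_nonneg_ae (.of_forall fun z =>
    mul_nonneg (abs_nonneg _) (halfSpacePoissonKernel_pos hy _).le)
    (f := fun z => |u z| * halfSpacePoissonKernel y (x - z))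
    (hu.norm.mul ((continuous_halfSpacePoissonKernel hy).comp
    (continuous_const.sub continuous_id)).aestronglyMeasurable)]
  rfl

/-- The pointwise estimate `poisson_second_differences` at `x - z` is integrated against `|u z|`.
Since its error is a multiple of the kernel, it becomes the same multiple of the extension. -/
theorem poissonExtensionAbs_second_differences {ι : Type*} [Fintype ι] (b : OrthonormalBasis ι ℝ E)
    {u : E → ℝ} (hu : AEStronglyMeasurable u volume) {y r s : ℝ} (hy : 0 < y) (hr : 0 < r)
    (hry : r ≤ y / 2) (hs : 0 < s) (hsy : s ≤ y / 4) (x : E)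
    (hfin : ∀ x, poissonExtensionAbs u y x ≠ ⊤) (hfin1 : poissonExtensionAbs u (y + s) x ≠ ⊤)
    (hfin2 : poissonExtensionAbs u (y - s) x ≠ ⊤) :
    0 ≤ (∑ i, ((poissonExtensionAbs u y (x + r • b i)).toReal
          + (poissonExtensionAbs u y (x - r • b i)).toReal
          - 2 * (poissonExtensionAbs u y x).toReal)) / r ^ 2
      + ((poissonExtensionAbs u (y + s) x).toReal + (poissonExtensionAbs u (y - s) x).toReal
        - 2 * (poissonExtensionAbs u y x).toReal) / s ^ 2
      + poissonThirdConst E / y ^ 3 * (Fintype.card ι * r + s)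
        * (poissonExtensionAbs u y x).toReal := by
  have hys : 0 < y - s := by linarith
  have hys' : 0 < y + s := by linarith
  have I0 := fun x => integrable_poissonExtensionAbs hu hy (hfin x)
  have I1 := integrable_poissonExtensionAbs hu hys' hfin1
  have I2 := integrable_poissonExtensionAbs hu hys hfin2
  simp_rw [toReal_poissonExtensionAbs hu hy, toReal_poissonExtensionAbs hu hys,
    toReal_poissonExtensionAbs hu hys']
  have J : ∀ i, Integrable (fun z => |u z| * halfSpacePoissonKernel y (x + r • b i - z)
      + |u z| * halfSpacePoissonKernel y (x - r • b i - z)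
      - 2 * (|u z| * halfSpacePoissonKernel y (x - z))) :=
    fun i => ((I0 _).add (I0 _)).sub ((I0 x).const_mul 2)
  have J' : Integrable (fun z => (∑ i, (|u z| * halfSpacePoissonKernel y (x + r • b i - z)
      + |u z| * halfSpacePoissonKernel y (x - r • b i - z)
      - 2 * (|u z| * halfSpacePoissonKernel y (x - z)))) / r ^ 2) :=
    (integrable_finsetSum _ fun i _ => J i).div_const _
  have J2 : Integrable (fun z => (|u z| * halfSpacePoissonKernel (y + s) (x - z)
      + |u z| * halfSpacePoissonKernel (y - s) (x - z)
      - 2 * (|u z| * halfSpacePoissonKernel y (x - z))) / s ^ 2) :=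
    ((I1.add I2).sub ((I0 x).const_mul 2)).div_const _
  have J3 : Integrable (fun z => poissonThirdConst E / y ^ 3 * (Fintype.card ι * r + s)
        * (|u z| * halfSpacePoissonKernel y (x - z))) := (I0 x).const_mul _
  have key : 0 ≤ ∫ z, ((∑ i, (|u z| * halfSpacePoissonKernel y (x + r • b i - z)
      + |u z| * halfSpacePoissonKernel y (x - r • b i - z)
      - 2 * (|u z| * halfSpacePoissonKernel y (x - z)))) / r ^ 2
      + (|u z| * halfSpacePoissonKernel (y + s) (x - z)
      + |u z| * halfSpacePoissonKernel (y - s) (x - z)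
      - 2 * (|u z| * halfSpacePoissonKernel y (x - z))) / s ^ 2
      + poissonThirdConst E / y ^ 3 * (Fintype.card ι * r + s)
        * (|u z| * halfSpacePoissonKernel y (x - z))) := by
    refine integral_nonneg fun z => ?_
    have := mul_nonneg (abs_nonneg (u z)) (poisson_second_differences b hy hr hry hs hsy (x - z))
    refine this.trans (le_of_eq ?_)
    have e1 : ∀ i, x + r • b i - z = x - z + r • b i := fun i => by abel
    have e2 : ∀ i, x - r • b i - z = x - z - r • b i := fun i => by abel
    simp only [e1, e2]
    rw [mul_add, mul_add, mul_div_assoc', Finset.mul_sum]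
    congr 1
    · congr 1
      · congr 1
        refine Finset.sum_congr rfl fun i _ => ?_
        ring
      · ring
    · ring
  refine key.trans (le_of_eq ?_)
  have J12 := J'.add J2
  simp only [Pi.add_def] at J12
  rw [integral_add J12 J3, integral_add J' J2, integral_div, integral_div, integral_const_mul,
    integral_finsetSum _ fun i _ => J i, integral_add_sub_two_mul I1 I2 (I0 x)]
  congr 3
  exact Finset.sum_congr rfl fun i _ => integral_add_sub_two_mul (I0 _) (I0 _) (I0 x)

end PoissonExtension

/-! ### Subharmonicity of the truncated maximal function where it exceeds the lowest level. -/

section Detachment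

open Filter Topology

variable {E : Type*} [NormedAddCommGroup E] [InnerProductSpace ℝ E] [FiniteDimensional ℝ E]
  [MeasurableSpace E] [BorelSpace E]

theorem continuousOn_poissonExtensionAbs_level (u : E → ℝ) {ε : ℝ} (hε : 0 < ε) (x : E)
    (hfin : ∀ y, ε ≤ y → poissonExtensionAbs u y x ≠ ⊤) :
    ContinuousOn (fun y => (poissonExtensionAbs u y x).toReal) (Ici ε) := by
  set n := Module.finrank ℝ E + 2
  have hR : ∀ y y', ε ≤ y → ε ≤ y' → |y' - y| ≤ ε →
      (1 - |y' - y| / ε) ^ n * (poissonExtensionAbs u y x).toReal ≤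
        (poissonExtensionAbs u y' x).toReal := by
    intro y y' hy hy' h
    have hy0 := hε.trans_le hy
    have := ENNReal.toReal_mono (hfin y' hy')
      (poissonExtensionAbs_harnack u hy0 x x (y' := y') (δ := |y' - y|) (by simp) (h.trans hy))
    rw [ENNReal.toReal_mul, ENNReal.toReal_ofReal (pow_nonneg
      (by rw [sub_nonneg, div_le_one hy0]; exact h.trans hy) _)] at this
    refine le_trans (mul_le_mul_of_nonneg_right ?_ ENNReal.toReal_nonneg) this
    have : 0 ≤ 1 - |y' - y| / ε := by rw [sub_nonneg, div_le_one hε]; exact h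
    gcongr
  intro y hy
  have hc : Continuous fun y' : ℝ => (1 - |y' - y| / ε) ^ n := by fun_prop
  have hc1 : Tendsto (fun y' : ℝ => (1 - |y' - y| / ε) ^ n) (𝓝[Ici ε] y) (𝓝 1) := by
    have := (hc.tendsto y).mono_left (nhdsWithin_le_nhds (s := Ici ε))
    simpa using this
  have hnear : ∀ᶠ y' in 𝓝[Ici ε] y, |y' - y| < ε :=
    nhdsWithin_le_nhds (Metric.ball_mem_nhds y hε)
  refine tendsto_of_tendsto_of_tendsto_of_le_of_le'
    (g := fun y' => (1 - |y' - y| / ε) ^ n * (poissonExtensionAbs u y x).toReal)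
    (h := fun y' => (poissonExtensionAbs u y x).toReal / (1 - |y' - y| / ε) ^ n) ?_ ?_ ?_ ?_
  · simpa using hc1.mul_const (poissonExtensionAbs u y x).toReal
  · have := (tendsto_const_nhds (x := (poissonExtensionAbs u y x).toReal)).div hc1 one_ne_zero
    rw [div_one] at this
    exact this
  · filter_upwards [hnear, self_mem_nhdsWithin] with y' h h'
    exact hR y y' hy h' h.le
  · filter_upwards [hnear, self_mem_nhdsWithin] with y' h h'
    have := hR y' y h' hy (by rw [abs_sub_comm]; exact h.le)
    rw [abs_sub_comm] at this
    rw [le_div_iff₀ (pow_pos (by rw [sub_pos, div_lt_one hε]; exact h) _), mul_comm]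
    exact this

theorem nonneg_of_forall_small {A B s₀ : ℝ} (hs₀ : 0 < s₀)
    (h : ∀ s, 0 < s → s ≤ s₀ → 0 ≤ A + B * s) : 0 ≤ A := by
  have hc : Tendsto (fun s : ℝ => A + B * s) (𝓝[>] 0) (𝓝 A) := by
    have : Continuous fun s : ℝ => A + B * s := by fun_prop
    have := (this.tendsto 0).mono_left (nhdsWithin_le_nhds (s := Ioi 0))
    simpa using this
  refine ge_of_tendsto hc ?_
  filter_upwards [Ioc_mem_nhdsGT hs₀] with s hs
  exact h s hs.1 hs.2

/-- If the supremum defining the truncated maximal function at `x` is only approached at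
`y → ∞`, then `x` is a global minimum. -/
theorem poissonMaximalFrom_le_of_not_attained (u : E → ℝ) {ε : ℝ} (hε : 0 < ε)
    (hfin : ∀ x, poissonMaximalFrom u ε x ≠ ⊤) {x : E}
    (h : ∀ y, ε ≤ y → poissonExtensionAbs u y x ≠ poissonMaximalFrom u ε x) (x' : E) :
    (poissonMaximalFrom u ε x).toReal ≤ (poissonMaximalFrom u ε x').toReal := by
  set G := (poissonMaximalFrom u ε x).toReal with hG
  have hfinE : ∀ y, ε ≤ y → ∀ x, poissonExtensionAbs u y x ≠ ⊤ := fun y hy x =>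
    ne_top_of_le_ne_top (hfin x) (poissonExtensionAbs_le_from u hy x)
  have hlt : ∀ y, ε ≤ y → (poissonExtensionAbs u y x).toReal < G := fun y hy =>
    ENNReal.toReal_strict_mono (hfin x)
      (lt_of_le_of_ne (poissonExtensionAbs_le_from u hy x) (h y hy))
  have hex : ∀ c, c < G → ∃ y, ε ≤ y ∧ c < (poissonExtensionAbs u y x).toReal := by
    intro c hc
    by_contra! hcon
    have : poissonMaximalFrom u ε x ≤ ENNReal.ofReal c := iSup₂_le fun y hy =>
      (ENNReal.le_ofReal_iff_toReal_le (hfinE y hy x) (ENNReal.toReal_nonneg.trans (hcon y hy))).2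
        (hcon y hy)
    have h0 : 0 ≤ c := ENNReal.toReal_nonneg.trans (hcon ε le_rfl)
    have := ENNReal.toReal_mono ENNReal.ofReal_ne_top this
    rw [ENNReal.toReal_ofReal h0] at this
    exact absurd hc (not_lt.2 this)
  -- On the compact range `[ε, N]` the maximum is attained and is below `G`, so values close to `G`
  -- occur only above `N`.
  have hfar : ∀ N : ℝ, ε ≤ N → ∀ c, c < G → ∃ y, N < y ∧ c < (poissonExtensionAbs u y x).toReal := by
    intro N hN c hc
    obtain ⟨y₀, hy₀, hmax⟩ := isCompact_Icc.exists_isMaxOn (nonempty_Icc.2 hN)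
      ((continuousOn_poissonExtensionAbs_level u hε x fun y hy => hfinE y hy x).mono
        (Icc_subset_Ici_self : Icc ε N ⊆ Ici ε))
    obtain ⟨y, hy, hcy⟩ := hex (max c (poissonExtensionAbs u y₀ x).toReal)
      (max_lt hc (hlt y₀ hy₀.1))
    refine ⟨y, ?_, (le_max_left _ _).trans_lt hcy⟩
    by_contra! hyN
    exact absurd ((le_max_right _ _).trans_lt hcy) (not_lt.2 (hmax ⟨hy, hyN⟩))
  set δ := ‖x' - x‖
  refine le_of_forall_lt fun c hc => ?_
  obtain ⟨c', hcc', hc'⟩ := exists_between hc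
  -- At high levels the Harnack factor between `x` and any other point tends to 1, so near-maximal
  -- values at `x` are nearly reached at `x'`.
  have hc1 : Tendsto (fun N : ℝ => (1 - δ / N) ^ (Module.finrank ℝ E + 2) * max c' 0) atTop
      (𝓝 (max c' 0)) := by
    have : Tendsto (fun N : ℝ => δ / N) atTop (𝓝 0) := tendsto_const_nhds.div_atTop tendsto_id
    simpa using ((tendsto_const_nhds (x := (1 : ℝ))).sub this).pow (Module.finrank ℝ E + 2)
      |>.mul_const (max c' 0)
  obtain ⟨N, hN1, hN2, hN3⟩ := ((hc1.eventually (lt_mem_nhds (hcc'.trans_le (le_max_left _ _)))).and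
    ((eventually_ge_atTop ε).and (eventually_ge_atTop δ))).exists
  obtain ⟨y, hNy, hy⟩ := hfar N hN2 c' hc'
  have hy0 : 0 < y := hε.trans_le (hN2.trans hNy.le)
  have hNpos : 0 < N := hε.trans_le hN2
  have h1 := (poissonExtensionAbs_harnack u hy0 x x' (y' := y) (δ := δ) (by simp [δ])
    (hN3.trans hNy.le)).trans (poissonExtensionAbs_le_from u (hN2.trans hNy.le) x')
  have h1' := ENNReal.toReal_mono (hfin x') h1
  rw [ENNReal.toReal_mul, ENNReal.toReal_ofReal (pow_nonneg
      (by rw [sub_nonneg, div_le_one hy0]; exact hN3.trans hNy.le) _)] at h1'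
  refine hN1.trans_le (le_trans ?_ h1')
  have h0 : 0 ≤ 1 - δ / N := by rw [sub_nonneg, div_le_one hNpos]; exact hN3
  have h2 : 1 - δ / N ≤ 1 - δ / y := by gcongr
  exact mul_le_mul (pow_le_pow_left₀ h0 h2 _) (max_le hy.le ENNReal.toReal_nonneg)
    (le_max_right _ _) (pow_nonneg (h0.trans h2) _)

/-- Subharmonicity of the truncated maximal function at detached points. -/
theorem poissonMaximalFrom_second_differences {ι : Type*} [Fintype ι] (b : OrthonormalBasis ι ℝ E)
    {u : E → ℝ} (hu : AEStronglyMeasurable u volume) {ε : ℝ} (hε : 0 < ε)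
    (hfin : ∀ x, poissonMaximalFrom u ε x ≠ ⊤) {x : E}
    (hx : (poissonExtensionAbs u ε x).toReal < (poissonMaximalFrom u ε x).toReal)
    {r : ℝ} (hr : 0 < r) (hrε : r ≤ ε / 2) :
    0 ≤ ∑ i, ((poissonMaximalFrom u ε (x + r • b i)).toReal
          + (poissonMaximalFrom u ε (x - r • b i)).toReal
          - 2 * (poissonMaximalFrom u ε x).toReal)
      + poissonThirdConst E * Fintype.card ι / ε ^ 3 * r ^ 3
        * (poissonMaximalFrom u ε x).toReal := by
  have hC := poissonThirdConst_nonneg (E := E)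
  have hle : ∀ y, ε ≤ y → ∀ x, (poissonExtensionAbs u y x).toReal ≤ (poissonMaximalFrom u ε x).toReal :=
    fun y hy x => ENNReal.toReal_mono (hfin x) (poissonExtensionAbs_le_from u hy x)
  have hfinE : ∀ y, ε ≤ y → ∀ x, poissonExtensionAbs u y x ≠ ⊤ := fun y hy x =>
    ne_top_of_le_ne_top (hfin x) (poissonExtensionAbs_le_from u hy x)
  by_cases hA : ∃ y, ε ≤ y ∧ poissonExtensionAbs u y x = poissonMaximalFrom u ε x
  · obtain ⟨y, hy, hyx⟩ := hA
    have hεy : ε < y := by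
      rcases hy.eq_or_lt with h | h
      · rw [← h] at hyx; rw [hyx] at hx; exact absurd hx (lt_irrefl _)
      · exact h
    have hy0 : 0 < y := hε.trans hεy
    set V := (poissonExtensionAbs u y x).toReal with hV
    have hVG : V = (poissonMaximalFrom u ε x).toReal := by rw [hV, hyx]
    set S := ∑ i, ((poissonExtensionAbs u y (x + r • b i)).toReal
          + (poissonExtensionAbs u y (x - r • b i)).toReal - 2 * V) with hS
    have key : 0 ≤ S / r ^ 2 + poissonThirdConst E / y ^ 3 * (Fintype.card ι * r) * V := by
      -- The vertical step `s` tends to 0 while `r` stays fixed. The bound `s ≤ y - ε` keeps `y - s`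
      -- among the admissible levels, so maximality at `y` makes the vertical second difference
      -- nonpositive.
      refine nonneg_of_forall_small (B := poissonThirdConst E / y ^ 3 * V)
        (s₀ := min (y / 4) (y - ε)) (lt_min (by linarith) (by linarith)) fun s hs hs' => ?_
      have h1 : s ≤ y / 4 := hs'.trans (min_le_left _ _)
      have h2 : s ≤ y - ε := hs'.trans (min_le_right _ _)
      have := poissonExtensionAbs_second_differences b hu hy0 hr (by linarith) hs h1 x
        (hfinE y hy) (hfinE _ (by linarith) x) (hfinE _ (by linarith) x)
      have h3 : ((poissonExtensionAbs u (y + s) x).toReal + (poissonExtensionAbs u (y - s) x).toReal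
        - 2 * V) / s ^ 2 ≤ 0 := by
        refine div_nonpos_of_nonpos_of_nonneg ?_ (by positivity)
        have e1 := hle (y + s) (by linarith) x
        have e2 := hle (y - s) (by linarith) x
        linarith
      rw [← hV, ← hS] at this
      linarith
    -- The truncated maximal function lies above the extension at level `y` and agrees with it at
    -- `x`, so its second differences are larger.
    have hSle : S ≤ ∑ i, ((poissonMaximalFrom u ε (x + r • b i)).toReal
          + (poissonMaximalFrom u ε (x - r • b i)).toReal
          - 2 * (poissonMaximalFrom u ε x).toReal) := by
      refine Finset.sum_le_sum fun i _ => ?_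
      rw [← hVG]
      have e1 := hle y hy (x + r • b i)
      have e2 := hle y hy (x - r • b i)
      linarith
    have hV0 : 0 ≤ V := ENNReal.toReal_nonneg
    have h4 : 0 ≤ S + poissonThirdConst E * Fintype.card ι / y ^ 3 * r ^ 3 * V := by
      have := mul_nonneg (sq_nonneg r) key
      rw [mul_add, mul_div_cancel₀ _ (by positivity)] at this
      refine this.trans (le_of_eq ?_)
      ring
    have h5 : poissonThirdConst E * Fintype.card ι / y ^ 3 * r ^ 3 * V ≤
        poissonThirdConst E * Fintype.card ι / ε ^ 3 * r ^ 3 * V := by gcongr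
    rw [← hVG] at hSle ⊢
    linarith
  · push Not at hA
    have := poissonMaximalFrom_le_of_not_attained u hε hfin hA
    refine add_nonneg (Finset.sum_nonneg fun i _ => ?_) (by positivity)
    linarith [this (x + r • b i), this (x - r • b i)]

end Detachment

/-! ### One-dimensional comparison of energies across a contact set. -/

section ContactEnergy

/-- An even convex energy density `ψ` with `ψ 0 = 0`, and a monotone selection `σ` of its
subgradients. -/
structure IsEnergyDensity (ψ σ : ℝ → ℝ) : Prop where
  map_zero : ψ 0 = 0
  mono_abs : ∀ {s t}, |s| ≤ |t| → ψ s ≤ ψ t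
  continuous : Continuous ψ
  subgradient : ∀ s t, ψ t + σ t * (s - t) ≤ ψ s
  monotone : Monotone σ
  sign_nonneg : ∀ {t}, 0 ≤ t → 0 ≤ σ t
  sign_nonpos : ∀ {t}, t ≤ 0 → σ t ≤ 0

theorem IsEnergyDensity.nonneg {ψ σ : ℝ → ℝ} (h : IsEnergyDensity ψ σ) (t : ℝ) : 0 ≤ ψ t := by
  rw [← h.map_zero]
  exact h.mono_abs (by simp)

/-- The `ψ`-energy of the chord of `w` over `[a, b]`. -/
noncomputable def chordEnergy (ψ w : ℝ → ℝ) (a b : ℝ) : ℝ := ψ ((w b - w a) / (b - a)) * (b - a)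

/-- `PartialEnergy ψ w x T` holds if `T` is the sum of the chord energies of `w` along a partition
that ends in `x`. -/
inductive PartialEnergy (ψ w : ℝ → ℝ) : ℝ → ℝ → Prop
  | start (x : ℝ) : PartialEnergy ψ w x 0
  | step {x x' T : ℝ} : PartialEnergy ψ w x T → x ≤ x' →
      PartialEnergy ψ w x' (T + chordEnergy ψ w x x')

variable {ψ σ : ℝ → ℝ}

@[simp] theorem chordEnergy_self (ψ w : ℝ → ℝ) (a : ℝ) : chordEnergy ψ w a a = 0 := by
  simp [chordEnergy]

theorem chordEnergy_nonneg (h : IsEnergyDensity ψ σ) (w : ℝ → ℝ) {a b : ℝ} (hab : a ≤ b) :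
    0 ≤ chordEnergy ψ w a b :=
  mul_nonneg (h.nonneg _) (sub_nonneg.2 hab)

/-- Jensen's inequality for two chords: with the subgradient taken at the slope of the long chord,
the linear terms cancel. -/
theorem chordEnergy_le_add (h : IsEnergyDensity ψ σ) (w : ℝ → ℝ) {a c b : ℝ} (hac : a ≤ c)
    (hcb : c ≤ b) : chordEnergy ψ w a b ≤ chordEnergy ψ w a c + chordEnergy ψ w c b := by
  rcases hac.eq_or_lt with rfl | hac
  · simp
  rcases hcb.eq_or_lt with rfl | hcb
  · simp
  unfold chordEnergy
  have h1 : 0 < c - a := sub_pos.2 hac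
  have h2 : 0 < b - c := sub_pos.2 hcb
  have h3 : 0 < b - a := by linarith
  set t := (w b - w a) / (b - a) with ht
  have e1 := mul_le_mul_of_nonneg_right (h.subgradient ((w c - w a) / (c - a)) t) h1.le
  have e2 := mul_le_mul_of_nonneg_right (h.subgradient ((w b - w c) / (b - c)) t) h2.le
  have f1 : (w c - w a) / (c - a) * (c - a) = w c - w a := div_mul_cancel₀ _ h1.ne'
  have f2 : (w b - w c) / (b - c) * (b - c) = w b - w c := div_mul_cancel₀ _ h2.ne'
  have f3 : t * (b - a) = w b - w a := div_mul_cancel₀ _ h3.ne'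
  have g1 : (ψ t + σ t * ((w c - w a) / (c - a) - t)) * (c - a) =
      ψ t * (c - a) + σ t * (w c - w a - t * (c - a)) := by rw [add_mul, mul_assoc (σ t), sub_mul, f1]
  have g2 : (ψ t + σ t * ((w b - w c) / (b - c) - t)) * (b - c) =
      ψ t * (b - c) + σ t * (w b - w c - t * (b - c)) := by rw [add_mul, mul_assoc (σ t), sub_mul, f2]
  rw [g1] at e1
  rw [g2] at e2
  have : σ t * (w c - w a - t * (c - a)) + σ t * (w b - w c - t * (b - c)) = 0 := by
    rw [← mul_add]
    have : w c - w a - t * (c - a) + (w b - w c - t * (b - c)) = w b - w a - t * (b - a) := by ring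
    rw [this, f3, sub_self, mul_zero]
  nlinarith

/-- The subgradient inequality at the slope of `g`. The excess energy of `g` over `f` is paid for by
boundary values of `g - f`, as in an integration by parts. -/
theorem chordEnergy_le_tangent (h : IsEnergyDensity ψ σ) (f g : ℝ → ℝ) {a b : ℝ} (hab : a < b) :
    chordEnergy ψ g a b ≤ chordEnergy ψ f a b
      + σ ((g b - g a) / (b - a)) * ((g b - f b) - (g a - f a)) := by
  unfold chordEnergy
  have h1 : 0 < b - a := sub_pos.2 hab
  set t := (g b - g a) / (b - a) with ht
  have e1 := mul_le_mul_of_nonneg_right (h.subgradient ((f b - f a) / (b - a)) t) h1.le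
  have f1 : (f b - f a) / (b - a) * (b - a) = f b - f a := div_mul_cancel₀ _ h1.ne'
  have f3 : t * (b - a) = g b - g a := div_mul_cancel₀ _ h1.ne'
  have g1 : (ψ t + σ t * ((f b - f a) / (b - a) - t)) * (b - a) =
      ψ t * (b - a) + σ t * (f b - f a - (g b - g a)) := by
    rw [add_mul, mul_assoc (σ t), sub_mul, f1, f3]
  rw [g1] at e1
  linarith

/-- A function `g` that is convex on the intervals where it is detached from `f ≤ g`, and is
bounded above; `e` is a bounded cumulative energy of `f`. -/
structure ContactData (ψ f g e : ℝ → ℝ) (K : ℝ) : Prop where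
  le : ∀ x, f x ≤ g x
  continuous_f : Continuous f
  continuous_g : Continuous g
  convex : ∀ {x y}, x < y → (∀ z ∈ Ioo x y, f z < g z) → ConvexOn ℝ (Icc x y) g
  bdd : BddAbove (range g)
  e_nonneg : ∀ x, 0 ≤ e x
  e_le : ∀ x, e x ≤ K
  chord_le : ∀ {a b}, a < b → chordEnergy ψ f a b ≤ e b - e a

/-- The invariant in the proof of `PartialEnergy.le_of_contactData`. -/
def ContactInvariant (σ f g e : ℝ → ℝ) (x T : ℝ) : Prop :=
  (f x = g x → T ≤ e x) ∧ ∀ y, x < y → (∀ z ∈ Ioo x y, f z < g z) →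
    T ≤ e x + σ ((g y - g x) / (y - x)) * (g x - f x)

variable {f g e : ℝ → ℝ} {K : ℝ}

theorem ContactInvariant.mono {x T T' : ℝ} (h : ContactInvariant σ f g e x T) (hT : T' ≤ T) :
    ContactInvariant σ f g e x T' :=
  ⟨fun hx => hT.trans (h.1 hx), fun y hy hz => hT.trans (h.2 y hy hz)⟩

theorem contactInvariant_of_contact {x T : ℝ} (hx : f x = g x) (hT : T ≤ e x) :
    ContactInvariant σ f g e x T :=
  ⟨fun _ => hT, fun y _ _ => by rw [hx, sub_self, mul_zero, add_zero]; exact hT⟩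

/-- After a step the boundary term at `x'` carries `σ` of the slope on the left. If `x'` is
detached, convexity across `x'` makes every admissible slope on the right at least as large; as `σ`
is monotone and `g - f ≥ 0`, the term may be rewritten with that slope, which is the second clause
of the invariant. At a contact point the term vanishes. -/
theorem ContactInvariant.step_detached (h : IsEnergyDensity ψ σ) (D : ContactData ψ f g e K)
    {x x' T : ℝ} (hI : ContactInvariant σ f g e x T) (hx : x ≤ x')
    (hd : ∀ z ∈ Ioo x x', f z < g z) :
    ContactInvariant σ f g e x' (T + chordEnergy ψ g x x') := by
  rcases hx.eq_or_lt with rfl | hx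
  · simpa using hI
  have h1 := hI.2 x' hx hd
  have h2 := chordEnergy_le_tangent h f g hx
  have h3 := D.chord_le hx
  set s := (g x' - g x) / (x' - x) with hs
  have h4 : T + chordEnergy ψ g x x' ≤ e x' + σ s * (g x' - f x') := by nlinarith
  by_cases hc : f x' = g x'
  · refine contactInvariant_of_contact hc ?_
    rwa [hc, sub_self, mul_zero, add_zero] at h4
  refine ⟨fun hc' => absurd hc' hc, fun y hy hdy => ?_⟩
  have hlt : f x' < g x' := lt_of_le_of_ne (D.le x') hc
  have hcv := D.convex (hx.trans hy) fun z hz => by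
    rcases lt_trichotomy z x' with hz' | rfl | hz'
    · exact hd z ⟨hz.1, hz'⟩
    · exact hlt
    · exact hdy z ⟨hz', hz.2⟩
  have hslope := hcv.slope_mono_adjacent (x := x) (y := x') (z := y) ⟨le_rfl, (hx.trans hy).le⟩
    ⟨(hx.trans hy).le, le_rfl⟩ hx hy
  refine h4.trans (add_le_add_right (mul_le_mul_of_nonneg_right (h.monotone hslope) ?_) _)
  linarith

/-- The step is cut at the first and the last contact points `b` and `a`. The two outer pieces are
detached; on the middle one the chords of `f` and `g` coincide. Cutting only increases the chord
energy. -/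
theorem ContactInvariant.step (h : IsEnergyDensity ψ σ) (D : ContactData ψ f g e K)
    {x x' T : ℝ} (hI : ContactInvariant σ f g e x T) (hx : x ≤ x') :
    ContactInvariant σ f g e x' (T + chordEnergy ψ g x x') := by
  by_cases hd : ∀ z ∈ Ioo x x', f z < g z
  · exact hI.step_detached h D hx hd
  push Not at hd
  obtain ⟨c, hc, hcg⟩ := hd
  have hcomp : IsCompact (Icc x x' ∩ {z | f z = g z}) :=
    isCompact_Icc.inter_right (isClosed_eq D.continuous_f D.continuous_g)
  have hne : (Icc x x' ∩ {z | f z = g z}).Nonempty :=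
    ⟨c, ⟨hc.1.le, hc.2.le⟩, le_antisymm (D.le c) hcg⟩
  obtain ⟨b, ⟨hb, hfb⟩, hbl⟩ := hcomp.exists_isLeast hne
  obtain ⟨a, ⟨ha, hfa⟩, hag⟩ := hcomp.exists_isGreatest hne
  have hba : b ≤ a := hbl ⟨ha, hfa⟩
  simp only [mem_ofPred_eq] at hfa hfb
  have I1 := hI.step_detached h D hb.1 fun z hz => lt_of_le_of_ne (D.le z) fun hz' =>
    absurd (hbl ⟨⟨hz.1.le, hz.2.le.trans hb.2⟩, hz'⟩) (not_le.2 hz.2)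
  have I2 : ContactInvariant σ f g e a (T + chordEnergy ψ g x b + chordEnergy ψ g b a) := by
    refine contactInvariant_of_contact hfa ?_
    have h1 := I1.1 hfb
    rcases hba.eq_or_lt with rfl | hba
    · simpa using h1
    · have h2 := D.chord_le hba
      have h3 : chordEnergy ψ g b a = chordEnergy ψ f b a := by
        unfold chordEnergy; rw [hfa, hfb]
      linarith
  have I3 := I2.step_detached h D ha.2 fun z hz => lt_of_le_of_ne (D.le z) fun hz' =>
    absurd (hag ⟨⟨ha.1.trans hz.1.le, hz.2.le⟩, hz'⟩) (not_le.2 hz.1)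
  refine I3.mono ?_
  have e1 := chordEnergy_le_add h g hb.1 hb.2
  have e2 := chordEnergy_le_add h g hba ha.2
  linarith

/-- If there is a contact point to the left, the partition starts there. Otherwise `g` is convex on
a left half-line and bounded above, so its slopes are nonnegative and the boundary term has the
right sign. -/
theorem ContactData.exists_start (h : IsEnergyDensity ψ σ) (D : ContactData ψ f g e K) (x : ℝ) :
    ∃ T, 0 ≤ T ∧ ContactInvariant σ f g e x T := by
  by_cases hc : ∃ c ≤ x, f c = g c
  · obtain ⟨c, hcx, hc⟩ := hc
    refine ⟨0 + chordEnergy ψ g c x, ?_, ?_⟩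
    · rw [zero_add]; exact chordEnergy_nonneg h g hcx
    · exact (contactInvariant_of_contact hc (D.e_nonneg c)).step h D hcx
  push Not at hc
  refine ⟨0, le_rfl, fun _ => D.e_nonneg x, fun y hy hd => ?_⟩
  have hs : 0 ≤ (g y - g x) / (y - x) := by
    by_contra! hs
    set s := (g y - g x) / (y - x) with hs'
    obtain ⟨B, hB⟩ := D.bdd
    have hle : ∀ z, z < x → g z ≥ g x + s * (z - x) := by
      intro z hz
      have hcv := D.convex (hz.trans hy) fun t ht => by
        rcases le_or_gt t x with h' | h'
        · exact lt_of_le_of_ne (D.le t) (hc t h')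
        · exact hd t ⟨h', ht.2⟩
      have := hcv.slope_mono_adjacent (x := z) (y := x) (z := y) ⟨le_rfl, (hz.trans hy).le⟩
        ⟨(hz.trans hy).le, le_rfl⟩ hz hy
      rw [← hs', div_le_iff₀ (by linarith)] at this
      linarith
    have hgx := hB (mem_range_self x)
    -- At this point the line through `(x, g x)` of slope `s` has height `B + 1`.
    have h1 : x - (B - g x + 1) / (-s) < x := by
      have : 0 < (B - g x + 1) / (-s) := div_pos (by linarith) (by linarith)
      linarith
    have h2 := hle _ h1
    have h3 := hB (mem_range_self (x - (B - g x + 1) / (-s)))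
    have h4 : s * (x - (B - g x + 1) / (-s) - x) = B - g x + 1 := by
      have : s ≠ 0 := hs.ne
      field_simp
      ring
    linarith
  exact add_nonneg (D.e_nonneg x) (mul_nonneg (h.sign_nonneg hs) (by linarith [D.le x]))

/-- The mirror image of `ContactData.exists_start`: either the partition is continued to a contact
point on the right, or `g` has nonpositive slopes there and the boundary term can be dropped. -/
theorem ContactInvariant.le (h : IsEnergyDensity ψ σ) (D : ContactData ψ f g e K) {x T : ℝ}
    (hI : ContactInvariant σ f g e x T) : T ≤ K := by
  by_cases hc : ∃ c ≥ x, f c = g c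
  · obtain ⟨c, hcx, hc⟩ := hc
    have := (hI.step h D hcx).1 hc
    linarith [chordEnergy_nonneg h g hcx, D.e_le c]
  push Not at hc
  have hd : ∀ z, x ≤ z → f z < g z := fun z hz => lt_of_le_of_ne (D.le z) (hc z hz)
  have hs : (g (x + 1) - g x) / (x + 1 - x) ≤ 0 := by
    by_contra! hs
    set s := (g (x + 1) - g x) / (x + 1 - x) with hs'
    obtain ⟨B, hB⟩ := D.bdd
    have hle : ∀ z, x + 1 < z → g z ≥ g (x + 1) + s * (z - (x + 1)) := by
      intro z hz
      have hcv := D.convex (x := x) (y := z) (by linarith) fun t ht => hd t ht.1.le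
      have := hcv.slope_mono_adjacent (x := x) (y := x + 1) (z := z) ⟨le_rfl, by linarith⟩
        ⟨by linarith, le_rfl⟩ (by linarith) hz
      rw [← hs', le_div_iff₀ (by linarith)] at this
      linarith
    have hgx := hB (mem_range_self (x + 1))
    have h1 : x + 1 < x + 1 + (B - g (x + 1) + 1) / s := by
      have : 0 < (B - g (x + 1) + 1) / s := div_pos (by linarith) hs
      linarith
    have h2 := hle _ h1
    have h3 := hB (mem_range_self (x + 1 + (B - g (x + 1) + 1) / s))
    have h4 : s * (x + 1 + (B - g (x + 1) + 1) / s - (x + 1)) = B - g (x + 1) + 1 := by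
      have : s ≠ 0 := hs.ne'
      field_simp
      ring
    linarith
  have h1 := hI.2 (x + 1) (by linarith) fun z hz => hd z hz.1.le
  have h2 : σ ((g (x + 1) - g x) / (x + 1 - x)) * (g x - f x) ≤ 0 :=
    mul_nonpos_of_nonpos_of_nonneg (h.sign_nonpos hs) (by linarith [D.le x])
  linarith [D.e_le x]

theorem PartialEnergy.le_of_contactData (h : IsEnergyDensity ψ σ) (D : ContactData ψ f g e K)
    {x T : ℝ} (hT : PartialEnergy ψ g x T) : T ≤ K := by
  have : ∃ T', T ≤ T' ∧ ContactInvariant σ f g e x T' := by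
    induction hT with
    | start x => exact D.exists_start h x
    | step _ hx ih =>
      obtain ⟨T', hT', hI⟩ := ih
      exact ⟨_, add_le_add_left hT' _, hI.step h D hx⟩
  obtain ⟨T', hT', hI⟩ := this
  exact hT'.trans (hI.le h D)

/-- A maximum principle. If `g` exceeded a chord, then `g` minus the chord plus a small parabola
would have a positive interior maximum; there its second difference is nonpositive, but the parabola
contributes `2 * η * r ^ 2`, which beats `C * r ^ 3` for small `r`. -/
theorem convexOn_Icc_of_second_difference {g : ℝ → ℝ} (hg : Continuous g) {x y C r₀ : ℝ}
    (hr₀ : 0 < r₀)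
    (h : ∀ z ∈ Ioo x y, ∀ r, 0 < r → r ≤ r₀ → 0 ≤ g (z + r) + g (z - r) - 2 * g z + C * r ^ 3) :
    ConvexOn ℝ (Icc x y) g := by
  refine convexOn_of_slope_mono_adjacent (convex_Icc x y) ?_
  intro u v w hu hw huv hvw
  by_contra! hcon
  have h1 : 0 < v - u := sub_pos.2 huv
  have h2 : 0 < w - v := sub_pos.2 hvw
  have h3 : 0 < w - u := by linarith
  set m := (g w - g u) / (w - u) with hm
  have hmw : m * (w - u) = g w - g u := div_mul_cancel₀ _ h3.ne'
  rw [div_lt_div_iff₀ h2 h1] at hcon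
  have hD : 0 < g v - (g u + m * (v - u)) := by
    have : 0 < (g v - (g u + m * (v - u))) * (w - u) := by
      have : m * (v - u) * (w - u) = (v - u) * (g w - g u) := by rw [← hmw]; ring
      nlinarith
    exact pos_of_mul_pos_left this h3.le
  set D := g v - (g u + m * (v - u)) with hDdef
  -- The parabola vanishes at `u` and `w` and lowers the value at `v` from `D` to `D / 2`.
  set η := D / (2 * ((v - u) * (w - v))) with hη
  have hη0 : 0 < η := by positivity
  have hηv : η * ((v - u) * (w - v)) = D / 2 := by rw [hη]; field_simp
  let H : ℝ → ℝ := fun t => g t - (g u + m * (t - u)) + η * ((t - u) * (t - w))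
  have hH : Continuous H := by fun_prop
  obtain ⟨t, ht, hmax⟩ := isCompact_Icc.exists_isMaxOn (nonempty_Icc.2 (huv.trans hvw).le)
    hH.continuousOn
  have hHv : 0 < H v := by
    have : H v = D - η * ((v - u) * (w - v)) := by simp only [H, hDdef]; ring
    rw [this, hηv]; linarith
  have hHt : 0 < H t := hHv.trans_le (hmax ⟨huv.le, hvw.le⟩)
  have hHu : H u = 0 := by simp [H]
  have hHw : H w = 0 := by simp only [H]; rw [hmw]; ring
  have htu : u < t := lt_of_le_of_ne ht.1 fun h => by rw [← h, hHu] at hHt; exact lt_irrefl _ hHt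
  have htw : t < w := lt_of_le_of_ne ht.2 fun h => by rw [h, hHw] at hHt; exact lt_irrefl _ hHt
  obtain ⟨r, hr0, hr1, hr2, hr3, hr4⟩ : ∃ r, 0 < r ∧ r ≤ r₀ ∧ r ≤ t - u ∧ r ≤ w - t ∧
      C * r < 2 * η := by
    refine ⟨min (min r₀ (η / (|C| + 1))) (min (t - u) (w - t)), ?_, ?_, ?_, ?_, ?_⟩
    · exact lt_min (lt_min hr₀ (by positivity)) (lt_min (by linarith) (by linarith))
    · exact (min_le_left _ _).trans (min_le_left _ _)
    · exact (min_le_right _ _).trans (min_le_left _ _)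
    · exact (min_le_right _ _).trans (min_le_right _ _)
    · set r := min (min r₀ (η / (|C| + 1))) (min (t - u) (w - t)) with hr
      have hr0 : 0 < r := lt_min (lt_min hr₀ (by positivity)) (lt_min (by linarith) (by linarith))
      have h4 : r ≤ η / (|C| + 1) := (min_le_left _ _).trans (min_le_right _ _)
      rw [le_div_iff₀ (by positivity)] at h4
      nlinarith [le_abs_self C]
  have hz := h t ⟨hu.1.trans_lt htu, htw.trans_le hw.2⟩ r hr0 hr1
  have m1 := hmax (show t + r ∈ Icc u w from ⟨by linarith, by linarith⟩)
  have m2 := hmax (show t - r ∈ Icc u w from ⟨by linarith, by linarith⟩)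
  simp only [mem_ofPred_eq, H] at m1 m2
  nlinarith [mul_pos hr0 hr0, mul_pos (mul_pos hr0 hr0) (sub_pos.2 hr4)]

end ContactEnergy

/-! ### Poisson extensions of bounded functions. -/

section BoundedExtension

variable {E : Type*} [NormedAddCommGroup E] [InnerProductSpace ℝ E] [FiniteDimensional ℝ E]
  [MeasurableSpace E] [BorelSpace E]

theorem poissonExtensionAbs_congr {u v : E → ℝ} (h : u =ᵐ[volume] v) (y : ℝ) (x : E) :
    poissonExtensionAbs u y x = poissonExtensionAbs v y x := by
  unfold poissonExtensionAbs
  refine lintegral_congr_ae ?_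
  filter_upwards [h] with z hz
  rw [hz]

theorem poissonMaximal_congr {u v : E → ℝ} (h : u =ᵐ[volume] v) :
    poissonMaximal u = poissonMaximal v := by
  funext x
  unfold poissonMaximal
  simp_rw [poissonExtensionAbs_congr h]

theorem poissonExtensionAbs_le_of_bound {u : E → ℝ} {B : ℝ} (hB : ∀ᵐ z, |u z| ≤ B) {y : ℝ}
    (hy : 0 < y) (x : E) : poissonExtensionAbs u y x ≤ ENNReal.ofReal B := by
  calc poissonExtensionAbs u y x
      ≤ ∫⁻ z, ENNReal.ofReal B * ENNReal.ofReal (halfSpacePoissonKernel y (x - z)) := by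
        refine lintegral_mono_ae ?_
        filter_upwards [hB] with z hz
        rw [ENNReal.ofReal_mul (abs_nonneg _)]
        gcongr
    _ = ENNReal.ofReal B := by
        rw [lintegral_const_mul' _ _ ENNReal.ofReal_ne_top,
          lintegral_sub_left_eq_self (fun z => ENNReal.ofReal (halfSpacePoissonKernel y z)) x,
          lintegral_halfSpacePoissonKernel hy, mul_one]

theorem poissonMaximal_le_of_bound {u : E → ℝ} {B : ℝ} (hB : ∀ᵐ z, |u z| ≤ B) (x : E) :
    poissonMaximal u x ≤ ENNReal.ofReal B :=
  iSup₂_le fun _ hy => poissonExtensionAbs_le_of_bound hB hy x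

theorem toReal_poissonExtensionAbs' {u : E → ℝ} (hu : AEStronglyMeasurable u volume) {y : ℝ}
    (hy : 0 < y) (x : E) :
    (poissonExtensionAbs u y x).toReal = ∫ z, |u (x - z)| * halfSpacePoissonKernel y z := by
  rw [toReal_poissonExtensionAbs hu hy,
    ← integral_sub_left_eq_self (fun z => |u z| * halfSpacePoissonKernel y (x - z)) volume x]
  simp

theorem memLp_top_poissonMaximal {u : E → ℝ} {B : ℝ} (hB : ∀ᵐ z, |u z| ≤ B) :
    MemLp (fun x => (poissonMaximal u x).toReal) ⊤ volume := by
  refine memLp_top_of_bound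
    (lowerSemicontinuous_poissonMaximal u).measurable.ennreal_toReal.aestronglyMeasurable
    (max B 0) (.of_forall fun x => ?_)
  rw [Real.norm_of_nonneg ENNReal.toReal_nonneg]
  have := ENNReal.toReal_mono ENNReal.ofReal_ne_top (poissonMaximal_le_of_bound hB x)
  rwa [ENNReal.toReal_ofReal'] at this

end BoundedExtension

/-! ### Energy estimate for the Poisson maximal function on the line. -/

section OneDimensional

open Filter Topology

variable {ψ σ : ℝ → ℝ}

/-- A partial energy depends continuously on finitely many values of the function, so bounds for it
pass to pointwise limits. -/
theorem PartialEnergy.exists_tendsto (hψ : Continuous ψ) {g : ℕ → ℝ → ℝ} {w : ℝ → ℝ}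
    (hg : ∀ x, Tendsto (fun k => g k x) atTop (𝓝 (w x))) {x T : ℝ} (hT : PartialEnergy ψ w x T) :
    ∃ S : ℕ → ℝ, (∀ k, PartialEnergy ψ (g k) x (S k)) ∧ Tendsto S atTop (𝓝 T) := by
  induction hT with
  | start x => exact ⟨fun _ => 0, fun _ => .start x, tendsto_const_nhds⟩
  | @step x x' T _ hx ih =>
    obtain ⟨S, hS, hST⟩ := ih
    refine ⟨fun k => S k + chordEnergy ψ (g k) x x', fun k => (hS k).step hx, hST.add ?_⟩
    unfold chordEnergy
    exact ((hψ.tendsto _).comp (((hg x').sub (hg x)).div_const _)).mul_const _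

/-- The supremum of the partial energies ending at or before `x` turns a bound for all partitions
into a monotone function that dominates every chord energy. -/
theorem exists_cumulative_energy (h : IsEnergyDensity ψ σ) {w : ℝ → ℝ} {K : ℝ}
    (hK : ∀ x T, PartialEnergy ψ w x T → T ≤ K) :
    ∃ e : ℝ → ℝ, Monotone e ∧ (∀ x, 0 ≤ e x) ∧ (∀ x, e x ≤ K) ∧
      ∀ a b, a ≤ b → chordEnergy ψ w a b ≤ e b - e a := by
  let A : ℝ → Set ℝ := fun x => {T | ∃ x' ≤ x, PartialEnergy ψ w x' T}
  have hbdd : ∀ x, BddAbove (A x) := fun x => ⟨K, by rintro T ⟨x', _, hT⟩; exact hK x' T hT⟩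
  have h0 : ∀ x, (0 : ℝ) ∈ A x := fun x => ⟨x, le_rfl, .start x⟩
  have hch : ∀ a b, a ≤ b → chordEnergy ψ w a b ≤ sSup (A b) - sSup (A a) := by
    intro a b hab
    rw [le_sub_iff_add_le, add_comm, ← le_sub_iff_add_le]
    refine csSup_le ⟨0, h0 a⟩ ?_
    rintro T ⟨x', hx', hT⟩
    have h2 : T + chordEnergy ψ w x' a + chordEnergy ψ w a b ≤ sSup (A b) :=
      le_csSup (hbdd b) ⟨b, le_rfl, (hT.step hx').step hab⟩
    linarith [chordEnergy_nonneg h w hx']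
  refine ⟨fun x => sSup (A x), fun a b hab => ?_, fun x => le_csSup (hbdd x) (h0 x),
    fun x => csSup_le ⟨0, h0 x⟩ ?_, hch⟩
  · have := hch a b hab
    linarith [chordEnergy_nonneg h w hab]
  · rintro T ⟨x', _, hT⟩; exact hK x' T hT

theorem integrable_bounded_mul_poisson {v : ℝ → ℝ} (hv : AEStronglyMeasurable v volume) {B : ℝ}
    (hB : ∀ z, |v z| ≤ B) {y : ℝ} (hy : 0 < y) (x : ℝ) :
    Integrable (fun z => v (x - z) * halfSpacePoissonKernel y z) := by
  refine (integrable_halfSpacePoissonKernel hy).bdd_mul ?_ (.of_forall fun z => hB (x - z))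
  exact hv.comp_quasiMeasurePreserving (quasiMeasurePreserving_sub_left volume x)

/-- The energy of a Poisson extension is controlled by the energy of the boundary values. -/
theorem chordEnergy_poissonExtensionAbs_le (h : IsEnergyDensity ψ σ) {u e₀ : ℝ → ℝ} {B K : ℝ}
    (hu : AEStronglyMeasurable u volume) (hB : ∀ z, |u z| ≤ B) (he : Monotone e₀)
    (he0 : ∀ x, 0 ≤ e₀ x) (heK : ∀ x, e₀ x ≤ K)
    (hch : ∀ a b, a < b → chordEnergy ψ u a b ≤ e₀ b - e₀ a) {y : ℝ} (hy : 0 < y) {a b : ℝ}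
    (hab : a < b) :
    chordEnergy ψ (fun x => (poissonExtensionAbs u y x).toReal) a b ≤
      (∫ z, e₀ (b - z) * halfSpacePoissonKernel y z)
        - ∫ z, e₀ (a - z) * halfSpacePoissonKernel y z := by
  have hba : 0 < b - a := sub_pos.2 hab
  have IU := integrable_bounded_mul_poisson (v := fun z => |u z|) hu.norm
    (fun z => by rw [abs_abs]; exact hB z) hy
  have IE := integrable_bounded_mul_poisson (v := e₀) he.measurable.aestronglyMeasurable
    (fun z => by rw [abs_of_nonneg (he0 z)]; exact heK z) hy
  have IP := integrable_halfSpacePoissonKernel (E := ℝ) hy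
  unfold chordEnergy
  simp only [toReal_poissonExtensionAbs' hu hy]
  set Fa := ∫ z, |u (a - z)| * halfSpacePoissonKernel y z with hFa
  set Fb := ∫ z, |u (b - z)| * halfSpacePoissonKernel y z with hFb
  set t := (Fb - Fa) / (b - a) with ht
  -- Jensen's inequality for the kernel as a probability density: the subgradient is taken at the
  -- slope `t` of the extension, and after integration the terms with `σ t` cancel. Replacing `u` by
  -- `|u|` lowers `ψ` of the slopes.
  have hpt : ∀ z, (ψ t - σ t * t) * (b - a) * halfSpacePoissonKernel y z
      + σ t * (|u (b - z)| * halfSpacePoissonKernel y z - |u (a - z)| * halfSpacePoissonKernel y z) ≤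
      e₀ (b - z) * halfSpacePoissonKernel y z - e₀ (a - z) * halfSpacePoissonKernel y z := by
    intro z
    have h1 := hch (a - z) (b - z) (by linarith)
    unfold chordEnergy at h1
    rw [show b - z - (a - z) = b - a by ring] at h1
    have h2 : ψ ((|u (b - z)| - |u (a - z)|) / (b - a)) ≤ ψ ((u (b - z) - u (a - z)) / (b - a)) := by
      refine h.mono_abs ?_
      rw [abs_div, abs_div]
      exact div_le_div_of_nonneg_right (abs_abs_sub_abs_le (u (b - z)) (u (a - z))) (abs_nonneg _)
    have h3 := h.subgradient ((|u (b - z)| - |u (a - z)|) / (b - a)) t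
    have h4 := mul_le_mul_of_nonneg_right (h3.trans h2) hba.le
    rw [add_mul, mul_assoc (σ t), sub_mul, div_mul_cancel₀ _ hba.ne'] at h4
    have h5 := mul_le_mul_of_nonneg_right (h4.trans h1) (halfSpacePoissonKernel_pos hy z).le
    linarith
  have I1 := (IU b).sub (IU a)
  have I2 := IP.const_mul ((ψ t - σ t * t) * (b - a))
  have key := integral_mono (I2.add (I1.const_mul (σ t))) ((IE b).sub (IE a)) hpt
  rw [integral_add' I2 (I1.const_mul (σ t)), integral_sub' (IE b) (IE a), integral_const_mul,
    integral_const_mul, integral_halfSpacePoissonKernel hy, integral_sub' (IU b) (IU a),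
    ← hFa, ← hFb] at key
  have h6 : t * (b - a) = Fb - Fa := div_mul_cancel₀ _ hba.ne'
  rw [← h6] at key
  linarith

/-- For each `ε` the extension at level `ε` and the truncated maximal function form `ContactData`,
the cumulative energy being `e₀` convolved with the kernel, still with values in `[0, K]`. The bound
does not depend on `ε`, so `ε` may tend to 0. -/
theorem partialEnergy_poissonMaximal_le (h : IsEnergyDensity ψ σ) {u e₀ : ℝ → ℝ} {B K : ℝ}
    (hu : AEStronglyMeasurable u volume) (hB : ∀ z, |u z| ≤ B) (he : Monotone e₀)
    (he0 : ∀ x, 0 ≤ e₀ x) (heK : ∀ x, e₀ x ≤ K)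
    (hch : ∀ a b, a < b → chordEnergy ψ u a b ≤ e₀ b - e₀ a) {x T : ℝ}
    (hT : PartialEnergy ψ (fun x => (poissonMaximal u x).toReal) x T) : T ≤ K := by
  have hbd : ∀ x, poissonMaximal u x ≤ ENNReal.ofReal B :=
    poissonMaximal_le_of_bound (.of_forall hB)
  have hfin : ∀ ε, 0 < ε → ∀ x, poissonMaximalFrom u ε x ≠ ⊤ := fun ε hε x =>
    ne_top_of_le_ne_top ENNReal.ofReal_ne_top ((poissonMaximalFrom_le u hε x).trans (hbd x))
  have hB0 : 0 ≤ B := (abs_nonneg _).trans (hB 0)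
  have hGB : ∀ ε, 0 < ε → ∀ x, (poissonMaximalFrom u ε x).toReal ≤ B := fun ε hε x => by
    have := ENNReal.toReal_mono ENNReal.ofReal_ne_top ((poissonMaximalFrom_le u hε x).trans (hbd x))
    rwa [ENNReal.toReal_ofReal hB0] at this
  have IE : ∀ {y : ℝ}, 0 < y → ∀ x, Integrable fun z => e₀ (x - z) * halfSpacePoissonKernel y z :=
    fun hy x => integrable_bounded_mul_poisson (v := e₀) he.measurable.aestronglyMeasurable
      (fun z => by rw [abs_of_nonneg (he0 z)]; exact heK z) hy x
  have D : ∀ ε, 0 < ε → ContactData ψ (fun x => (poissonExtensionAbs u ε x).toReal)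
      (fun x => (poissonMaximalFrom u ε x).toReal)
      (fun x => ∫ z, e₀ (x - z) * halfSpacePoissonKernel ε z) K := by
    intro ε hε
    have hfinE : ∀ x, poissonExtensionAbs u ε x ≠ ⊤ := fun x =>
      ne_top_of_le_ne_top (hfin ε hε x) (poissonExtensionAbs_le_from u le_rfl x)
    refine ⟨fun x => ENNReal.toReal_mono (hfin ε hε x) (poissonExtensionAbs_le_from u le_rfl x),
      continuous_poissonExtensionAbs u hε hfinE, continuous_poissonMaximalFrom u hε (hfin ε hε),
      ?_, ⟨B, by rintro _ ⟨x, rfl⟩; exact hGB ε hε x⟩, ?_, ?_, ?_⟩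
    · intro x y _ hd
      refine convexOn_Icc_of_second_difference (continuous_poissonMaximalFrom u hε (hfin ε hε))
        (C := poissonThirdConst ℝ / ε ^ 3 * B) (r₀ := ε / 2) (by positivity) fun z hz r hr hrε => ?_
      have := poissonMaximalFrom_second_differences (OrthonormalBasis.singleton (Fin 1) ℝ) hu hε
        (hfin ε hε) (hd z hz) hr hrε
      simp only [Finset.univ_unique, Finset.sum_singleton, OrthonormalBasis.coe_singleton,
        Pi.one_apply, smul_eq_mul, mul_one, Fintype.card_unique, Nat.cast_one] at this
      refine this.trans (add_le_add_right ?_ _)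
      have h0 := poissonThirdConst_nonneg (E := ℝ)
      calc poissonThirdConst ℝ / ε ^ 3 * r ^ 3 * (poissonMaximalFrom u ε z).toReal
          ≤ poissonThirdConst ℝ / ε ^ 3 * r ^ 3 * B := by
            gcongr
            exact hGB ε hε z
        _ = _ := by ring
    · exact fun x => integral_nonneg fun z =>
        mul_nonneg (he0 _) (halfSpacePoissonKernel_pos hε z).le
    · intro x
      have := integral_mono (IE hε x) ((integrable_halfSpacePoissonKernel hε).const_mul K)
        fun z => mul_le_mul_of_nonneg_right (heK (x - z)) (halfSpacePoissonKernel_pos hε z).le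
      rwa [integral_const_mul, integral_halfSpacePoissonKernel hε, mul_one] at this
    · exact fun hab => chordEnergy_poissonExtensionAbs_le h hu hB he he0 heK hch hε hab
  obtain ⟨S, hS, hST⟩ := hT.exists_tendsto h.continuous
    (g := fun k x => (poissonMaximalFrom u (1 / ((k : ℝ) + 1)) x).toReal)
    (fun x => (ENNReal.tendsto_toReal (ne_top_of_le_ne_top ENNReal.ofReal_ne_top (hbd x))).comp
      (tendsto_poissonMaximalFrom u x))
  exact le_of_tendsto' hST fun k => (hS k).le_of_contactData h (D _ (by positivity))

end OneDimensional

/-! ### The energy densities (|t| - M)⁺ and |t|^p. -/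

section Densities

theorem isEnergyDensity_of_subgradient {ψ σ : ℝ → ℝ} (h0 : ψ 0 = 0)
    (hm : ∀ s t, |s| ≤ |t| → ψ s ≤ ψ t) (hc : Continuous ψ)
    (hs : ∀ s t, ψ t + σ t * (s - t) ≤ ψ s) (hn : ∀ t, 0 ≤ t → 0 ≤ σ t)
    (hn' : ∀ t, t ≤ 0 → σ t ≤ 0) : IsEnergyDensity ψ σ where
  map_zero := h0
  mono_abs := hm _ _
  continuous := hc
  subgradient := hs
  monotone := by
    intro s t hst
    rcases hst.eq_or_lt with rfl | hst
    · exact le_rfl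
    have h1 := hs s t
    have h2 := hs t s
    by_contra! h
    nlinarith [mul_pos (sub_pos.2 h) (sub_pos.2 hst)]
  sign_nonneg := hn _
  sign_nonpos := hn' _

/-- For `M = 0` the energy is the total variation. Large `M` measures only the steep part of a
function and is used to exclude singular parts of the derivative. -/
theorem isEnergyDensity_truncated {M : ℝ} (hM : 0 ≤ M) :
    IsEnergyDensity (fun t => max (|t| - M) 0)
      (fun t => if M < t then 1 else if t < -M then -1 else 0) := by
  refine isEnergyDensity_of_subgradient (by simp [hM]) (fun s t h => ?_) (by fun_prop)
    (fun s t => ?_) (fun t ht => ?_) (fun t ht => ?_)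
  · gcongr
  · have h1 := le_max_left (|s| - M) 0
    have h2 := le_max_right (|s| - M) 0
    have h3 := le_abs_self s
    have h4 := neg_le_abs s
    split_ifs with h h'
    · rw [abs_of_nonneg (by linarith : 0 ≤ t), max_eq_left (by linarith)]; linarith
    · rw [abs_of_nonpos (by linarith : t ≤ 0), max_eq_left (by linarith)]; linarith
    · rw [max_eq_right (by rw [sub_nonpos, abs_le]; constructor <;> linarith)]; linarith
  · split_ifs <;> linarith
  · split_ifs <;> linarith

theorem exists_isEnergyDensity_rpow {p : ℝ} (hp : 1 ≤ p) :
    ∃ σ, IsEnergyDensity (fun t => |t| ^ p) σ := by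
  rcases hp.eq_or_lt with rfl | hp
  · have h := isEnergyDensity_truncated (le_refl (0 : ℝ))
    have e : (fun t : ℝ => |t| ^ (1 : ℝ)) = fun t => max (|t| - 0) 0 := by
      funext t; simp
    rw [e]
    exact ⟨_, h⟩
  refine ⟨fun t => p * |t| ^ (p - 2) * t, isEnergyDensity_of_subgradient
    (by simp [(by linarith : p ≠ 0)]) (fun s t h => by gcongr)
    (continuous_abs.rpow_const fun _ => Or.inr (by linarith)) (fun s t => ?_) (fun t ht => by positivity)
    (fun t ht => mul_nonpos_of_nonneg_of_nonpos (by positivity) ht)⟩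
  have hconv : ConvexOn ℝ univ (fun t : ℝ => |t| ^ p) := by
    refine ⟨convex_univ, fun x _ y _ a b ha hb hab => ?_⟩
    have h1 : |a • x + b • y| ≤ a • |x| + b • |y| := by
      refine (abs_add_le _ _).trans ?_
      simp [abs_mul, abs_of_nonneg ha, abs_of_nonneg hb]
    exact (Real.rpow_le_rpow (abs_nonneg _) h1 (by linarith)).trans
      ((convexOn_rpow hp.le).2 (abs_nonneg x) (abs_nonneg y) ha hb hab)
  have hd := hasDerivAt_abs_rpow t hp
  rcases lt_trichotomy s t with h | rfl | h
  · have := hconv.slope_le_of_hasDerivAt (mem_univ s) (mem_univ t) h hd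
    rw [slope_def_field, div_le_iff₀ (by linarith)] at this
    linarith
  · simp
  · have := hconv.le_slope_of_hasDerivAt (mem_univ t) (mem_univ s) h hd
    rw [slope_def_field, le_div_iff₀ (by linarith)] at this
    linarith

end Densities

/-! ### Functions of bounded variation. -/

section BoundedVariation

theorem measurable_of_boundedVariationOn {u : ℝ → ℝ} (hu : BoundedVariationOn u univ) :
    Measurable u := by
  obtain ⟨p, q, hp, hq, rfl⟩ := hu.locallyBoundedVariationOn.exists_monotoneOn_sub_monotoneOn
  exact (monotoneOn_univ.1 hp).measurable.sub (monotoneOn_univ.1 hq).measurable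

theorem chordEnergy_abs {w : ℝ → ℝ} {a b : ℝ} (hab : a ≤ b) :
    chordEnergy (fun t => max (|t| - 0) 0) w a b = |w b - w a| := by
  rcases hab.eq_or_lt with rfl | hab
  · simp
  · have : 0 < b - a := sub_pos.2 hab
    unfold chordEnergy
    simp only [sub_zero]
    rw [max_eq_left (abs_nonneg _), abs_div, abs_of_pos this, div_mul_cancel₀ _ this.ne']

/-- The Poisson maximal operator does not increase the total variation. -/
theorem boundedVariation_poissonMaximal {u : ℝ → ℝ} (hu : BoundedVariationOn u univ) :
    (∀ x, poissonMaximal u x < ⊤) ∧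
      BoundedVariationOn (fun x => (poissonMaximal u x).toReal) univ ∧
      eVariationOn (fun x => (poissonMaximal u x).toReal) univ ≤ eVariationOn u univ := by
  set K := (eVariationOn u univ).toReal with hK
  have hB : ∀ z, |u z| ≤ |u 0| + K := fun z => by
    have := hu.dist_le (mem_univ z) (mem_univ 0)
    rw [Real.dist_eq] at this
    linarith [abs_sub_abs_le_abs_sub (u z) (u 0)]
  have hfinI : ∀ x, eVariationOn u (Iic x) ≠ ⊤ := fun x =>
    ne_top_of_le_ne_top hu (eVariationOn.mono u (subset_univ _))
  -- For the density with `M = 0` the partial energies are exactly the sums that define the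
  -- variation.
  have hsum : ∀ n (s : ℕ → ℝ), Monotone s → PartialEnergy (fun t => max (|t| - 0) 0)
      (fun x => (poissonMaximal u x).toReal) (s n)
      (∑ i ∈ Finset.range n, |(poissonMaximal u (s (i + 1))).toReal - (poissonMaximal u (s i)).toReal|) := by
    intro n s hs
    induction n with
    | zero => simpa using PartialEnergy.start _
    | succ n ih =>
      have := ih.step (hs (Nat.le_succ n))
      rw [chordEnergy_abs (hs (Nat.le_succ n))] at this
      rwa [Finset.sum_range_succ]
  have hle : eVariationOn (fun x => (poissonMaximal u x).toReal) univ ≤ eVariationOn u univ := by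
    refine iSup_le fun p => ?_
    have := partialEnergy_poissonMaximal_le (isEnergyDensity_truncated le_rfl)
      (measurable_of_boundedVariationOn hu).aestronglyMeasurable hB
      (e₀ := fun x => (eVariationOn u (Iic x)).toReal) (K := K)
      (fun a b hab => ENNReal.toReal_mono (hfinI b) (eVariationOn.mono u (Iic_subset_Iic.2 hab)))
      (fun x => ENNReal.toReal_nonneg)
      (fun x => ENNReal.toReal_mono hu (eVariationOn.mono u (subset_univ _)))
      (fun a b hab => by
        rw [chordEnergy_abs hab.le, le_sub_iff_add_le, add_comm]
        have h1 := eVariationOn.add_le_union u (s := Iic a) (t := Icc a b)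
          fun x hx y hy => le_trans hx hy.1
        rw [Iic_union_Icc_eq_Iic hab.le] at h1
        have h2 := eVariationOn.edist_le u (right_mem_Icc.2 hab.le) (left_mem_Icc.2 hab.le)
        have h3 := (add_le_add_right h2 (eVariationOn u (Iic a))).trans h1
        have h4 := ENNReal.toReal_mono (hfinI b) h3
        rw [ENNReal.toReal_add (hfinI a) (edist_ne_top _ _), edist_dist,
          ENNReal.toReal_ofReal dist_nonneg, Real.dist_eq] at h4
        exact h4) (hsum p.1 p.2.1 p.2.2.1)
    rw [← ENNReal.ofReal_toReal hu]
    refine le_trans (le_of_eq ?_) (ENNReal.ofReal_le_ofReal this)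
    rw [ENNReal.ofReal_sum_of_nonneg fun _ _ => abs_nonneg _]
    simp_rw [edist_dist, Real.dist_eq]
  exact ⟨fun x => (poissonMaximal_le_of_bound (.of_forall hB) x).trans_lt ENNReal.ofReal_lt_top,
    ne_top_of_le_ne_top hu hle, hle⟩

end BoundedVariation

/-! ### Absolute continuity and the energy of the derivative. -/

section AbsoluteContinuity

open Filter Topology

/-- A monotone function carries disjoint intervals to disjoint intervals between its values, and all
of these lie in `(0, K]`, so their lengths add up to at most `K`. -/
theorem sum_increments_le {e : ℝ → ℝ} {K : ℝ} (he : Monotone e) (he0 : ∀ x, 0 ≤ e x)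
    (heK : ∀ x, e x ≤ K) {n : ℕ} {a b : ℕ → ℝ} (hab : ∀ i, a i ≤ b i)
    (hd : (Finset.range n : Set ℕ).PairwiseDisjoint fun i => Ioc (a i) (b i)) :
    ∑ i ∈ Finset.range n, (e (b i) - e (a i)) ≤ K := by
  have hK : 0 ≤ K := (he0 0).trans (heK 0)
  have hd' : (Finset.range n : Set ℕ).PairwiseDisjoint fun i => Ioc (e (a i)) (e (b i)) := by
    intro i hi j hj hij
    refine Set.disjoint_left.2 fun z hz hz' => ?_
    have h1 : a i < b i := he.reflect_lt (hz.1.trans_le hz.2)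
    have h2 : a j < b j := he.reflect_lt (hz'.1.trans_le hz'.2)
    have h3 : a i < b j := he.reflect_lt (hz.1.trans_le hz'.2)
    have h4 : a j < b i := he.reflect_lt (hz'.1.trans_le hz.2)
    have hdis : Disjoint (Ioc (a i) (b i)) (Ioc (a j) (b j)) := hd hi hj hij
    exact Set.disjoint_left.1 hdis (show min (b i) (b j) ∈ Ioc (a i) (b i) from
      ⟨lt_min h1 h3, min_le_left _ _⟩) ⟨lt_min h4 h2, min_le_right _ _⟩
  have h1 := measure_biUnion_finset (μ := (volume : Measure ℝ)) hd' fun i _ => measurableSet_Ioc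
  have h2 : (volume : Measure ℝ) (⋃ i ∈ Finset.range n, Ioc (e (a i)) (e (b i))) ≤ ENNReal.ofReal K := by
    calc _ ≤ volume (Ioc 0 K) := measure_mono (iUnion₂_subset fun i _ => fun z hz =>
          ⟨(he0 _).trans_lt hz.1, hz.2.trans (heK _)⟩)
      _ = _ := by simp
  rw [h1] at h2
  simp_rw [Real.volume_Ioc] at h2
  rw [← ENNReal.ofReal_sum_of_nonneg fun i _ => sub_nonneg.2 (he (hab i))] at h2
  exact (ENNReal.ofReal_le_ofReal_iff hK).1 h2

/-- Control of all truncated energies implies absolute continuity. -/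
theorem absolutelyContinuous_of_truncated_energy {w : ℝ → ℝ} {K : ℝ → ℝ}
    (hK : Tendsto K atTop (𝓝 0))
    (hw : ∀ M, 1 ≤ M → ∃ e : ℝ → ℝ, Monotone e ∧ (∀ x, 0 ≤ e x) ∧ (∀ x, e x ≤ K M) ∧
      ∀ a b, a ≤ b → chordEnergy (fun t => max (|t| - M) 0) w a b ≤ e b - e a) (a b : ℝ) :
    AbsolutelyContinuousOnInterval w a b := by
  rw [absolutelyContinuousOnInterval_iff]
  intro ε hε
  obtain ⟨M, hM, hM1⟩ := ((hK.eventually (gt_mem_nhds (half_pos hε))).and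
    (eventually_ge_atTop (1 : ℝ))).exists
  obtain ⟨e, he, he0, heK, hch⟩ := hw M hM1
  have hM0 : 0 ≤ M := by linarith
  refine ⟨ε / (2 * (M + 1)), by positivity, fun P hP hlen => ?_⟩
  -- An increment is at most `M` times the length plus the truncated energy. `M` was chosen first,
  -- to keep the total truncated energy below `ε / 2`; the total length is then small relative to
  -- `M`.
  have key : ∀ s t : ℝ, dist (w s) (w t) ≤ M * dist s t + (e (max s t) - e (min s t)) := by
    intro s t
    wlog hst : s ≤ t generalizing s t
    · rw [dist_comm, dist_comm s t, max_comm, min_comm]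
      exact this t s (le_of_not_ge hst)
    rw [max_eq_right hst, min_eq_left hst, dist_comm, dist_comm s, Real.dist_eq, Real.dist_eq,
      abs_of_nonneg (sub_nonneg.2 hst)]
    rcases hst.eq_or_lt with rfl | hst
    · simp
    have h0 : 0 < t - s := sub_pos.2 hst
    have h1 := hch s t hst.le
    unfold chordEnergy at h1
    have h2 := mul_le_mul_of_nonneg_right (le_max_left (|(w t - w s) / (t - s)| - M) 0) h0.le
    rw [sub_mul, abs_div, abs_of_pos h0, div_mul_cancel₀ _ h0.ne'] at h2
    have h3 := h2.trans (by simpa [abs_div, abs_of_pos h0] using h1)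
    linarith
  have hsum := sum_increments_le he he0 heK (n := P.1) (a := fun i => min (P.2 i).1 (P.2 i).2)
    (b := fun i => max (P.2 i).1 (P.2 i).2) (fun i => min_le_max) hP.2
  calc ∑ i ∈ Finset.range P.1, dist (w (P.2 i).1) (w (P.2 i).2)
      ≤ ∑ i ∈ Finset.range P.1, (M * dist (P.2 i).1 (P.2 i).2
          + (e (max (P.2 i).1 (P.2 i).2) - e (min (P.2 i).1 (P.2 i).2))) :=
        Finset.sum_le_sum fun i _ => key _ _
    _ ≤ M * (ε / (2 * (M + 1))) + K M := by
        rw [Finset.sum_add_distrib, ← Finset.mul_sum]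
        gcongr
    _ < ε := by
        have : M * (ε / (2 * (M + 1))) ≤ ε / 2 := by
          rw [mul_div_assoc', div_le_div_iff₀ (by positivity) (by positivity)]
          nlinarith
        linarith

/-- Fatou's lemma for difference quotients. Their energy density is at most the difference quotient
of `e`, whose integral over a bounded window telescopes to means of `e` at the two ends and is at
most `K`. -/
theorem lintegral_density_deriv_le {ψ σ w e : ℝ → ℝ} {K : ℝ} (h : IsEnergyDensity ψ σ)
    (hw : Measurable w) (hdiff : ∀ᵐ x, DifferentiableAt ℝ w x) (he : Monotone e)
    (he0 : ∀ x, 0 ≤ e x) (heK : ∀ x, e x ≤ K)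
    (hch : ∀ a b, a ≤ b → chordEnergy ψ w a b ≤ e b - e a) :
    ∫⁻ x, ENNReal.ofReal (ψ (deriv w x)) ≤ ENNReal.ofReal K := by
  let r : ℕ → ℝ := fun k => 1 / ((k : ℝ) + 1)
  have hr : ∀ k, 0 < r k := fun k => by positivity
  let F : ℕ → ℝ → ℝ≥0∞ := fun k => (Ioc (-(k : ℝ)) k).indicator
    fun x => ENNReal.ofReal (ψ ((w (x + r k) - w x) / r k))
  have hF : ∀ k, Measurable (F k) := fun k => by
    refine Measurable.indicator ?_ measurableSet_Ioc
    exact (h.continuous.measurable.comp (((hw.comp (measurable_id.add_const _)).sub hw).div_const _)).ennreal_ofReal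
  have hlim : ∀ᵐ x, Tendsto (fun k => F k x) atTop (𝓝 (ENNReal.ofReal (ψ (deriv w x)))) := by
    filter_upwards [hdiff] with x hx
    have h1 := hx.hasDerivAt.tendsto_slope_zero_right
    have h2 : Tendsto r atTop (𝓝[>] 0) := tendsto_nhdsWithin_iff.2
      ⟨tendsto_one_div_add_atTop_nhds_zero_nat, .of_forall hr⟩
    have h3 := (h1.comp h2)
    have h4 := (ENNReal.continuous_ofReal.comp h.continuous).tendsto _ |>.comp h3
    refine h4.congr' ?_
    obtain ⟨n, hn⟩ := exists_nat_gt |x|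
    filter_upwards [eventually_ge_atTop n] with k hk
    have hk' : |x| < k := hn.trans_le (by exact_mod_cast hk)
    rw [abs_lt] at hk'
    simp only [F]
    rw [indicator_of_mem (show x ∈ Ioc (-(k : ℝ)) k from ⟨hk'.1, hk'.2.le⟩)]
    simp only [Function.comp_apply, smul_eq_mul, div_eq_inv_mul]
  have hbound : ∀ k, ∫⁻ x, F k x ≤ ENNReal.ofReal K := by
    intro k
    have hint : ∀ a b, IntervalIntegrable e volume a b := fun a b => he.intervalIntegrable
    have hint1 : IntervalIntegrable (fun x => e (x + r k)) volume (-(k : ℝ)) k :=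
      (he.comp (fun x y hxy => by simpa using hxy : Monotone fun x => x + r k)).intervalIntegrable
    have hint2 : IntervalIntegrable (fun x => (e (x + r k) - e x) / r k) volume (-(k : ℝ)) k :=
      (hint1.sub (hint _ _)).div_const _
    have hk0 : -(k : ℝ) ≤ k := by linarith [(Nat.cast_nonneg k : (0 : ℝ) ≤ k)]
    rw [lintegral_indicator measurableSet_Ioc]
    calc ∫⁻ x in Ioc (-(k : ℝ)) k, ENNReal.ofReal (ψ ((w (x + r k) - w x) / r k))
        ≤ ∫⁻ x in Ioc (-(k : ℝ)) k, ENNReal.ofReal ((e (x + r k) - e x) / r k) := by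
          refine lintegral_mono fun x => ENNReal.ofReal_le_ofReal ?_
          rw [le_div_iff₀ (hr k)]
          have := hch x (x + r k) (by linarith [hr k])
          unfold chordEnergy at this
          rwa [add_sub_cancel_left] at this
      _ = ENNReal.ofReal (∫ x in (-(k : ℝ))..k, (e (x + r k) - e x) / r k) := by
          rw [intervalIntegral.integral_of_le hk0, ofReal_integral_eq_lintegral_ofReal]
          · exact (intervalIntegrable_iff_integrableOn_Ioc_of_le hk0).1 hint2
          · exact .of_forall fun x => div_nonneg (sub_nonneg.2 (he (by linarith [hr k]))) (hr k).le
      _ ≤ ENNReal.ofReal K := by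
          refine ENNReal.ofReal_le_ofReal ?_
          rw [intervalIntegral.integral_div, div_le_iff₀ (hr k), intervalIntegral.integral_sub
            hint1 (hint _ _), intervalIntegral.integral_comp_add_right,
            intervalIntegral.integral_interval_sub_interval_comm' (hint _ _) (hint _ _) (hint _ _)]
          have h1 : ∫ x in (k : ℝ)..(k + r k), e x ≤ K * r k := by
            have := intervalIntegral.integral_mono_on (by linarith [hr k] : (k : ℝ) ≤ k + r k)
              (hint _ _) (intervalIntegrable_const (c := K)) fun x _ => heK x
            simpa [mul_comm] using this
          have h2 : 0 ≤ ∫ x in (-(k : ℝ))..(-k + r k), e x :=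
            intervalIntegral.integral_nonneg (by linarith [hr k]) fun x _ => he0 x
          linarith
  calc ∫⁻ x, ENNReal.ofReal (ψ (deriv w x)) = ∫⁻ x, liminf (fun k => F k x) atTop := by
        refine lintegral_congr_ae ?_
        filter_upwards [hlim] with x hx
        exact hx.liminf_eq.symm
    _ ≤ liminf (fun k => ∫⁻ x, F k x) atTop := lintegral_liminf_le hF
    _ ≤ ENNReal.ofReal K := by
        refine (liminf_le_liminf (.of_forall hbound)).trans (by simp)

end AbsoluteContinuity

/-! ### The weak derivative of the maximal function on the line, finite exponents. -/

section SobolevLine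

open Filter Topology

/-- Jensen's inequality: the slope of the chord is the mean of `G`, so the linear term of the
subgradient inequality integrates to 0. -/
theorem chordEnergy_le_integral {ψ σ v G : ℝ → ℝ} (h : IsEnergyDensity ψ σ)
    (hGi : ∀ a b, IntervalIntegrable G volume a b) (hv : ∀ a b, v b - v a = ∫ x in a..b, G x)
    (hψ : Integrable fun x => ψ (G x)) {a b : ℝ} (hab : a < b) :
    chordEnergy ψ v a b ≤ (∫ x in Iic b, ψ (G x)) - ∫ x in Iic a, ψ (G x) := by
  have hba : 0 < b - a := sub_pos.2 hab
  rw [intervalIntegral.integral_Iic_sub_Iic hψ.integrableOn hψ.integrableOn]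
  unfold chordEnergy
  set t := (v b - v a) / (b - a) with ht
  have h1 : IntervalIntegrable (fun x => σ t * (G x - t)) volume a b :=
    ((hGi a b).sub intervalIntegrable_const).const_mul _
  have key := intervalIntegral.integral_mono_on hab.le (intervalIntegrable_const.add h1)
    hψ.intervalIntegrable fun x _ => h.subgradient (G x) t
  rw [intervalIntegral.integral_add intervalIntegrable_const h1,
    intervalIntegral.integral_const_mul, intervalIntegral.integral_sub (hGi a b)
    intervalIntegrable_const, ← hv a b, intervalIntegral.integral_const,
    intervalIntegral.integral_const, smul_eq_mul, smul_eq_mul, mul_comm (b - a) t,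
    div_mul_cancel₀ _ hba.ne', sub_self, mul_zero, add_zero] at key
  linarith

theorem hasWeakGradient_deriv {w : ℝ → ℝ} (hw : ∀ a b, AbsolutelyContinuousOnInterval w a b)
    (hw1 : LocallyIntegrable w volume) (hw2 : LocallyIntegrable (deriv w) volume) :
    HasWeakGradient w (deriv w) := by
  refine ⟨hw1, hw2, fun φ hφ hφc v => ?_⟩
  obtain ⟨R, hR⟩ := hφc.isCompact.isBounded.subset_closedBall 0
  have hR0 : ∀ x, |R| + 1 ≤ |x| → φ x = 0 := fun x hx => by
    refine image_eq_zero_of_notMem_tsupport fun h => ?_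
    have := hR h
    rw [Metric.mem_closedBall, dist_zero_right, Real.norm_eq_abs] at this
    linarith [le_abs_self R]
  have hR1 : ∀ x, |R| + 1 < |x| → deriv φ x = 0 := fun x hx => by
    have : φ =ᶠ[𝓝 x] fun _ => 0 := by
      filter_upwards [(isOpen_lt continuous_const continuous_abs).mem_nhds hx] with z hz
      exact hR0 z (le_of_lt hz)
    rw [this.deriv_eq, deriv_const]
  -- Beyond the radius of the support, so that `φ` vanishes at both endpoints and the boundary terms
  -- disappear.
  set S := |R| + 1 with hS
  have hS0 : 0 ≤ S := by positivity
  have hsupp : ∀ F : ℝ → ℝ, (∀ x, S < |x| → F x = 0) → ∫ x, F x = ∫ x in (-S)..S, F x := by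
    intro F hF
    rw [intervalIntegral.integral_of_le (by linarith), ← integral_Icc_eq_integral_Ioc]
    refine (setIntegral_eq_integral_of_forall_compl_eq_zero fun x hx => hF x ?_).symm
    by_contra! hx'
    rw [abs_le] at hx'
    exact hx hx'
  have hφ1 : ContDiff ℝ 1 φ := hφ.of_le (by exact_mod_cast le_top)
  have hφac : AbsolutelyContinuousOnInterval φ (-S) S :=
    hφ1.contDiffOn.absolutelyContinuousOnInterval
  have hparts := AbsolutelyContinuousOnInterval.integral_mul_deriv_eq_deriv_mul (hw (-S) S) hφac
  rw [hR0 S (le_abs_self S), hR0 (-S) (by rw [abs_neg]; exact le_abs_self S)] at hparts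
  have e1 : ∀ x, w x * fderiv ℝ φ x v = v * (w x * deriv φ x) := fun x => by
    rw [fderiv_eq_smul_deriv, smul_eq_mul]; ring
  have e2 : ∀ x, inner ℝ (deriv w x) v * φ x = v * (deriv w x * φ x) := fun x => by
    simp; ring
  simp_rw [e1, e2]
  rw [integral_const_mul, integral_const_mul, hsupp (fun x => w x * deriv φ x)
    (fun x hx => by rw [hR1 x hx, mul_zero]), hsupp (fun x => deriv w x * φ x)
    (fun x hx => by rw [hR0 x hx.le, mul_zero]), hparts]
  ring

/-- The Poisson maximal function of a function with derivative in `L^p`, `1 ≤ p < ∞`. -/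
theorem poissonMaximal_weakGradient_line {v G : ℝ → ℝ} {p : ℝ≥0∞} (hp : 1 ≤ p) (hp' : p ≠ ⊤)
    {B : ℝ} (hvm : AEStronglyMeasurable v volume) (hB : ∀ z, |v z| ≤ B)
    (hv : ∀ a b, v b - v a = ∫ x in a..b, G x) (hG : MemLp G p volume) :
    HasWeakGradient (fun x => (poissonMaximal v x).toReal)
        (deriv fun x => (poissonMaximal v x).toReal) ∧
      eLpNorm (deriv fun x => (poissonMaximal v x).toReal) p volume ≤ eLpNorm G p volume := by
  set w := fun x => (poissonMaximal v x).toReal with hw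
  have hwm : Measurable w := (lowerSemicontinuous_poissonMaximal v).measurable.ennreal_toReal
  have hGi : ∀ a b, IntervalIntegrable G volume a b := fun a b =>
    ((hG.locallyIntegrable hp).integrableOn_isCompact isCompact_uIcc).intervalIntegrable
  have hp0 : p ≠ 0 := (zero_lt_one.trans_le hp).ne'
  set q := p.toReal with hq
  have hq1 : 1 ≤ q := by
    have := ENNReal.toReal_mono hp' hp
    simpa using this
  have hIq : Integrable fun x => |G x| ^ q := hG.integrable_norm_rpow hp0 hp'
  have energy : ∀ {ψ σ : ℝ → ℝ}, IsEnergyDensity ψ σ → Integrable (fun x => ψ (G x)) →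
      ∃ e : ℝ → ℝ, Monotone e ∧ (∀ x, 0 ≤ e x) ∧ (∀ x, e x ≤ ∫ z, ψ (G z)) ∧
      ∀ a b, a ≤ b → chordEnergy ψ w a b ≤ e b - e a := by
    intro ψ σ h hI
    refine exists_cumulative_energy h fun x T hT => ?_
    have h0 : ∀ s : Set ℝ, 0 ≤ ∫ x in s, ψ (G x) := fun s => integral_nonneg fun x => h.nonneg _
    exact partialEnergy_poissonMaximal_le h hvm hB (e₀ := fun x => ∫ z in Iic x, ψ (G z))
      (fun a b hab => setIntegral_mono_set hI.integrableOn (.of_forall fun x => h.nonneg _)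
        (Iic_subset_Iic.2 hab).eventuallyLE)
      (fun x => h0 _) (fun x => setIntegral_le_integral hI (.of_forall fun x => h.nonneg _))
      (fun a b hab => chordEnergy_le_integral h hGi hv hI hab) hT
  -- This makes the truncated energies finite although `G` itself need not be integrable. It also
  -- dominates them as `M → ∞`, so that they tend to 0 and give absolute continuity.
  have hdom : ∀ M t : ℝ, 1 ≤ M → max (|t| - M) 0 ≤ |t| ^ q := by
    intro M t hM
    refine max_le ?_ (by positivity)
    rcases le_or_gt 1 |t| with h | h
    · have := Real.rpow_le_rpow_of_exponent_le h hq1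
      rw [Real.rpow_one] at this
      linarith
    · have : 0 ≤ |t| ^ q := by positivity
      linarith
  have hmeasM : ∀ M : ℝ, AEStronglyMeasurable (fun x => max (|G x| - M) 0) volume := fun M =>
    (by fun_prop : Continuous fun t : ℝ => max (|t| - M) 0).comp_aestronglyMeasurable
      hG.aestronglyMeasurable
  have hIM : ∀ M : ℝ, 1 ≤ M → Integrable fun x => max (|G x| - M) 0 := fun M hM =>
    hIq.mono' (hmeasM M) (.of_forall fun x => by
      rw [Real.norm_of_nonneg (le_max_right _ _)]; exact hdom M _ hM)
  have hac : ∀ a b, AbsolutelyContinuousOnInterval w a b := by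
    refine absolutelyContinuous_of_truncated_energy (K := fun M => ∫ x, max (|G x| - M) 0) ?_
      fun M hM => energy (isEnergyDensity_truncated (by linarith)) (hIM M hM)
    have := tendsto_integral_filter_of_dominated_convergence (l := atTop)
      (F := fun M x => max (|G x| - M) 0) (f := fun _ => (0 : ℝ)) (μ := volume) (fun x => |G x| ^ q)
      (.of_forall hmeasM)
      (by
        filter_upwards [eventually_ge_atTop (1 : ℝ)] with M hM
        exact .of_forall fun x => by
          rw [Real.norm_of_nonneg (le_max_right _ _)]; exact hdom M _ hM)
      hIq (.of_forall fun x => by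
        refine tendsto_const_nhds.congr' ?_
        filter_upwards [eventually_ge_atTop |G x|] with M hM
        rw [max_eq_right (by linarith)])
    simpa using this
  have hdiff : ∀ᵐ x, DifferentiableAt ℝ w x := by
    have : ∀ n : ℕ, ∀ᵐ x, x ∈ uIcc (-(n : ℝ)) n → DifferentiableAt ℝ w x :=
      fun n => (hac _ _).ae_differentiableAt
    filter_upwards [ae_all_iff.2 this] with x hx
    obtain ⟨n, hn⟩ := exists_nat_ge |x|
    refine hx n ?_
    rw [abs_le] at hn
    rw [uIcc_of_le (by linarith)]
    exact hn
  obtain ⟨σ, hσ⟩ := exists_isEnergyDensity_rpow hq1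
  obtain ⟨e, he, he0, heK, hch⟩ := energy hσ hIq
  have hL := lintegral_density_deriv_le hσ hwm hdiff he he0 heK hch
  have hnorm : eLpNorm (deriv w) p volume ≤ eLpNorm G p volume := by
    rw [eLpNorm_eq_lintegral_rpow_enorm_toReal hp0 hp', eLpNorm_eq_lintegral_rpow_enorm_toReal hp0 hp']
    refine ENNReal.rpow_le_rpow ?_ (by positivity)
    rw [ofReal_integral_eq_lintegral_ofReal hIq (.of_forall fun x => by positivity)] at hL
    have e1 : ∀ t : ℝ, ENNReal.ofReal (|t| ^ q) = ‖t‖ₑ ^ q := fun t => by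
      rw [← ENNReal.ofReal_rpow_of_nonneg (abs_nonneg _) (by linarith), Real.enorm_eq_ofReal_abs]
    simp_rw [e1] at hL
    exact hL
  refine ⟨hasWeakGradient_deriv hac ?_ ?_, hnorm⟩
  · exact ((memLp_top_poissonMaximal (.of_forall hB)).locallyIntegrable le_top)
  · exact MemLp.locallyIntegrable ⟨(measurable_deriv w).aestronglyMeasurable,
      hnorm.trans_lt hG.2⟩ hp

end SobolevLine

/-! ### Weak gradients: fundamental theorem of calculus, uniqueness, Lipschitz functions. -/

section WeakGradient

open Filter Topology

variable {E : Type*} [NormedAddCommGroup E] [InnerProductSpace ℝ E] [FiniteDimensional ℝ E]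
  [MeasurableSpace E] [BorelSpace E]

theorem integrable_prod_translate_test {F φ : E → ℝ} (hF : LocallyIntegrable F volume)
    (hφ : Continuous φ) (hφc : HasCompactSupport φ) (h : E) :
    Integrable (fun p : ℝ × E => F p.2 * φ (p.2 - p.1 • h))
      ((volume.restrict (Ioc (0 : ℝ) 1)).prod volume) := by
  obtain ⟨C, hC⟩ := hφc.exists_bound_of_continuous hφ
  obtain ⟨R, hR⟩ := hφc.isCompact.isBounded.subset_closedBall 0
  set K := Metric.closedBall (0 : E) (R + ‖h‖) with hK
  have hFK : Integrable (K.indicator fun x => ‖F x‖ * C) volume :=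
    (integrable_indicator_iff measurableSet_closedBall).2
      ((hF.integrableOn_isCompact (isCompact_closedBall 0 _)).norm.mul_const C)
  refine Integrable.mono' (g := fun p : ℝ × E => K.indicator (fun x => ‖F x‖ * C) p.2)
    (hFK.comp_snd (volume.restrict (Ioc (0 : ℝ) 1))) ?_ ?_
  · exact hF.aestronglyMeasurable.comp_snd.mul (hφ.comp (by fun_prop)).aestronglyMeasurable
  · have : ∀ᵐ p : ℝ × E ∂((volume.restrict (Ioc (0 : ℝ) 1)).prod volume), p.1 ∈ Ioc (0 : ℝ) 1 :=
      Measure.quasiMeasurePreserving_fst.ae (ae_restrict_mem measurableSet_Ioc)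
    filter_upwards [this] with p hp
    by_cases hx : p.2 ∈ K
    · rw [indicator_of_mem hx, norm_mul]
      exact mul_le_mul_of_nonneg_left (hC _) (norm_nonneg _)
    · rw [indicator_of_notMem hx, image_eq_zero_of_notMem_tsupport (f := φ), mul_zero, norm_zero]
      intro hmem
      have := hR hmem
      rw [Metric.mem_closedBall, dist_zero_right] at this
      refine hx ?_
      rw [hK, Metric.mem_closedBall, dist_zero_right]
      calc ‖p.2‖ = ‖(p.2 - p.1 • h) + p.1 • h‖ := by rw [sub_add_cancel]
        _ ≤ ‖p.2 - p.1 • h‖ + ‖p.1 • h‖ := norm_add_le _ _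
        _ ≤ R + ‖h‖ := by
          rw [norm_smul, Real.norm_of_nonneg hp.1.le]
          exact add_le_add this (mul_le_of_le_one_left (norm_nonneg _) hp.2)

theorem measurePreserving_shear (h : E) :
    MeasurePreserving (fun p : ℝ × E => (p.1, p.2 + p.1 • h))
      ((volume.restrict (Ioc (0 : ℝ) 1)).prod volume)
      ((volume.restrict (Ioc (0 : ℝ) 1)).prod volume) := by
  refine (MeasurePreserving.id _).skew_product (g := fun s x => x + s • h) (by fun_prop)
    (.of_forall fun s => ?_)
  exact (measurePreserving_add_right volume (s • h)).map_eq

theorem integrable_prod_test_translate {F φ : E → ℝ} (hF : LocallyIntegrable F volume)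
    (hφ : Continuous φ) (hφc : HasCompactSupport φ) (h : E) :
    Integrable (fun p : ℝ × E => F (p.2 + p.1 • h) * φ p.2)
      ((volume.restrict (Ioc (0 : ℝ) 1)).prod volume) := by
  have := (measurePreserving_shear h).integrable_comp_of_integrable
    (integrable_prod_translate_test hF hφ hφc h)
  simpa [Function.comp_def] using this

theorem locallyIntegrable_line_average {F : E → ℝ} (hF : LocallyIntegrable F volume) (h : E) :
    LocallyIntegrable (fun x => ∫ s in (0 : ℝ)..1, F (x + s • h)) volume := by
  intro x
  -- The bump equals 1 on the unit ball around `x`, so integrability of the product with it gives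
  -- local integrability of the average.
  let φ : ContDiffBump x := ⟨1, 2, one_pos, one_lt_two⟩
  have hI := (integrable_prod_test_translate hF φ.continuous φ.hasCompactSupport h).integral_prod_right
  refine ⟨Metric.closedBall x 1, Metric.closedBall_mem_nhds x one_pos, ?_⟩
  refine (hI.integrableOn (s := Metric.closedBall x 1)).congr_fun (fun z hz => ?_)
    measurableSet_closedBall
  simp only
  rw [intervalIntegral.integral_of_le zero_le_one, φ.one_of_mem_closedBall hz]
  simp

theorem HasWeakGradient.locallyIntegrable_inner {u : E → ℝ} {G : E → E} (hu : HasWeakGradient u G)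
    (v : E) : LocallyIntegrable (fun x => inner ℝ (G x) v) volume :=
  fun x => by
    obtain ⟨s, hs, hG⟩ := hu.locallyIntegrable_grad x
    exact ⟨s, hs, hG.inner_const v⟩

/-- The fundamental theorem of calculus for functions with a weak gradient. -/
theorem HasWeakGradient.sub_eq_integral {u : E → ℝ} {G : E → E} (hu : HasWeakGradient u G) (h : E) :
    ∀ᵐ x, u (x + h) - u x = ∫ s in (0 : ℝ)..1, inner ℝ (G (x + s • h)) h := by
  have hGh := hu.locallyIntegrable_inner h
  have hut : LocallyIntegrable (fun x => u (x + h)) volume := by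
    intro x
    obtain ⟨s, hs, hI⟩ := hu.locallyIntegrable (x + h)
    refine ⟨(fun z => z + h) ⁻¹' s, (continuous_add_const h).continuousAt.preimage_mem_nhds hs, ?_⟩
    exact ((measurePreserving_add_right volume h).integrableOn_comp_preimage
      (measurableEmbedding_addRight h)).2 hI
  refine ae_eq_of_integral_contDiff_smul_eq (hut.sub hu.locallyIntegrable)
    (locallyIntegrable_line_average hGh h) fun φ hφ hφc => ?_
  have hφ' : Continuous φ := hφ.continuous
  have hφd : Differentiable ℝ φ := hφ.differentiable (by simp)
  have hDc : Continuous fun x => fderiv ℝ φ x h :=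
    (hφ.continuous_fderiv (by simp)).clm_apply continuous_const
  have hDs : HasCompactSupport fun x => fderiv ℝ φ x h := hφc.fderiv_apply ℝ h
  have hsm : ∀ (F : E → ℝ), LocallyIntegrable F volume → ∀ (η : E → ℝ), Continuous η →
      HasCompactSupport η → Integrable fun x => F x * η x := fun F hF η hη hηc => by
    simpa [mul_comm] using hF.integrable_smul_left_of_hasCompactSupport hη hηc
  have hφt : HasCompactSupport fun x => φ (x - h) := by
    simpa [Function.comp_def, sub_eq_add_neg] using hφc.comp_homeomorph (Homeomorph.addRight (-h))
  -- The translation is moved to the test function, where the classical fundamental theorem applies.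
  -- The weak gradient identity is then used for each translate `φ (· - s • h)`, and Fubini
  -- exchanges the integrals in `s` and `x`.
  have e1 : ∫ x, φ x • (u (x + h) - u x) = ∫ x, u x * (φ (x - h) - φ x) := by
    have t1 : ∫ x, u (x + h) * φ x = ∫ x, u x * φ (x - h) := by
      rw [← integral_add_right_eq_self (fun x => u x * φ (x - h)) h]
      simp
    have i1 := hsm _ hut φ hφ' hφc
    have i2 := hsm _ hu.locallyIntegrable φ hφ' hφc
    have i3 := hsm _ hu.locallyIntegrable _ (hφ'.comp (continuous_sub_right h)) hφt
    simp only [Function.comp_def] at i3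
    calc _ = ∫ x, (u (x + h) * φ x - u x * φ x) := by
          congr 1; funext x; simp only [smul_eq_mul]; ring
      _ = ∫ x, (u x * φ (x - h) - u x * φ x) := by
          rw [integral_sub i1 i2, integral_sub i3 i2, t1]
      _ = _ := by congr 1; funext x; ring
  have ftc : ∀ x, φ (x - h) - φ x = -∫ s in (0 : ℝ)..1, fderiv ℝ φ (x - s • h) h := by
    intro x
    have hd : ∀ s ∈ uIcc (0 : ℝ) 1, HasDerivAt (fun s : ℝ => φ (x - s • h))
        (-(fderiv ℝ φ (x - s • h) h)) s := by
      intro s _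
      have h1 : HasDerivAt (fun s : ℝ => x - s • h) (-h) s := by
        simpa using ((hasDerivAt_id s).smul_const h).const_sub x
      have := (hφd (x - s • h)).hasFDerivAt.comp_hasDerivAt s h1
      simpa [Function.comp_def] using this
    have hc : Continuous fun s : ℝ => -(fderiv ℝ φ (x - s • h) h) :=
      (hDc.comp (by fun_prop : Continuous fun s : ℝ => x - s • h)).neg
    have := intervalIntegral.integral_eq_sub_of_hasDerivAt hd (hc.intervalIntegrable _ _)
    rw [intervalIntegral.integral_neg] at this
    simpa using this.symm
  have weak : ∀ s : ℝ, ∫ x, u x * fderiv ℝ φ (x - s • h) h =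
      -∫ x, inner ℝ (G (x + s • h)) h * φ x := by
    intro s
    have hc : ContDiff ℝ ∞ fun x => φ (x - s • h) := hφ.comp (contDiff_id.sub contDiff_const)
    have hcs : HasCompactSupport fun x => φ (x - s • h) := by
      simpa [Function.comp_def, sub_eq_add_neg] using
        hφc.comp_homeomorph (Homeomorph.addRight (-(s • h)))
    have := hu.integral_eq _ hc hcs h
    have e : ∀ x, fderiv ℝ (fun x => φ (x - s • h)) x = fderiv ℝ φ (x - s • h) := fun x => by
      rw [fderiv_comp_sub]
    simp_rw [e] at this
    rw [this, ← integral_add_right_eq_self (fun x => inner ℝ (G x) h * φ (x - s • h)) (s • h)]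
    simp
  rw [e1]
  simp_rw [ftc, smul_eq_mul, mul_neg]
  rw [integral_neg]
  have f1 := integral_integral_swap (f := fun s x => u x * fderiv ℝ φ (x - s • h) h)
    (integrable_prod_translate_test hu.locallyIntegrable hDc hDs h)
  have f2 := integral_integral_swap (f := fun s x => inner ℝ (G (x + s • h)) h * φ x)
    (integrable_prod_test_translate hGh hφ' hφc h)
  simp_rw [intervalIntegral.integral_of_le (zero_le_one' ℝ)]
  simp_rw [integral_const_mul] at f1
  simp_rw [integral_mul_const] at f2
  rw [← f1]
  simp_rw [weak, integral_neg, neg_neg]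
  rw [f2]
  simp_rw [mul_comm]

theorem HasWeakGradient.ae_eq {u : E → ℝ} {G G' : E → E} (hG : HasWeakGradient u G)
    (hG' : HasWeakGradient u G') : G =ᵐ[volume] G' := by
  have : ∀ i, ∀ᵐ x, inner ℝ (G x) (stdOrthonormalBasis ℝ E i) =
      inner ℝ (G' x) (stdOrthonormalBasis ℝ E i) := fun i => by
    refine ae_eq_of_integral_contDiff_smul_eq (hG.locallyIntegrable_inner _)
      (hG'.locallyIntegrable_inner _) fun φ hφ hφc => ?_
    have h1 := hG.integral_eq φ hφ hφc (stdOrthonormalBasis ℝ E i)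
    rw [hG'.integral_eq φ hφ hφc] at h1
    simp_rw [smul_eq_mul, mul_comm (φ _)]
    exact (neg_injective h1).symm
  filter_upwards [ae_all_iff.2 this] with x hx
  exact InnerProductSpace.ext_inner_right_basis (stdOrthonormalBasis ℝ E).toBasis fun i => by simpa using hx i

/-- Rademacher's theorem with integration by parts for Lipschitz functions. The bound holds at every
point because the gradient is 0 by default where `w` is not differentiable. -/
theorem LipschitzWith.hasWeakGradient {w : E → ℝ} {C : NNReal} (hw : LipschitzWith C w) :
    HasWeakGradient w (gradient w) ∧ ∀ x, ‖gradient w x‖ ≤ C := by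
  have hnorm : ∀ x, ‖gradient w x‖ ≤ C := fun x => by
    rw [gradient, LinearIsometryEquiv.norm_map]
    exact norm_fderiv_le_of_lipschitz ℝ hw
  have hmeas : Measurable (gradient w) :=
    (InnerProductSpace.toDual ℝ E).symm.continuous.measurable.comp (measurable_fderiv ℝ w)
  refine ⟨⟨hw.continuous.locallyIntegrable, ?_, fun φ hφ hφc v => ?_⟩, hnorm⟩
  · exact (memLp_top_of_bound hmeas.aestronglyMeasurable C (.of_forall hnorm)).locallyIntegrable le_top
  · obtain ⟨D, hD⟩ := (hφ.of_le (by exact_mod_cast le_top) : ContDiff ℝ 1 φ).lipschitzWith_of_hasCompactSupport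
      hφc one_ne_zero
    have h1 := hw.integral_lineDeriv_mul_eq (μ := volume) hD hφc v
    have h2 : ∀ x, lineDeriv ℝ φ x (-v) * w x = -(w x * fderiv ℝ φ x v) := fun x => by
      rw [(hφ.differentiable (by simp) x).lineDeriv_eq_fderiv, map_neg]; ring
    have h3 : ∫ x, lineDeriv ℝ w x v * φ x = ∫ x, inner ℝ (gradient w x) v * φ x := by
      refine integral_congr_ae ?_
      filter_upwards [hw.ae_differentiableAt (μ := volume)] with x hx
      rw [hx.lineDeriv_eq_fderiv, gradient, InnerProductSpace.toDual_symm_apply]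
    simp_rw [h2] at h1
    rw [integral_neg] at h1
    rw [← h3, h1, neg_neg]

end WeakGradient

/-! ### Weak limits of difference quotients in L². -/

section WeakCompactness

open Filter Topology

/-- Banach–Alaoglu through the Riesz isometry. A limit along an ultrafilter replaces a weakly
convergent subsequence, so separability is not needed. -/
theorem exists_weak_limit {H : Type*} [NormedAddCommGroup H] [InnerProductSpace ℝ H]
    [CompleteSpace H] {g : ℕ → H} {K : ℝ} (hg : ∀ n, ‖g n‖ ≤ K) :
    ∃ z : H, ‖z‖ ≤ K ∧ ∃ l : Filter ℕ, l.NeBot ∧ l ≤ atTop ∧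
      ∀ ψ, Tendsto (fun n => inner ℝ (g n) ψ) l (𝓝 (inner ℝ z ψ)) := by
  let T : ℕ → WeakDual ℝ H := fun n => StrongDual.toWeakDual (InnerProductSpace.toDual ℝ H (g n))
  obtain ⟨y, hy, hle⟩ := (WeakDual.isCompact_closedBall (𝕜 := ℝ) (0 : StrongDual ℝ H)
    K).ultrafilter_le_nhds ((hyperfilter ℕ).map T) (by
      rw [le_principal_iff]
      refine Filter.mem_map.2 (univ_mem' fun n => ?_)
      simpa [T] using hg n)
  refine ⟨(InnerProductSpace.toDual ℝ H).symm (WeakDual.toStrongDual y), ?_, hyperfilter ℕ,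
    inferInstance, Nat.hyperfilter_le_atTop, fun ψ => ?_⟩
  · rw [LinearIsometryEquiv.norm_map]
    simpa using hy
  · have ht : Tendsto T (hyperfilter ℕ) (𝓝 y) := hle
    have := (tendsto_iff_forall_eval_tendsto_topDualPairing.1 ht) ψ
    simp only [InnerProductSpace.toDual_symm_apply]
    exact this

variable {E : Type*} [NormedAddCommGroup E] [InnerProductSpace ℝ E] [FiniteDimensional ℝ E]
  [MeasurableSpace E] [BorelSpace E]

theorem eLpNorm_two_sq {α F : Type*} [MeasurableSpace α] [NormedAddCommGroup F] (f : α → F)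
    (μ : Measure α) : eLpNorm f 2 μ ^ 2 = ∫⁻ x, ‖f x‖ₑ ^ 2 ∂μ := by
  simpa using eLpNorm_nnreal_pow_eq_lintegral (f := f) (μ := μ) (p := 2) two_ne_zero

theorem tendsto_integral_difference_quotient {w φ : E → ℝ} (hw : LocallyIntegrable w volume)
    (hφ : ContDiff ℝ ∞ φ) (hφc : HasCompactSupport φ) (v : E) {r : ℕ → ℝ} (hr : ∀ n, 0 < r n)
    (hr0 : Tendsto r atTop (𝓝 0)) :
    Tendsto (fun n => ∫ x, (r n)⁻¹ * (w (x + r n • v) - w x) * φ x) atTop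
      (𝓝 (-∫ x, w x * fderiv ℝ φ x v)) := by
  obtain ⟨D, hD⟩ := (hφ.of_le (by exact_mod_cast le_top) :
    ContDiff ℝ 1 φ).lipschitzWith_of_hasCompactSupport hφc one_ne_zero
  obtain ⟨R, hR⟩ := hφc.isCompact.isBounded.subset_closedBall 0
  obtain ⟨M, hM⟩ := hr0.bddAbove_range
  have hM : ∀ n, r n ≤ M := fun n => hM ⟨n, rfl⟩
  set B := Metric.closedBall (0 : E) (R + M * ‖v‖) with hB
  have hφt : ∀ n, HasCompactSupport fun x => φ (x - r n • v) := fun n => by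
    simpa [Function.comp_def, sub_eq_add_neg] using
      hφc.comp_homeomorph (Homeomorph.addRight (-(r n • v)))
  have hsm : ∀ (F : E → ℝ), LocallyIntegrable F volume → ∀ (η : E → ℝ), Continuous η →
      HasCompactSupport η → Integrable fun x => F x * η x := fun F hF η hη hηc => by
    simpa [mul_comm] using hF.integrable_smul_left_of_hasCompactSupport hη hηc
  have hswap : ∀ n, ∫ x, (r n)⁻¹ * (w (x + r n • v) - w x) * φ x =
      ∫ x, w x * ((r n)⁻¹ * (φ (x - r n • v) - φ x)) := fun n => by
    have i2 := hsm w hw φ hφ.continuous hφc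
    have i3 := hsm w hw _ (hφ.continuous.comp (continuous_sub_right (r n • v))) (hφt n)
    simp only [Function.comp_def] at i3
    have t1 : ∫ x, w (x + r n • v) * φ x = ∫ x, w x * φ (x - r n • v) := by
      rw [← integral_add_right_eq_self (fun x => w x * φ (x - r n • v)) (r n • v)]
      simp
    have i1 : Integrable fun x => w (x + r n • v) * φ x := by
      simpa using i3.comp_add_right (r n • v)
    calc _ = ∫ x, (r n)⁻¹ * (w (x + r n • v) * φ x - w x * φ x) := by
          congr 1; funext x; ring
      _ = ∫ x, (r n)⁻¹ * (w x * φ (x - r n • v) - w x * φ x) := by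
          rw [integral_const_mul, integral_const_mul, integral_sub i1 i2, integral_sub i3 i2, t1]
      _ = _ := by congr 1; funext x; ring
  simp_rw [hswap]
  rw [← integral_neg]
  refine tendsto_integral_of_dominated_convergence
    (B.indicator fun x => ‖w x‖ * (D * ‖v‖)) (fun n => ?_) ?_ (fun n => ?_) ?_
  · exact hw.aestronglyMeasurable.mul (Continuous.aestronglyMeasurable (by
      have := hφ.continuous
      fun_prop))
  · exact (integrable_indicator_iff measurableSet_closedBall).2
      ((hw.integrableOn_isCompact (isCompact_closedBall 0 _)).norm.mul_const _)
  · refine .of_forall fun x => ?_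
    by_cases hx : x ∈ B
    · rw [indicator_of_mem hx, norm_mul]
      refine mul_le_mul_of_nonneg_left ?_ (norm_nonneg _)
      have := hD.dist_le_mul (x - r n • v) x
      rw [dist_eq_norm, dist_eq_norm, sub_sub_cancel_left, norm_neg, norm_smul,
        Real.norm_of_nonneg (hr n).le] at this
      rw [norm_mul, norm_inv, Real.norm_of_nonneg (hr n).le, inv_mul_le_iff₀ (hr n)]
      linarith
    · have key : ∀ z : E, ‖x - z‖ ≤ M * ‖v‖ → φ z = 0 := fun z hz => by
        refine image_eq_zero_of_notMem_tsupport fun hmem => hx ?_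
        have h1 := hR hmem
        rw [Metric.mem_closedBall, dist_zero_right] at h1
        rw [hB, Metric.mem_closedBall, dist_zero_right]
        have := norm_add_le (x - z) z
        rw [sub_add_cancel] at this
        linarith
      have hMv : 0 ≤ M * ‖v‖ := mul_nonneg ((hr n).le.trans (hM n)) (norm_nonneg _)
      rw [indicator_of_notMem hx, key x (by simpa using hMv), key (x - r n • v) (by
        rw [sub_sub_cancel, norm_smul, Real.norm_of_nonneg (hr n).le]
        exact mul_le_mul_of_nonneg_right (hM n) (norm_nonneg _))]
      simp
  · refine .of_forall fun x => ?_
    have hd := ((hφ.differentiable (by simp) x).hasFDerivAt.hasLineDerivAt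
      (-v)).tendsto_slope_zero_right
    have hr' : Tendsto r atTop (𝓝[>] 0) :=
      tendsto_nhdsWithin_iff.2 ⟨hr0, .of_forall hr⟩
    have := (hd.comp hr').const_mul (w x)
    simpa [Function.comp_def, ← sub_eq_add_neg] using this

/-- An `L²` function whose difference quotients are bounded in `L²` has a weak gradient in `L²`. -/
theorem exists_hasWeakGradient_of_difference_quotients {ι : Type*} [Fintype ι]
    (b : OrthonormalBasis ι ℝ E) {w : E → ℝ} (hw : MemLp w 2 volume) {K : ℝ≥0∞} (hK : K ≠ ⊤)
    (h : ∀ r : ℝ, 0 < r →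
      ∑ i, ∫⁻ x, ‖w (x + r • b i) - w x‖ₑ ^ 2 ≤ ENNReal.ofReal r ^ 2 * K ^ 2) :
    ∃ G : E → E, HasWeakGradient w G ∧ eLpNorm G 2 volume ≤ K := by
  set r : ℕ → ℝ := fun n => 1 / ((n : ℝ) + 1) with hrdef
  have hr : ∀ n, 0 < r n := fun n => by positivity
  have hr0 : Tendsto r atTop (𝓝 0) := tendsto_one_div_add_atTop_nhds_zero_nat
  have hwt : ∀ a : E, MemLp (fun x => w (x + a)) 2 volume := fun a =>
    hw.comp_measurePreserving (measurePreserving_add_right volume a)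
  let q : ℕ → ι → E → ℝ := fun n i x => (r n)⁻¹ * (w (x + r n • b i) - w x)
  have hq : ∀ n i, MemLp (q n i) 2 volume := fun n i => ((hwt _).sub hw).const_mul _
  -- The vectors of difference quotients are bounded by `K` in L², and the weak gradient is a weak
  -- limit of them.
  let g : ℕ → E → E := fun n x => ∑ i, q n i x • b i
  have hg : ∀ n, MemLp (g n) 2 volume := fun n =>
    memLp_finsetSum _ fun i _ =>
    (MemLp.of_le_mul (c := 1) (hq n i) ((hq n i).1.smul_const _) (.of_forall fun x => by
      simp [norm_smul]))
  have hgK : ∀ n, eLpNorm (g n) 2 volume ≤ K := fun n => by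
    refine (ENNReal.pow_le_pow_left_iff two_ne_zero).1 ?_
    have hr0 : ENNReal.ofReal (r n) ≠ 0 := by simpa using hr n
    rw [eLpNorm_two_sq]
    have e : ∀ x, ‖g n x‖ₑ ^ 2 =
        ∑ i, (ENNReal.ofReal (r n) ^ 2)⁻¹ * ‖w (x + r n • b i) - w x‖ₑ ^ 2 := fun x => by
      have e1 : ‖g n x‖ ^ 2 = ∑ i, ‖q n i x‖ ^ 2 := by
        rw [← b.sum_sq_norm_inner_right]
        simp_rw [g, b.orthonormal.inner_right_fintype]
      rw [← ofReal_norm, ← ENNReal.ofReal_pow (norm_nonneg _), e1,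
        ENNReal.ofReal_sum_of_nonneg fun i _ => by positivity]
      refine Finset.sum_congr rfl fun i _ => ?_
      rw [ENNReal.ofReal_pow (norm_nonneg _), ofReal_norm, enorm_mul, mul_pow, ENNReal.inv_pow,
        ← ofReal_norm (r n)⁻¹, norm_inv, Real.norm_of_nonneg (hr n).le,
        ENNReal.ofReal_inv_of_pos (hr n)]
    simp_rw [e]
    have hm : ∀ i, AEMeasurable (fun x => ‖w (x + r n • b i) - w x‖ₑ ^ 2) volume := fun i =>
      ((hwt _).sub hw).1.enorm.pow_const 2
    rw [lintegral_finsetSum' _ fun i _ => (hm i).const_mul _]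
    simp_rw [lintegral_const_mul'' _ (hm _)]
    rw [← Finset.mul_sum]
    refine (mul_le_mul_right (h (r n) (hr n)) _).trans_eq ?_
    rw [← mul_assoc, ENNReal.inv_mul_cancel (pow_ne_zero 2 hr0)
      (ENNReal.pow_ne_top ENNReal.ofReal_ne_top), one_mul]
  obtain ⟨z, hz, l, hl, hle, hlim⟩ := exists_weak_limit (g := fun n => (hg n).toLp) (K := K.toReal)
    (fun n => by
      rw [Lp.norm_toLp]
      exact ENNReal.toReal_mono hK (hgK n))
  refine ⟨z, ⟨hw.locallyIntegrable one_le_two, (Lp.memLp z).locallyIntegrable one_le_two,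
    fun φ hφ hφc v => ?_⟩, ?_⟩
  · have hψ : MemLp (fun x => φ x • v) 2 volume :=
      Continuous.memLp_of_hasCompactSupport (by have := hφ.continuous; fun_prop) hφc.smul_right
    have h1 := hlim hψ.toLp
    have e1 : ∀ (f : E → E) (hf : MemLp f 2 volume), inner ℝ (hf.toLp) hψ.toLp =
        ∫ x, inner ℝ (f x) v * φ x := fun f hf => by
      rw [L2.inner_def]
      refine integral_congr_ae ?_
      filter_upwards [hf.coeFn_toLp, hψ.coeFn_toLp] with x hx hx'
      rw [hx, hx', inner_smul_right, mul_comm]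
    have e2 : inner ℝ z hψ.toLp = ∫ x, inner ℝ (z x) v * φ x := by
      rw [← e1 z (Lp.memLp z), Lp.toLp_coeFn]
    have e3 : ∀ n, ∫ x, inner ℝ (g n x) v * φ x = ∑ i, inner ℝ (b i) v * ∫ x, q n i x * φ x := by
      intro n
      simp_rw [← integral_const_mul]
      rw [← integral_finsetSum]
      · refine integral_congr_ae (.of_forall fun x => ?_)
        simp only [g, sum_inner, inner_smul_left, Finset.sum_mul]
        refine Finset.sum_congr rfl fun i _ => ?_
        simp; ring
      · intro i _
        refine Integrable.const_mul ?_ _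
        simpa [mul_comm] using ((hq n i).locallyIntegrable
          one_le_two).integrable_smul_left_of_hasCompactSupport hφ.continuous hφc
    simp_rw [e1 _ (hg _), e3] at h1
    rw [e2] at h1
    have h2 : Tendsto (fun n => ∑ i, inner ℝ (b i) v * ∫ x, q n i x * φ x) atTop
        (𝓝 (∑ i, inner ℝ (b i) v * -∫ x, w x * fderiv ℝ φ x (b i))) :=
      tendsto_finsetSum _ fun i _ => (tendsto_integral_difference_quotient
        (hw.locallyIntegrable one_le_two) hφ hφc (b i) hr hr0).const_mul _
    rw [← tendsto_nhds_unique (h2.mono_left hle) h1, ← Finset.sum_neg_distrib]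
    simp_rw [mul_neg, neg_neg, ← integral_const_mul]
    rw [← integral_finsetSum]
    · refine integral_congr_ae (.of_forall fun x => ?_)
      simp only
      conv_lhs => rw [← b.sum_repr' v, map_sum, Finset.mul_sum]
      refine Finset.sum_congr rfl fun i _ => ?_
      rw [map_smul, smul_eq_mul]; ring
    · intro i _
      refine Integrable.const_mul ?_ _
      simpa [mul_comm] using (hw.locallyIntegrable
          one_le_two).integrable_smul_left_of_hasCompactSupport
          ((hφ.continuous_fderiv (by simp)).clm_apply continuous_const) (hφc.fderiv_apply ℝ (b i))
  · rw [← Lp.enorm_def, ← ofReal_norm]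
    exact ENNReal.ofReal_le_of_le_toReal hz

end WeakCompactness

/-- The kernel is radially decreasing. For large `s` the radicand is negative, the square root is 0,
and the ball is empty, as it should be. -/
theorem setOf_lt_halfSpacePoissonKernel {E : Type*} [NormedAddCommGroup E]
    [InnerProductSpace ℝ E] {y s : ℝ} (hy : 0 < y) (hs : 0 < s) (x : E) :
    ∃ r : ℝ, {z | s < halfSpacePoissonKernel y (x - z)} = Metric.ball x r := by
  have hc := poissonConst_pos (E := E)
  set a : ℝ := ((Module.finrank ℝ E : ℝ) + 1) / 2
  have ha : 0 < a := by positivity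
  refine ⟨√((s / (poissonConst E * y)) ^ (-a)⁻¹ - y ^ 2), Set.ext fun z => ?_⟩
  rw [Metric.mem_ball', dist_eq_norm, Real.lt_sqrt (norm_nonneg _), lt_sub_iff_add_lt,
    Real.lt_rpow_inv_iff_of_neg (by positivity) (by positivity) (by linarith), mem_ofPred_eq,
    halfSpacePoissonKernel_eq_rpow_neg, ← mul_assoc, div_lt_iff₀' (by positivity)]

/-! ### The Hardy–Littlewood maximal theorem for the Poisson maximal function. -/

section MaximalInequality

open Filter Topology

variable {E : Type*} [NormedAddCommGroup E] [InnerProductSpace ℝ E] [FiniteDimensional ℝ E]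
  [MeasurableSpace E] [BorelSpace E]

/-- The centred Hardy–Littlewood maximal function of a measure. -/
noncomputable def ballMaximal (ν : Measure E) (x : E) : ℝ≥0∞ :=
  ⨆ (r : ℝ) (_ : 0 < r), ν (Metric.ball x r) / volume (Metric.ball x r)

theorem measure_ball_le_ballMaximal (ν : Measure E) (x : E) (r : ℝ) :
    ν (Metric.ball x r) ≤ ballMaximal ν x * volume (Metric.ball x r) := by
  rcases le_or_gt r 0 with hr | hr
  · simp [Metric.ball_eq_empty.2 hr]
  · rw [← ENNReal.div_le_iff (Metric.measure_ball_pos volume x hr).ne' measure_ball_lt_top.ne]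
    exact le_iSup₂_of_le r hr le_rfl

/-- The weak-type inequality by Vitali's covering lemma with enlargement 4. That lemma needs bounded
radii, whence the exhaustion by the sets `A n`. -/
theorem volume_ballMaximal_gt_le (ν : Measure E) {t : ℝ≥0∞} (ht : t ≠ 0) (ht' : t ≠ ⊤) :
    volume {x | t < ballMaximal ν x} ≤ 4 ^ Module.finrank ℝ E * ν univ / t := by
  let A : ℕ → Set E := fun n => {x | ∃ r : ℝ, 0 < r ∧ r ≤ n ∧
    t * volume (Metric.ball x r) < ν (Metric.ball x r)}
  have hA : Monotone A := fun m n hmn x ⟨r, h0, h1, h2⟩ =>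
    ⟨r, h0, h1.trans (by exact_mod_cast hmn), h2⟩
  have hsub : {x | t < ballMaximal ν x} ⊆ ⋃ n, A n := by
    intro x hx
    obtain ⟨r, hr⟩ := lt_iSup_iff.1 (show t < ballMaximal ν x from hx)
    obtain ⟨hr0, hr⟩ := lt_iSup_iff.1 hr
    obtain ⟨n, hn⟩ := exists_nat_ge r
    refine mem_iUnion.2 ⟨n, r, hr0, hn, ?_⟩
    exact (ENNReal.lt_div_iff_mul_lt (.inl (Metric.measure_ball_pos volume x hr0).ne')
      (.inl measure_ball_lt_top.ne)).1 hr
  refine (measure_mono hsub).trans ?_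
  rw [hA.measure_iUnion]
  refine iSup_le fun n => ?_
  have hch : ∀ x : E, ∃ r : ℝ, x ∈ A n → 0 < r ∧ r ≤ n ∧
      t * volume (Metric.ball x r) < ν (Metric.ball x r) := fun x => by
    by_cases hx : x ∈ A n
    · obtain ⟨r, hr⟩ := hx
      exact ⟨r, fun _ => hr⟩
    · exact ⟨0, fun h => absurd h hx⟩
  choose ρ hρ using hch
  obtain ⟨s, hsA, hdisj, hcov⟩ := Vitali.exists_disjoint_subfamily_covering_enlargement_ball (A n)
    (fun x => x) ρ n (fun a ha => (hρ a ha).2.1) 4 (by norm_num)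
  have hcount : s.Countable := hdisj.countable_of_isOpen (fun _ _ => Metric.isOpen_ball)
    fun a ha => Metric.nonempty_ball.2 (hρ a (hsA ha)).1
  have := hcount.to_subtype
  calc volume (A n) ≤ volume (⋃ a ∈ s, Metric.ball a (4 * ρ a)) := by
        refine measure_mono fun x hx => ?_
        obtain ⟨b, hb, hxb⟩ := hcov x hx
        exact mem_biUnion hb (hxb (Metric.mem_ball_self (hρ x hx).1))
    _ ≤ ∑' a : s, volume (Metric.ball (a : E) (4 * ρ a)) := measure_biUnion_le _ hcount _
    _ ≤ ∑' a : s, 4 ^ Module.finrank ℝ E / t * ν (Metric.ball (a : E) (ρ a)) := by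
        refine ENNReal.tsum_le_tsum fun a => ?_
        obtain ⟨h0, -, h2⟩ := hρ a (hsA a.2)
        rw [Measure.addHaar_ball_mul_of_pos volume _ (by norm_num : (0 : ℝ) < 4),
          ← Measure.addHaar_ball_center volume (a : E),
          ENNReal.ofReal_pow (by norm_num), ENNReal.ofReal_ofNat, ENNReal.mul_comm_div]
        refine mul_le_mul_right ?_ _
        rw [ENNReal.le_div_iff_mul_le (.inl ht) (.inl ht'), mul_comm]
        exact h2.le
    _ = 4 ^ Module.finrank ℝ E / t * ν (⋃ a ∈ s, Metric.ball (a : E) (ρ a)) := by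
        rw [ENNReal.tsum_mul_left, measure_biUnion hcount hdisj fun _ _ => measurableSet_ball]
    _ ≤ 4 ^ Module.finrank ℝ E * ν univ / t := by
        rw [ENNReal.mul_div_right_comm]
        exact mul_le_mul_right (measure_mono (subset_univ _)) _

/-- Layer-cake formula: the kernel is an average of indicators of balls centred at `x`, of total
mass one. -/
theorem poissonMaximal_le_ballMaximal {u : E → ℝ} (hu : AEStronglyMeasurable u volume) (x : E) :
    poissonMaximal u x ≤ ballMaximal (volume.withDensity fun z => ‖u z‖ₑ) x := by
  set ν := (volume : Measure E).withDensity fun z => ‖u z‖ₑ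
  refine iSup₂_le fun y hy => ?_
  have hPc : Continuous fun z : E => halfSpacePoissonKernel y (x - z) :=
    (continuous_halfSpacePoissonKernel hy).comp (continuous_sub_left x)
  have hP0 : ∀ z : E, 0 ≤ halfSpacePoissonKernel y (x - z) := fun z =>
    (halfSpacePoissonKernel_pos hy _).le
  calc poissonExtensionAbs u y x
      = ∫⁻ z, ENNReal.ofReal (halfSpacePoissonKernel y (x - z)) ∂ν := by
        rw [lintegral_withDensity_eq_lintegral_mul₀ hu.enorm
          hPc.measurable.ennreal_ofReal.aemeasurable]
        refine lintegral_congr fun z => ?_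
        rw [ENNReal.ofReal_mul (abs_nonneg _), ← Real.norm_eq_abs, ofReal_norm]
        rfl
    _ = ∫⁻ t in Ioi (0 : ℝ), ν {z | t < halfSpacePoissonKernel y (x - z)} :=
        lintegral_eq_lintegral_meas_lt ν (.of_forall hP0) hPc.measurable.aemeasurable
    _ ≤ ∫⁻ t in Ioi (0 : ℝ), ballMaximal ν x *
          volume {z | t < halfSpacePoissonKernel y (x - z)} := by
        refine setLIntegral_mono' measurableSet_Ioi fun t ht => ?_
        obtain ⟨r, hr⟩ := setOf_lt_halfSpacePoissonKernel hy ht x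
        rw [hr]
        exact measure_ball_le_ballMaximal ν x r
    _ = ballMaximal ν x * ∫⁻ z, ENNReal.ofReal (halfSpacePoissonKernel y (x - z)) := by
        rw [lintegral_const_mul, ← lintegral_eq_lintegral_meas_lt volume (.of_forall hP0)
          hPc.measurable.aemeasurable]
        exact (Antitone.measurable fun s t hst => measure_mono fun z hz => hst.trans_lt hz)
    _ = ballMaximal ν x := by
        rw [lintegral_sub_left_eq_self (fun z => ENNReal.ofReal (halfSpacePoissonKernel y z)),
          lintegral_halfSpacePoissonKernel hy, mul_one]

/-- The part of `u` with `|u| ≤ t / 2` contributes at most `t / 2` to the maximal function, so the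
weak-type inequality is needed only for the rest. -/
theorem volume_poissonMaximal_gt_le {u : E → ℝ} (hu : AEStronglyMeasurable u volume) {t : ℝ}
    (ht : 0 < t) :
    volume {x | ENNReal.ofReal t < poissonMaximal u x} ≤
      2 * 4 ^ Module.finrank ℝ E / ENNReal.ofReal t *
        volume.withDensity (fun z => ‖u z‖ₑ) {z | t < 2 * |u z|} := by
  have hu2 : NullMeasurableSet {z | t < 2 * |u z|} volume :=
    nullMeasurableSet_lt aemeasurable_const (hu.norm.aemeasurable.const_mul 2)
  set ν := (volume : Measure E).withDensity fun z => ‖u z‖ₑ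
  set S := toMeasurable volume {z | t < 2 * |u z|} with hS
  have hSm : MeasurableSet S := measurableSet_toMeasurable _ _
  have hSae : S =ᵐ[volume] {z | t < 2 * |u z|} := hu2.toMeasurable_ae_eq
  have hac : ν ≪ volume := withDensity_absolutelyContinuous _ _
  have hνS : ν {z | t < 2 * |u z|} = ν S := measure_congr (hac.ae_eq hSae).symm
  have h2 : ENNReal.ofReal (t / 2) ≠ 0 := by simpa using ht
  have key : ∀ x, ballMaximal ν x ≤ ballMaximal (ν.restrict S) x + ENNReal.ofReal (t / 2) := by
    intro x
    refine iSup₂_le fun r hr => ?_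
    rw [ENNReal.div_le_iff (Metric.measure_ball_pos volume x hr).ne' measure_ball_lt_top.ne, add_mul]
    refine (measure_le_inter_add_sdiff ν _ S).trans (add_le_add ?_ ?_)
    · rw [← Measure.restrict_apply measurableSet_ball]
      exact measure_ball_le_ballMaximal _ x r
    · rw [withDensity_apply _ (measurableSet_ball.diff hSm), ← setLIntegral_const]
      refine (setLIntegral_mono_ae' (measurableSet_ball.diff hSm) ?_).trans
        (lintegral_mono_set sdiff_subset)
      filter_upwards [hSae.mem_iff] with z hz hzS
      have : ¬ t < 2 * |u z| := fun h => hzS.2 (hz.2 h)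
      rw [← ofReal_norm, Real.norm_eq_abs]
      exact ENNReal.ofReal_le_ofReal (by linarith)
  calc volume {x | ENNReal.ofReal t < poissonMaximal u x}
      ≤ volume {x | ENNReal.ofReal (t / 2) < ballMaximal (ν.restrict S) x} := by
        refine measure_mono fun x (hx : ENNReal.ofReal t < _) => ?_
        have h := hx.trans_le ((poissonMaximal_le_ballMaximal hu x).trans (key x))
        have e : ENNReal.ofReal t = ENNReal.ofReal (t / 2) + ENNReal.ofReal (t / 2) := by
          rw [← ENNReal.ofReal_add (by positivity) (by positivity), add_halves]
        rw [e] at h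
        exact lt_of_add_lt_add_right h
    _ ≤ 4 ^ Module.finrank ℝ E * ν.restrict S univ / ENNReal.ofReal (t / 2) :=
        volume_ballMaximal_gt_le _ h2 ENNReal.ofReal_ne_top
    _ = _ := by
        rw [Measure.restrict_apply_univ, hνS, ENNReal.ofReal_div_of_pos two_pos,
          ENNReal.ofReal_ofNat, div_eq_mul_inv, div_eq_mul_inv, div_eq_mul_inv,
          ENNReal.mul_inv (.inr (by simp)) (.inr (by simp)), inv_inv]
        ring

/-- The maximal theorem: `L^q`-boundedness of the Poisson maximal operator for `1 < q < ∞`. -/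
theorem lintegral_poissonMaximal_rpow_lt_top {u : E → ℝ} (hu : AEStronglyMeasurable u volume)
    {q : ℝ} (hq : 1 < q) (hui : ∫⁻ x, ‖u x‖ₑ ^ q < ⊤) :
    ∫⁻ x, poissonMaximal u x ^ q < ⊤ := by
  have hq0 : 0 < q := one_pos.trans hq
  have hmeas : Measurable (poissonMaximal u) := (lowerSemicontinuous_poissonMaximal u).measurable
  set ν := (volume : Measure E).withDensity fun z => ‖u z‖ₑ
  set C : ℝ≥0∞ := 2 * 4 ^ Module.finrank ℝ E with hC
  have hCt : C ≠ ⊤ := by simp [hC, ENNReal.mul_eq_top]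
  -- By the layer-cake formula for `ν` this is a multiple of the `ν`-integral of `|u| ^ (q - 1)`,
  -- that is, of the integral of `|u| ^ q`.
  set I : ℝ≥0∞ := ∫⁻ t in Ioi (0 : ℝ), ν {z | t < 2 * |u z|} * ENNReal.ofReal (t ^ (q - 1 - 1))
  have hI : I ≠ ⊤ := by
    have h1 := lintegral_rpow_eq_lintegral_meas_lt_mul ν (f := fun z => 2 * |u z|)
      (.of_forall fun z => by positivity)
      ((hu.norm.aemeasurable.const_mul 2).mono_ac (withDensity_absolutelyContinuous _ _))
      (sub_pos.2 hq)
    have hum : AEMeasurable (fun z => ENNReal.ofReal ((2 * |u z|) ^ (q - 1))) volume :=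
      ((hu.norm.aemeasurable.const_mul 2).pow_const _).ennreal_ofReal
    have h2 : ∫⁻ z, ENNReal.ofReal ((2 * |u z|) ^ (q - 1)) ∂ν =
        ENNReal.ofReal (2 ^ (q - 1)) * ∫⁻ z, ‖u z‖ₑ ^ q := by
      rw [lintegral_withDensity_eq_lintegral_mul₀ hu.enorm hum,
        ← lintegral_const_mul' _ _ ENNReal.ofReal_ne_top]
      refine lintegral_congr fun z => ?_
      simp only [Pi.mul_apply]
      rw [Real.mul_rpow two_pos.le (abs_nonneg _), ENNReal.ofReal_mul (by positivity),
        ← ENNReal.ofReal_rpow_of_nonneg (abs_nonneg _) (sub_pos.2 hq).le, ← Real.norm_eq_abs,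
        ofReal_norm, mul_left_comm]
      congr 1
      conv_rhs => rw [show q = 1 + (q - 1) by ring]
      rw [ENNReal.rpow_add_of_nonneg _ _ one_pos.le (sub_pos.2 hq).le, ENNReal.rpow_one]
    intro htop
    rw [h2] at h1
    have h3 : ENNReal.ofReal (q - 1) * I = ⊤ := by
      rw [htop, ENNReal.mul_top]
      simpa using hq
    exact (ENNReal.mul_lt_top ENNReal.ofReal_lt_top hui).ne (h1.trans h3)
  -- The layer-cake formula is for real-valued functions, so the maximal function is cut at height
  -- `N`; the bound is uniform in `N`.
  have hN : ∀ N : ℕ, ∫⁻ x, min (poissonMaximal u x) N ^ q ≤ ENNReal.ofReal q * (C * I) := by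
    intro N
    have hfin : ∀ x, min (poissonMaximal u x) N ≠ ⊤ := fun x =>
      ((min_le_right _ _).trans_lt (ENNReal.natCast_lt_top N)).ne
    have h1 := lintegral_rpow_eq_lintegral_meas_lt_mul volume
      (f := fun x => (min (poissonMaximal u x) N).toReal)
      (.of_forall fun z => ENNReal.toReal_nonneg)
      (hmeas.min measurable_const).ennreal_toReal.aemeasurable hq0
    have h2 : ∀ x, ENNReal.ofReal ((min (poissonMaximal u x) N).toReal ^ q) =
        min (poissonMaximal u x) N ^ q := fun x => by
      rw [← ENNReal.ofReal_rpow_of_nonneg ENNReal.toReal_nonneg hq0.le, ENNReal.ofReal_toReal (hfin x)]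
    simp_rw [h2] at h1
    rw [h1, ← lintegral_const_mul' _ _ hCt]
    refine mul_le_mul_right (setLIntegral_mono' measurableSet_Ioi fun t ht => ?_) _
    have ht : 0 < t := ht
    have h3 : volume {x | t < (min (poissonMaximal u x) N).toReal} ≤
        volume {x | ENNReal.ofReal t < poissonMaximal u x} := by
      refine measure_mono fun x hx => ?_
      exact ((ENNReal.ofReal_lt_iff_lt_toReal ht.le (hfin x)).2 hx).trans_le (min_le_left _ _)
    refine (mul_le_mul_left (h3.trans (volume_poissonMaximal_gt_le hu ht)) _).trans_eq ?_
    have h4 : ENNReal.ofReal (t ^ (q - 1)) = ENNReal.ofReal t * ENNReal.ofReal (t ^ (q - 1 - 1)) := by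
      rw [← ENNReal.ofReal_mul ht.le, Real.rpow_sub_one ht.ne' (q - 1), mul_div_cancel₀ _ ht.ne']
    have h5 : (ENNReal.ofReal t)⁻¹ * ENNReal.ofReal t = 1 :=
      ENNReal.inv_mul_cancel (by simpa using ht) ENNReal.ofReal_ne_top
    rw [h4, div_eq_mul_inv]
    calc _ = C * ((ENNReal.ofReal t)⁻¹ * ENNReal.ofReal t) *
          (ν {z | t < 2 * |u z|} * ENNReal.ofReal (t ^ (q - 1 - 1))) := by ring
      _ = _ := by rw [h5, mul_one]
  have hlim : ∫⁻ x, poissonMaximal u x ^ q ≤ ENNReal.ofReal q * (C * I) := by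
    have e : ∀ x, poissonMaximal u x ^ q = ⨆ N : ℕ, min (poissonMaximal u x) N ^ q := fun x => by
      refine le_antisymm ?_ (iSup_le fun N => ENNReal.rpow_le_rpow (min_le_left _ _) hq0.le)
      have : Tendsto (fun N : ℕ => min (poissonMaximal u x) N ^ q) atTop
          (𝓝 (min (poissonMaximal u x) ⊤ ^ q)) :=
        ((ENNReal.continuous_rpow_const.tendsto _).comp
          (tendsto_const_nhds.min ENNReal.tendsto_nat_nhds_top))
      rw [min_top_right] at this
      exact le_of_tendsto' this fun N => le_iSup (fun N : ℕ => min (poissonMaximal u x) N ^ q) N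
    simp_rw [e]
    rw [lintegral_iSup (fun N => (hmeas.min measurable_const).pow_const q)
      (fun m n hmn x => ENNReal.rpow_le_rpow (min_le_min_left _ (by exact_mod_cast hmn)) hq0.le)]
    exact iSup_le hN
  exact hlim.trans_lt (ENNReal.mul_lt_top ENNReal.ofReal_lt_top
    (ENNReal.mul_lt_top hCt.lt_top hI.lt_top))

theorem ae_poissonMaximal_lt_top {u : E → ℝ} {p : ℝ≥0∞} (hp : 1 < p) (hp' : p ≠ ⊤)
    (hu : MemLp u p volume) : ∀ᵐ x, poissonMaximal u x < ⊤ := by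
  have hq : 1 < p.toReal := by
    rw [← ENNReal.toReal_one]; exact (ENNReal.toReal_lt_toReal ENNReal.one_ne_top hp').2 hp
  have h := lintegral_poissonMaximal_rpow_lt_top hu.1 hq
    (lintegral_rpow_enorm_lt_top_of_eLpNorm_lt_top (one_pos.trans hp).ne' hp' hu.2)
  filter_upwards [ae_lt_top ((lowerSemicontinuous_poissonMaximal u).measurable.pow_const _) h.ne]
    with x hx
  contrapose! hx
  rw [top_le_iff.1 hx, ENNReal.top_rpow_of_pos (one_pos.trans hq)]

theorem memLp_poissonMaximal {u : E → ℝ} {p : ℝ≥0∞} (hp : 1 < p) (hp' : p ≠ ⊤)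
    (hu : MemLp u p volume) : MemLp (fun x => (poissonMaximal u x).toReal) p volume := by
  have hq : 1 < p.toReal := by
    rw [← ENNReal.toReal_one]; exact (ENNReal.toReal_lt_toReal ENNReal.one_ne_top hp').2 hp
  refine ⟨(lowerSemicontinuous_poissonMaximal u).measurable.ennreal_toReal.aestronglyMeasurable, ?_⟩
  rw [eLpNorm_lt_top_iff_lintegral_rpow_enorm_lt_top (one_pos.trans hp).ne' hp']
  refine (lintegral_mono fun x => ?_).trans_lt (lintegral_poissonMaximal_rpow_lt_top hu.1 hq
    (lintegral_rpow_enorm_lt_top_of_eLpNorm_lt_top (one_pos.trans hp).ne' hp' hu.2))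
  refine ENNReal.rpow_le_rpow ?_ (one_pos.trans hq).le
  rw [Real.enorm_of_nonneg ENNReal.toReal_nonneg]
  exact ENNReal.ofReal_toReal_le

end MaximalInequality

/-! ### The case p = ∞. -/

section BoundedGradient

open Filter Topology

variable {E : Type*} [NormedAddCommGroup E] [InnerProductSpace ℝ E] [FiniteDimensional ℝ E]
  [MeasurableSpace E] [BorelSpace E]

/-- Fubini: a null set meets almost every segment in the direction `h` in a null set. -/
theorem ae_ae_line {P : E → Prop} (hP : ∀ᵐ x, P x) (h : E) :
    ∀ᵐ x : E, ∀ᵐ s ∂volume.restrict (Ioc (0 : ℝ) 1), P (x + s • h) := by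
  set N := toMeasurable volume {x | ¬ P x}
  have hN : volume N = 0 := by rw [measure_toMeasurable]; exact hP
  have h1 : ∀ s : ℝ, ∀ᵐ x : E, x + s • h ∉ N := fun s =>
    (measurePreserving_add_right volume (s • h)).quasiMeasurePreserving.ae
      (measure_eq_zero_iff_ae_notMem.1 hN)
  have h2 : ∀ᵐ x : E, ∀ᵐ s ∂volume.restrict (Ioc (0 : ℝ) 1), x + s • h ∉ N := by
    refine (Measure.ae_ae_comm ?_).1 (.of_forall h1)
    exact (measurableSet_toMeasurable _ _).compl.preimage
      (f := fun p : ℝ × E => p.2 + p.1 • h) (by fun_prop)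
  filter_upwards [h2] with x hx
  filter_upwards [hx] with s hs
  by_contra hc
  exact hs (subset_toMeasurable _ _ hc)

theorem HasWeakGradient.ae_abs_sub_le {u : E → ℝ} {G : E → E} (hu : HasWeakGradient u G) {L : ℝ}
    (hG : ∀ᵐ x, ‖G x‖ ≤ L) (h : E) : ∀ᵐ x, |u (x + h) - u x| ≤ L * ‖h‖ := by
  filter_upwards [hu.sub_eq_integral h, ae_ae_line hG h] with x hx hxs
  rw [hx, ← Real.norm_eq_abs]
  have := intervalIntegral.norm_integral_le_of_norm_le_const_ae (a := 0) (b := 1)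
    (f := fun s : ℝ => inner ℝ (G (x + s • h)) h) (C := L * ‖h‖) (by
      rw [uIoc_of_le zero_le_one]
      filter_upwards [(ae_restrict_iff' measurableSet_Ioc).1 hxs] with s hs hsI
      exact (norm_inner_le_norm _ _).trans (mul_le_mul_of_nonneg_right (hs hsI) (norm_nonneg _)))
  simpa using this

theorem poissonExtensionAbs_eq_translate (u : E → ℝ) (y : ℝ) (x : E) :
    poissonExtensionAbs u y x = ∫⁻ z, ENNReal.ofReal (|u (x - z)| * halfSpacePoissonKernel y z) := by
  rw [poissonExtensionAbs, ← lintegral_sub_left_eq_self _ x]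
  simp

theorem poissonExtensionAbs_le_add {u : E → ℝ} (hu : AEStronglyMeasurable u volume) {h : E} {M : ℝ}
    (hM : ∀ᵐ x, |u (x + h) - u x| ≤ M) {y : ℝ} (hy : 0 < y) (x : E) :
    poissonExtensionAbs u y (x + h) ≤ poissonExtensionAbs u y x + ENNReal.ofReal M := by
  rw [poissonExtensionAbs_eq_translate, poissonExtensionAbs_eq_translate]
  have hq : ∀ᵐ z, |u (x - z + h) - u (x - z)| ≤ M :=
    (quasiMeasurePreserving_sub_left volume x).ae hM
  have hut : AEMeasurable (fun z => |u (x - z)|) volume :=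
    (hu.comp_quasiMeasurePreserving (quasiMeasurePreserving_sub_left volume x)).norm.aemeasurable
  have hP := (continuous_halfSpacePoissonKernel (E := E) hy).measurable
  have hutP : AEMeasurable (fun z => ENNReal.ofReal (|u (x - z)| * halfSpacePoissonKernel y z))
      volume := (hut.mul hP.aemeasurable).ennreal_ofReal
  calc _ ≤ ∫⁻ z, (ENNReal.ofReal (|u (x - z)| * halfSpacePoissonKernel y z) +
          ENNReal.ofReal M * ENNReal.ofReal (halfSpacePoissonKernel y z)) := by
        refine lintegral_mono_ae ?_
        filter_upwards [hq] with z hz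
        have hP0 := (halfSpacePoissonKernel_pos hy z).le
        have hM0 : 0 ≤ M := (abs_nonneg _).trans hz
        rw [← ENNReal.ofReal_mul hM0, ← ENNReal.ofReal_add (by positivity) (by positivity),
          ← add_mul]
        refine ENNReal.ofReal_le_ofReal (mul_le_mul_of_nonneg_right ?_ hP0)
        rw [show x + h - z = x - z + h by abel]
        linarith [abs_sub_abs_le_abs_sub (u (x - z + h)) (u (x - z))]
    _ = _ := by
        rw [lintegral_add_left' hutP,
          lintegral_const_mul _ hP.ennreal_ofReal, lintegral_halfSpacePoissonKernel hy, mul_one]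

theorem poissonMaximal_le_add {u : E → ℝ} (hu : AEStronglyMeasurable u volume) {h : E} {M : ℝ}
    (hM : ∀ᵐ x, |u (x + h) - u x| ≤ M) (x : E) :
    poissonMaximal u (x + h) ≤ poissonMaximal u x + ENNReal.ofReal M :=
  iSup₂_le fun y hy => (poissonExtensionAbs_le_add hu hM hy x).trans
    (add_le_add (le_iSup₂_of_le (f := fun y _ => poissonExtensionAbs u y x) y hy le_rfl) le_rfl)

theorem ae_norm_le_toReal_eLpNorm_top {F : Type*} [NormedAddCommGroup F] {f : E → F}
    (hf : MemLp f ⊤ volume) : ∀ᵐ x, ‖f x‖ ≤ (eLpNorm f ⊤ volume).toReal := by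
  have h : ∀ᵐ x, ‖f x‖ₑ ≤ eLpNorm f ⊤ volume := by
    rw [eLpNorm_exponent_top]; exact ae_le_eLpNormEssSup
  filter_upwards [h] with x hx
  rw [← toReal_enorm]
  exact ENNReal.toReal_mono hf.2.ne hx

/-- No subharmonicity is involved: the maximal function commutes with translations, so it is
Lipschitz with constant the L^∞ norm of `G`. -/
theorem poissonMaximal_memW1_top {u : E → ℝ} {G : E → E} (hu : MemLp u ⊤ volume)
    (hG : HasWeakGradient u G) (hGm : MemLp G ⊤ volume) :
    (∀ x, poissonMaximal u x < ⊤) ∧ MemW1 ⊤ (fun x => (poissonMaximal u x).toReal) ∧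
      ∃ G' : E → E, HasWeakGradient (fun x => (poissonMaximal u x).toReal) G' ∧
        eLpNorm G' ⊤ volume ≤ eLpNorm G ⊤ volume := by
  have hfin : ∀ x, poissonMaximal u x < ⊤ := fun x =>
    (poissonMaximal_le_of_bound (ae_norm_le_toReal_eLpNorm_top hu) x).trans_lt ENNReal.ofReal_lt_top
  set L := (eLpNorm G ⊤ volume).toNNReal with hL
  have hLG : (L : ℝ≥0∞) = eLpNorm G ⊤ volume := ENNReal.coe_toNNReal hGm.2.ne
  have hlip : LipschitzWith L fun x => (poissonMaximal u x).toReal := by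
    refine LipschitzWith.of_le_add_mul L fun x x' => ?_
    have h1 := poissonMaximal_le_add hu.1 (hG.ae_abs_sub_le (ae_norm_le_toReal_eLpNorm_top hGm) (x - x')) x'
    rw [add_sub_cancel] at h1
    have h2 := ENNReal.toReal_mono (ENNReal.add_lt_top.2 ⟨hfin x', ENNReal.ofReal_lt_top⟩).ne h1
    rw [ENNReal.toReal_add (hfin x').ne ENNReal.ofReal_ne_top, ENNReal.toReal_ofReal
      (by positivity)] at h2
    rw [dist_eq_norm]
    exact h2
  obtain ⟨hw, hb⟩ := hlip.hasWeakGradient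
  have hle : eLpNorm (gradient fun x => (poissonMaximal u x).toReal) ⊤ volume ≤
      eLpNorm G ⊤ volume := by
    rw [← hLG]
    refine (eLpNorm_le_of_ae_bound (.of_forall hb)).trans (by simp)
  exact ⟨hfin, ⟨memLp_top_poissonMaximal (ae_norm_le_toReal_eLpNorm_top hu), _, hw,
    hw.locallyIntegrable_grad.aestronglyMeasurable, hle.trans_lt hGm.2⟩, _, hw, hle⟩

end BoundedGradient

/-! ### Bounded representatives of Sobolev functions on the line. -/

section Line

open Filter Topology

/-- By Fubini some single `x` satisfies `w (x + a) = w x` for almost every `a`; that value is the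
constant. -/
theorem ae_eq_const_of_translation_invariant {w : ℝ → ℝ} (hw : AEStronglyMeasurable w volume)
    (h : ∀ a, ∀ᵐ x, w (x + a) = w x) : ∃ c, ∀ᵐ x, w x = c := by
  set w' := hw.mk w
  have hww' : w =ᵐ[volume] w' := hw.ae_eq_mk
  have hm : Measurable w' := hw.stronglyMeasurable_mk.measurable
  have h' : ∀ a, ∀ᵐ x, w' (x + a) = w' x := fun a => by
    filter_upwards [h a, hww', (quasiMeasurePreserving_add_right volume a).ae hww'] with x h1 h2 h3
    rw [← h2, ← h1, h3]
  have h2 : ∀ᵐ x : ℝ, ∀ᵐ a : ℝ, w' (x + a) = w' x := by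
    refine (Measure.ae_ae_comm ?_).1 (.of_forall h')
    exact measurableSet_eq_fun (hm.comp (measurable_snd.add measurable_fst)) (hm.comp measurable_snd)
  obtain ⟨x, hx⟩ := h2.exists
  refine ⟨w' x, ?_⟩
  filter_upwards [hww', (measurePreserving_sub_right volume x).quasiMeasurePreserving.ae hx] with z h1 h2
  rw [h1, ← h2, add_sub_cancel]

theorem integral_unit_interval_le {f : ℝ → ℝ} {p : ℝ≥0∞} (hp : 1 ≤ p) (hf : MemLp f p volume)
    (x : ℝ) : ∫ t in Ioc x (x + 1), ‖f t‖ ≤ (eLpNorm f p volume).toReal := by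
  have : IsProbabilityMeasure ((volume : Measure ℝ).restrict (Ioc x (x + 1))) := ⟨by simp⟩
  rw [integral_norm_eq_lintegral_enorm hf.1.restrict, ← eLpNorm_one_eq_lintegral_enorm]
  exact ENNReal.toReal_mono hf.2.ne ((eLpNorm_le_eLpNorm_of_exponent_le hp hf.1.restrict).trans
    (eLpNorm_mono_measure f Measure.restrict_le_self))

/-- A Sobolev function on the line has a bounded representative which is a primitive of its weak
derivative. -/
theorem HasWeakGradient.exists_bounded_primitive {u G : ℝ → ℝ} {p : ℝ≥0∞} (hp : 1 ≤ p)
    (hum : MemLp u p volume) (hG : HasWeakGradient u G) (hGm : MemLp G p volume) :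
    ∃ v : ℝ → ℝ, ∃ B : ℝ, u =ᵐ[volume] v ∧ (∀ z, |v z| ≤ B) ∧
      ∀ a b, v b - v a = ∫ x in a..b, G x := by
  have hGi : ∀ a b, IntervalIntegrable G volume a b := fun a b =>
    ((hGm.locallyIntegrable hp).integrableOn_isCompact isCompact_uIcc).intervalIntegrable
  set F : ℝ → ℝ := fun x => ∫ t in (0 : ℝ)..x, G t
  have hF : ∀ a b, F b - F a = ∫ x in a..b, G x := fun a b =>
    intervalIntegral.integral_interval_sub_left (hGi _ _) (hGi _ _)
  have hFc : Continuous F := intervalIntegral.continuous_primitive hGi 0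
  obtain ⟨c, hc⟩ := ae_eq_const_of_translation_invariant (w := fun x => u x - F x)
    (hum.1.sub hFc.aestronglyMeasurable) fun a => by
      filter_upwards [hG.sub_eq_integral a] with x hx
      have e : ∫ s in (0 : ℝ)..1, inner ℝ (G (x + s • a)) a = F (x + a) - F x := by
        rw [hF, ← (by simp : a * ∫ s in (0 : ℝ)..1, G (x + a * s) = ∫ t in x..x + a, G t),
          ← intervalIntegral.integral_const_mul]
        refine intervalIntegral.integral_congr fun s _ => ?_
        simp [mul_comm]
      linarith
  have huv : u =ᵐ[volume] fun x => F x + c := by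
    filter_upwards [hc] with x hx
    linarith
  have hv : MemLp (fun x => F x + c) p volume := hum.ae_eq huv
  refine ⟨fun x => F x + c, (eLpNorm (fun x => F x + c) p volume).toReal +
    (eLpNorm G p volume).toReal, huv, fun x => ?_, fun a b => by rw [← hF]; ring⟩
  -- Averaging this over `t` bounds the value at `x` by means over a unit interval, and these are at
  -- most the L^p norms of the function and of `G`.
  have h1 : ∀ t ∈ Ioc x (x + 1), |F x + c| ≤ ‖F t + c‖ + ∫ s in Ioc x (x + 1), ‖G s‖ := by
    intro t ht
    have h2 := hF x t
    have h3 : ‖∫ s in x..t, G s‖ ≤ ∫ s in Ioc x (x + 1), ‖G s‖ := by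
      refine (intervalIntegral.norm_integral_le_integral_norm ht.1.le).trans ?_
      rw [intervalIntegral.integral_of_le ht.1.le]
      exact setIntegral_mono_set (hGi x (x + 1)).norm.1 (.of_forall fun _ => norm_nonneg _)
        (Ioc_subset_Ioc_right ht.2).eventuallyLE
    rw [← h2, Real.norm_eq_abs] at h3
    rw [Real.norm_eq_abs]
    have h4 := abs_sub_abs_le_abs_sub (F x + c) (F t + c)
    rw [abs_sub_comm, show F t + c - (F x + c) = F t - F x by ring] at h4
    linarith
  have hvi : IntegrableOn (fun t => ‖F t + c‖) (Ioc x (x + 1)) volume :=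
    ((hFc.add continuous_const).norm.continuousOn.integrableOn_Icc).mono_set Ioc_subset_Icc_self
  have h2 : |F x + c| ≤ ∫ t in Ioc x (x + 1), (‖F t + c‖ + ∫ s in Ioc x (x + 1), ‖G s‖) := by
    have h3 := setIntegral_mono_on (μ := volume) (f := fun _ : ℝ => |F x + c|) (s := Ioc x (x + 1))
      (by simp) (hvi.add (by simp : IntegrableOn (fun _ => ∫ s in Ioc x (x + 1), ‖G s‖)
        (Ioc x (x + 1)) volume)) measurableSet_Ioc h1
    simpa using h3
  rw [integral_add hvi (by simp)] at h2
  have h3 := integral_unit_interval_le hp hv x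
  have h4 := integral_unit_interval_le hp hGm x
  simp only [integral_const, smul_eq_mul] at h2
  simp at h2
  simp only [Real.norm_eq_abs] at h3 h4
  linarith

theorem poissonMaximal_weakDerivative_line {u G : ℝ → ℝ} {p : ℝ≥0∞} (hp : 1 ≤ p) (hp' : p ≠ ⊤)
    (hum : MemLp u p volume) (hG : HasWeakGradient u G) (hGm : MemLp G p volume) :
    (∀ x, poissonMaximal u x < ⊤) ∧ MemLp (fun x => (poissonMaximal u x).toReal) ⊤ volume ∧
      ∃ G' : ℝ → ℝ, HasWeakGradient (fun x => (poissonMaximal u x).toReal) G' ∧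
        eLpNorm G' p volume ≤ eLpNorm G p volume := by
  obtain ⟨v, B, huv, hB, hv⟩ := hG.exists_bounded_primitive hp hum hGm
  rw [poissonMaximal_congr huv]
  exact ⟨fun x => (poissonMaximal_le_of_bound (.of_forall hB) x).trans_lt ENNReal.ofReal_lt_top,
    memLp_top_poissonMaximal (.of_forall hB), _,
    poissonMaximal_weakGradient_line hp hp' (hum.1.congr huv) hB hv hGm⟩

end Line

/-! ### L² norms of differences of Sobolev functions and of their Poisson extensions. -/

section DifferenceEnergy

open Filter Topology

theorem lintegral_enorm_sq_le {α F : Type*} [MeasurableSpace α] [NormedAddCommGroup F] {μ : Measure α}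
    [IsProbabilityMeasure μ] {f : α → F} (hf : AEStronglyMeasurable f μ) :
    (∫⁻ x, ‖f x‖ₑ ∂μ) ^ 2 ≤ ∫⁻ x, ‖f x‖ₑ ^ 2 ∂μ := by
  rw [← eLpNorm_two_sq, ← eLpNorm_one_eq_lintegral_enorm]
  gcongr
  exact eLpNorm_le_eLpNorm_of_exponent_le one_le_two hf

theorem enorm_integral_sq_le {α F : Type*} [MeasurableSpace α] [NormedAddCommGroup F]
    [NormedSpace ℝ F] {μ : Measure α} [IsProbabilityMeasure μ] (f : α → F) :
    ‖∫ x, f x ∂μ‖ₑ ^ 2 ≤ ∫⁻ x, ‖f x‖ₑ ^ 2 ∂μ := by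
  by_cases hf : AEStronglyMeasurable f μ
  · refine le_trans ?_ (lintegral_enorm_sq_le hf)
    gcongr
    exact enorm_integral_le_lintegral_enorm f
  · simp [integral_non_aestronglyMeasurable hf]

theorem enorm_toReal_sub_le {a b d : ℝ≥0∞} (ha : a ≠ ⊤) (hb : b ≠ ⊤) (h1 : a ≤ b + d)
    (h2 : b ≤ a + d) : ‖a.toReal - b.toReal‖ₑ ≤ d := by
  rcases eq_or_ne d ⊤ with rfl | hd
  · exact le_top
  rw [← ofReal_norm, Real.norm_eq_abs]
  refine ENNReal.ofReal_le_of_le_toReal (abs_sub_le_iff.2 ⟨?_, ?_⟩)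
  · have := ENNReal.toReal_mono (ENNReal.add_ne_top.2 ⟨hb, hd⟩) h1
    rw [ENNReal.toReal_add hb hd] at this
    linarith
  · have := ENNReal.toReal_mono (ENNReal.add_ne_top.2 ⟨ha, hd⟩) h2
    rw [ENNReal.toReal_add ha hd] at this
    linarith

variable {E : Type*} [NormedAddCommGroup E] [InnerProductSpace ℝ E] [FiniteDimensional ℝ E]
  [MeasurableSpace E] [BorelSpace E]

/-- Jensen's inequality on each segment, then Tonelli and translation invariance. -/
theorem HasWeakGradient.lintegral_difference_sq_le {u : E → ℝ} {G : E → E}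
    (hu : HasWeakGradient u G) (h : E) :
    ∫⁻ x, ‖u (x + h) - u x‖ₑ ^ 2 ≤ ∫⁻ x, ‖(inner ℝ (G x) h : ℝ)‖ₑ ^ 2 := by
  have : IsProbabilityMeasure ((volume : Measure ℝ).restrict (Ioc 0 1)) := ⟨by simp⟩
  have hm : AEStronglyMeasurable (fun x => (inner ℝ (G x) h : ℝ)) volume :=
    (hu.locallyIntegrable_inner h).aestronglyMeasurable
  have hm2 : AEMeasurable (Function.uncurry fun (s : ℝ) (x : E) =>
      ‖(inner ℝ (G (x + s • h)) h : ℝ)‖ₑ ^ 2) ((volume.restrict (Ioc (0 : ℝ) 1)).prod volume) :=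
    ((hm.comp_snd (μ := volume.restrict (Ioc (0 : ℝ) 1))).comp_quasiMeasurePreserving
      (measurePreserving_shear h).quasiMeasurePreserving).enorm.pow_const 2
  calc ∫⁻ x, ‖u (x + h) - u x‖ₑ ^ 2
      ≤ ∫⁻ x, ∫⁻ s in Ioc (0 : ℝ) 1, ‖(inner ℝ (G (x + s • h)) h : ℝ)‖ₑ ^ 2 := by
        refine lintegral_mono_ae ?_
        filter_upwards [hu.sub_eq_integral h] with x hx
        rw [hx, intervalIntegral.integral_of_le zero_le_one]
        exact enorm_integral_sq_le _
    _ = ∫⁻ s in Ioc (0 : ℝ) 1, ∫⁻ x, ‖(inner ℝ (G (x + s • h)) h : ℝ)‖ₑ ^ 2 :=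
        (lintegral_lintegral_swap hm2).symm
    _ = _ := by
        simp_rw [fun s : ℝ => lintegral_add_right_eq_self (μ := (volume : Measure E))
          (fun x => ‖(inner ℝ (G x) h : ℝ)‖ₑ ^ 2) (s • h)]
        simp

theorem HasWeakGradient.sum_lintegral_difference_sq_le {ι : Type*} [Fintype ι]
    (b : OrthonormalBasis ι ℝ E) {u : E → ℝ} {G : E → E} (hu : HasWeakGradient u G) (r : ℝ) :
    ∑ i, ∫⁻ x, ‖u (x + r • b i) - u x‖ₑ ^ 2 ≤ ‖r‖ₑ ^ 2 * eLpNorm G 2 volume ^ 2 := by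
  have hm : ∀ i, AEMeasurable (fun x => ‖(inner ℝ (G x) (r • b i) : ℝ)‖ₑ ^ 2) volume := fun i =>
    (hu.locallyIntegrable_inner _).aestronglyMeasurable.enorm.pow_const 2
  calc _ ≤ ∑ i, ∫⁻ x, ‖(inner ℝ (G x) (r • b i) : ℝ)‖ₑ ^ 2 :=
        Finset.sum_le_sum fun i _ => hu.lintegral_difference_sq_le _
    _ = ∫⁻ x, ‖r‖ₑ ^ 2 * ‖G x‖ₑ ^ 2 := by
        rw [← lintegral_finsetSum' _ fun i _ => hm i]
        refine lintegral_congr fun x => ?_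
        have e : ‖G x‖ₑ ^ 2 = ∑ i, ‖(inner ℝ (G x) (b i) : ℝ)‖ₑ ^ 2 := by
          rw [← ofReal_norm, ← ENNReal.ofReal_pow (norm_nonneg _), ← b.sum_sq_norm_inner_left,
            ENNReal.ofReal_sum_of_nonneg fun i _ => by positivity]
          simp_rw [ENNReal.ofReal_pow (norm_nonneg _), ofReal_norm]
        rw [e, Finset.mul_sum]
        refine Finset.sum_congr rfl fun i _ => ?_
        rw [inner_smul_right, enorm_mul, mul_pow]
    _ = _ := by rw [lintegral_const_mul' _ _ (by finiteness), eLpNorm_two_sq]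

/-- A difference of the extension is bounded by the average of `|u (x - z + h) - u (x - z)|` against
the kernel, a probability measure; averaging does not increase the L² norm. -/
theorem lintegral_poissonExtensionAbs_difference_sq_le {u : E → ℝ}
    (hu : AEStronglyMeasurable u volume) {y : ℝ} (hy : 0 < y)
    (hfin : ∀ x, poissonExtensionAbs u y x ≠ ⊤) (h : E) :
    ∫⁻ x, ‖(poissonExtensionAbs u y (x + h)).toReal - (poissonExtensionAbs u y x).toReal‖ₑ ^ 2 ≤
      ∫⁻ x, ‖u (x + h) - u x‖ₑ ^ 2 := by
  have hP : Measurable fun z : E => ENNReal.ofReal (halfSpacePoissonKernel y z) :=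
    (continuous_halfSpacePoissonKernel hy).measurable.ennreal_ofReal
  set π : Measure E := volume.withDensity fun z => ENNReal.ofReal (halfSpacePoissonKernel y z)
  have hπ : IsProbabilityMeasure π := ⟨by
    rw [withDensity_apply _ MeasurableSet.univ, Measure.restrict_univ,
      lintegral_halfSpacePoissonKernel hy]⟩
  have hac : π ≪ volume := withDensity_absolutelyContinuous _ _
  have hux : ∀ x : E, AEStronglyMeasurable (fun z => u (x - z)) volume := fun x =>
    hu.comp_quasiMeasurePreserving (quasiMeasurePreserving_sub_left volume x)
  have hV : ∀ x, poissonExtensionAbs u y x = ∫⁻ z, ‖u (x - z)‖ₑ ∂π := fun x => by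
    rw [poissonExtensionAbs_eq_translate,
      lintegral_withDensity_eq_lintegral_mul₀ hP.aemeasurable (hux x).enorm]
    refine lintegral_congr fun z => ?_
    rw [ENNReal.ofReal_mul (abs_nonneg _), ← Real.norm_eq_abs, ofReal_norm, mul_comm]
    rfl
  have hD : AEStronglyMeasurable (fun x => u (x + h) - u x) volume :=
    (hu.comp_quasiMeasurePreserving (measurePreserving_add_right volume h).quasiMeasurePreserving).sub
      hu
  have hDx : ∀ x : E, AEStronglyMeasurable (fun z => u (x - z + h) - u (x - z)) volume := fun x =>
    hD.comp_quasiMeasurePreserving (quasiMeasurePreserving_sub_left volume x)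
  have hDprod : AEMeasurable (Function.uncurry fun (x z : E) => ‖u (x - z + h) - u (x - z)‖ₑ ^ 2)
      (volume.prod π) :=
    ((hD.comp_quasiMeasurePreserving (quasiMeasurePreserving_sub volume volume)).enorm.pow_const
      2).mono_ac (Measure.AbsolutelyContinuous.rfl.prod hac)
  calc _ ≤ ∫⁻ x, ∫⁻ z, ‖u (x - z + h) - u (x - z)‖ₑ ^ 2 ∂π := by
        refine lintegral_mono fun x => ?_
        refine le_trans ?_ (lintegral_enorm_sq_le ((hDx x).mono_ac hac))
        gcongr
        refine enorm_toReal_sub_le (hfin _) (hfin _) ?_ ?_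
        · rw [hV, hV, ← lintegral_add_right' _ ((hDx x).mono_ac hac).enorm]
          refine lintegral_mono fun z => ?_
          rw [show x + h - z = x - z + h by abel]
          simpa using enorm_add_le (u (x - z)) (u (x - z + h) - u (x - z))
        · rw [hV, hV, ← lintegral_add_right' _ ((hDx x).mono_ac hac).enorm]
          refine lintegral_mono fun z => ?_
          rw [show x + h - z = x - z + h by abel]
          simpa using enorm_sub_le (a := u (x - z + h)) (b := u (x - z + h) - u (x - z))
    _ = ∫⁻ z, ∫⁻ x, ‖u (x - z + h) - u (x - z)‖ₑ ^ 2 ∂volume ∂π := lintegral_lintegral_swap hDprod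
    _ = _ := by
        simp_rw [fun z : E => lintegral_sub_right_eq_self (μ := (volume : Measure E))
          (fun x => ‖u (x + h) - u x‖ₑ ^ 2) z]
        simp

end DifferenceEnergy

/-! ### Comparison of Dirichlet energies and the case p = 2. -/

section DirichletEnergy

open Filter Topology

variable {E : Type*} [NormedAddCommGroup E] [InnerProductSpace ℝ E] [FiniteDimensional ℝ E]
  [MeasurableSpace E] [BorelSpace E] {ι : Type*} [Fintype ι]

/-- The discrete Dirichlet energy of `w` with step `r` along an orthonormal basis. -/
noncomputable def differenceEnergy (b : OrthonormalBasis ι ℝ E) (w : E → ℝ) (r : ℝ) : ℝ≥0∞ :=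
  ∑ i, ∫⁻ x, ‖w (x + r • b i) - w x‖ₑ ^ 2

theorem lintegral_enorm_sq_eq {w : E → ℝ} (hw : MemLp w 2 volume) :
    ∫⁻ x, ‖w x‖ₑ ^ 2 = ENNReal.ofReal (∫ x, w x ^ 2) := by
  rw [ofReal_integral_eq_lintegral_ofReal hw.integrable_sq (.of_forall fun x => sq_nonneg _)]
  refine lintegral_congr fun x => ?_
  rw [← ofReal_norm, ← ENNReal.ofReal_pow (norm_nonneg _), Real.norm_eq_abs, sq_abs]

theorem MemLp.translate {w : E → ℝ} {p : ℝ≥0∞} (hw : MemLp w p volume) (a : E) :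
    MemLp (fun x => w (x + a)) p volume :=
  hw.comp_measurePreserving (measurePreserving_add_right volume a)

/-- Discrete integration by parts. -/
theorem integral_difference_mul_difference {g h : E → ℝ} (hg : MemLp g 2 volume)
    (hh : MemLp h 2 volume) (a : E) :
    ∫ x, (g (x + a) - g x) * (h (x + a) - h x) =
      -∫ x, (g (x + a) + g (x - a) - 2 * g x) * h x := by
  have hga := MemLp.translate hg a
  have hha := MemLp.translate hh a
  have hga' : MemLp (fun x => g (x - a)) 2 volume := by
    simpa [sub_eq_add_neg] using MemLp.translate hg (-a)
  have i1 : Integrable fun x => g (x + a) * h x := hga.integrable_mul hh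
  have i2 : Integrable fun x => g (x - a) * h x := hga'.integrable_mul hh
  have i3 : Integrable fun x => g x * h x := hg.integrable_mul hh
  have i4 : Integrable fun x => g (x + a) * h (x + a) := hga.integrable_mul hha
  have i5 : Integrable fun x => g x * h (x + a) := hg.integrable_mul hha
  have t2 : ∫ x, g (x - a) * h x = ∫ x, g x * h (x + a) := by
    rw [← integral_add_right_eq_self (fun x => g (x - a) * h x) a]
    simp
  have t4 : ∫ x, g (x + a) * h (x + a) = ∫ x, g x * h x :=
    integral_add_right_eq_self (fun x => g x * h x) a
  have e1 : ∫ x, (g (x + a) - g x) * (h (x + a) - h x) =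
      ∫ x, ((g (x + a) * h (x + a) - g (x + a) * h x) - (g x * h (x + a) - g x * h x)) :=
    integral_congr_ae (.of_forall fun x => by ring)
  have e2 : ∫ x, (g (x + a) + g (x - a) - 2 * g x) * h x =
      ∫ x, ((g (x + a) * h x + g (x - a) * h x) - 2 * (g x * h x)) :=
    integral_congr_ae (.of_forall fun x => by ring)
  have j1 : Integrable fun x => g (x + a) * h (x + a) - g (x + a) * h x := i4.sub i1
  have j2 : Integrable fun x => g x * h (x + a) - g x * h x := i5.sub i3
  have j3 : Integrable fun x => g (x + a) * h x + g (x - a) * h x := i1.add i2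
  rw [e1, e2, integral_sub j1 j2, integral_sub i4 i1, integral_sub i5 i3,
    integral_sub j3 (i3.const_mul 2), integral_add i1 i2, integral_const_mul, t2, t4]
  ring

/-- A function which is almost subharmonic where it exceeds `f ≥ 0` has almost no more energy
than `f`. -/
theorem differenceEnergy_le_of_second_differences (b : OrthonormalBasis ι ℝ E) {f g : E → ℝ}
    (hf : MemLp f 2 volume) (hg : MemLp g 2 volume) (hf0 : ∀ x, 0 ≤ f x) (hfg : ∀ x, f x ≤ g x)
    {r A : ℝ} (hA : 0 ≤ A)
    (h2 : ∀ x, f x < g x → 0 ≤ ∑ i, (g (x + r • b i) + g (x - r • b i) - 2 * g x) + A * g x) :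
    differenceEnergy b g r ≤
      differenceEnergy b f r + ENNReal.ofReal (2 * A) * eLpNorm g 2 volume ^ 2 := by
  have hh : MemLp (fun x => g x - f x) 2 volume := hg.sub hf
  have hD : ∀ {w : E → ℝ}, MemLp w 2 volume → ∀ a : E, MemLp (fun x => w (x + a) - w x) 2 volume :=
    fun hw a => (MemLp.translate hw a).sub hw
  have hδ : ∀ i, MemLp (fun x => g (x + r • b i) + g (x - r • b i) - 2 * g x) 2 volume := fun i => by
    have h1 : MemLp (fun x => g (x - r • b i)) 2 volume := by
      simpa [sub_eq_add_neg] using MemLp.translate hg (-(r • b i))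
    exact ((MemLp.translate hg _).add h1).sub (hg.const_mul 2)
  have hP : ∀ i, Integrable fun x => (g (x + r • b i) - g x) *
      ((g (x + r • b i) - f (x + r • b i)) - (g x - f x)) := fun i =>
    (hD hg _).integrable_mul (hD hh _)
  have hQ : ∀ i, Integrable fun x =>
      (g (x + r • b i) + g (x - r • b i) - 2 * g x) * (g x - f x) := fun i =>
    (hδ i).integrable_mul hh
  -- Pointwise `a ^ 2 ≤ b ^ 2 + 2 * a * (a - b)` for the differences `a` of `g` and `b` of `f`; the
  -- mixed term is integrated by parts.
  have hstep : ∀ i, ∫ x, (g (x + r • b i) - g x) ^ 2 ≤ (∫ x, (f (x + r • b i) - f x) ^ 2) +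
      2 * -∫ x, (g (x + r • b i) + g (x - r • b i) - 2 * g x) * (g x - f x) := fun i => by
    rw [← integral_difference_mul_difference hg hh, ← integral_const_mul,
      ← integral_add (hD hf _).integrable_sq ((hP i).const_mul 2)]
    refine integral_mono (hD hg _).integrable_sq ((hD hf _).integrable_sq.add
      ((hP i).const_mul 2)) fun x => ?_
    simp only
    nlinarith [sq_nonneg ((g (x + r • b i) - g x) - (f (x + r • b i) - f x))]
  -- The factor `g - f` vanishes at contact points, and elsewhere the second differences are bounded
  -- below by `-A * g`. The error is at most `A * g ^ 2` because `0 ≤ f ≤ g`.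
  have hsum : ∑ i, -∫ x, (g (x + r • b i) + g (x - r • b i) - 2 * g x) * (g x - f x) ≤
      A * ∫ x, g x ^ 2 := by
    rw [Finset.sum_neg_distrib, ← integral_finsetSum _ fun i _ => hQ i,
      ← integral_const_mul, ← integral_neg]
    refine integral_mono (integrable_finsetSum _ fun i _ => hQ i).neg
      (hg.integrable_sq.const_mul A) fun x => ?_
    simp only [← Finset.sum_mul]
    rcases (hfg x).eq_or_lt with h | h
    · rw [h, sub_self, mul_zero, neg_zero]
      positivity
    · have h1 := mul_nonneg (h2 x h) (sub_nonneg.2 h.le)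
      have h3 : A * (g x * f x) ≥ 0 := mul_nonneg hA (mul_nonneg ((hf0 x).trans h.le) (hf0 x))
      nlinarith
  have htot : ∑ i, ∫ x, (g (x + r • b i) - g x) ^ 2 ≤
      (∑ i, ∫ x, (f (x + r • b i) - f x) ^ 2) + 2 * A * ∫ x, g x ^ 2 := by
    have := Finset.sum_le_sum fun i (_ : i ∈ Finset.univ) => hstep i
    rw [Finset.sum_add_distrib, ← Finset.mul_sum] at this
    linarith
  have hE : ∀ {w : E → ℝ}, MemLp w 2 volume →
      differenceEnergy b w r = ENNReal.ofReal (∑ i, ∫ x, (w (x + r • b i) - w x) ^ 2) := fun hw => by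
    rw [ENNReal.ofReal_sum_of_nonneg fun i _ => integral_nonneg fun x => sq_nonneg _]
    exact Finset.sum_congr rfl fun i _ => lintegral_enorm_sq_eq (hD hw _)
  have hg0 : 0 ≤ ∫ x, g x ^ 2 := integral_nonneg fun x => sq_nonneg _
  rw [hE hg, hE hf, eLpNorm_two_sq, lintegral_enorm_sq_eq hg, ← ENNReal.ofReal_mul (by positivity),
    ← ENNReal.ofReal_add (Finset.sum_nonneg fun i _ => integral_nonneg fun x => sq_nonneg _)
      (by positivity)]
  exact ENNReal.ofReal_le_ofReal htot

theorem eLpNorm_difference_le {w : E → ℝ} (hw : AEStronglyMeasurable w volume) {p : ℝ≥0∞}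
    (hp : 1 ≤ p) (a : E) (n : ℕ) :
    eLpNorm (fun x => w (x + (n : ℝ) • a) - w x) p volume ≤
      n * eLpNorm (fun x => w (x + a) - w x) p volume := by
  have ht : ∀ c : E, AEStronglyMeasurable (fun x => w (x + c) - w x) volume := fun c =>
    (hw.comp_quasiMeasurePreserving (measurePreserving_add_right volume c).quasiMeasurePreserving).sub
      hw
  induction n with
  | zero => simp
  | succ n ih =>
    have e : (fun x => w (x + ((n + 1 : ℕ) : ℝ) • a) - w x) =
        (fun x => w (x + (n : ℝ) • a + a) - w (x + (n : ℝ) • a)) +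
          fun x => w (x + (n : ℝ) • a) - w x := by
      funext x
      simp only [Pi.add_apply]
      rw [Nat.cast_succ, add_smul, one_smul, ← add_assoc]
      ring
    have hmp := measurePreserving_add_right (volume : Measure E) ((n : ℝ) • a)
    have h1 : eLpNorm (fun x => w (x + (n : ℝ) • a + a) - w (x + (n : ℝ) • a)) p volume =
        eLpNorm (fun x => w (x + a) - w x) p volume :=
      eLpNorm_comp_measurePreserving (g := fun x => w (x + a) - w x) (ht a) hmp
    have h2 : AEStronglyMeasurable
        (fun x => w (x + (n : ℝ) • a + a) - w (x + (n : ℝ) • a)) volume :=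
      (ht a).comp_quasiMeasurePreserving hmp.quasiMeasurePreserving
    rw [e]
    refine (eLpNorm_add_le h2 (ht _) hp).trans ?_
    rw [h1, Nat.cast_succ, add_mul, one_mul, add_comm]
    exact add_le_add ih le_rfl

/-- Passing to a finer step costs exactly the factor by which squared increments shrink, so the
sharp constant is kept while errors of higher order in the step vanish. -/
theorem differenceEnergy_le_sq_mul (b : OrthonormalBasis ι ℝ E) {w : E → ℝ}
    (hw : AEStronglyMeasurable w volume) (r : ℝ) {n : ℕ} (hn : n ≠ 0) :
    differenceEnergy b w r ≤ (n : ℝ≥0∞) ^ 2 * differenceEnergy b w (r / n) := by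
  unfold differenceEnergy
  rw [Finset.mul_sum]
  refine Finset.sum_le_sum fun i _ => ?_
  rw [← eLpNorm_two_sq, ← eLpNorm_two_sq, ← mul_pow]
  gcongr
  have := eLpNorm_difference_le hw one_le_two ((r / n) • b i) n
  rwa [smul_smul, mul_div_cancel₀ _ (Nat.cast_ne_zero.2 hn)] at this

/-- The Harnack inequality transfers finiteness from a nearby point of the full-measure set to every
point. -/
theorem poissonMaximalFrom_ne_top {u : E → ℝ} (hu : ∀ᵐ x, poissonMaximal u x < ⊤) {ε : ℝ}
    (hε : 0 < ε) (x : E) : poissonMaximalFrom u ε x ≠ ⊤ := by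
  obtain ⟨x', hx', hb⟩ : ∃ x', poissonMaximal u x' < ⊤ ∧ x' ∈ Metric.ball x (ε / 2) := by
    have := (Metric.measure_ball_pos volume x (half_pos hε)).ne'
    obtain ⟨x', h1, h2⟩ := (frequently_ae_mem_iff.2 this).and_eventually hu |>.exists
    exact ⟨x', h2, h1⟩
  have h1 := poissonMaximalFrom_harnack u hε x x' (δ := ε / 2)
    (by rw [← dist_eq_norm]; exact (Metric.mem_ball.1 hb).le) (by linarith)
  have h2 := h1.trans (poissonMaximalFrom_le u hε x')
  intro htop
  rw [htop, ENNReal.mul_top, top_le_iff] at h2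
  · exact hx'.ne h2
  · have : (0 : ℝ) < 1 - ε / 2 / ε := by
      rw [show ε / 2 / ε = 1 / 2 by field_simp]; norm_num
    simpa using pow_pos this _

theorem differenceEnergy_poissonMaximalFrom_le (b : OrthonormalBasis ι ℝ E) {u : E → ℝ} {G : E → E}
    (hu : MemLp u 2 volume) (hG : HasWeakGradient u G) {ε : ℝ} (hε : 0 < ε) {r : ℝ} (hr : 0 < r) :
    differenceEnergy b (fun x => (poissonMaximalFrom u ε x).toReal) r ≤
      ENNReal.ofReal r ^ 2 * eLpNorm G 2 volume ^ 2 := by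
  have hae := ae_poissonMaximal_lt_top ENNReal.one_lt_two (by simp) hu
  have hmax := memLp_poissonMaximal ENNReal.one_lt_two (by simp) hu
  have hfin := fun x => poissonMaximalFrom_ne_top hae hε x
  have hVfin : ∀ x, poissonExtensionAbs u ε x ≠ ⊤ := fun x =>
    ((poissonExtensionAbs_le_from u le_rfl x).trans_lt (hfin x).lt_top).ne
  set g := fun x => (poissonMaximalFrom u ε x).toReal
  set f := fun x => (poissonExtensionAbs u ε x).toReal
  have hfg : ∀ x, f x ≤ g x := fun x =>
    ENNReal.toReal_mono (hfin x) (poissonExtensionAbs_le_from u le_rfl x)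
  have hgm : MemLp g 2 volume := by
    refine hmax.mono (continuous_poissonMaximalFrom u hε hfin).aestronglyMeasurable ?_
    filter_upwards [hae] with x hx
    rw [Real.norm_of_nonneg ENNReal.toReal_nonneg, Real.norm_of_nonneg ENNReal.toReal_nonneg]
    exact ENNReal.toReal_mono hx.ne (poissonMaximalFrom_le u hε x)
  have hfm : MemLp f 2 volume := by
    refine hgm.mono (continuous_poissonExtensionAbs u hε hVfin).aestronglyMeasurable
      (.of_forall fun x => ?_)
    rw [Real.norm_of_nonneg ENNReal.toReal_nonneg, Real.norm_of_nonneg ENNReal.toReal_nonneg]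
    exact hfg x
  set C := poissonThirdConst E * Fintype.card ι / ε ^ 3
  have hC : 0 ≤ C := by have := poissonThirdConst_nonneg (E := E); positivity
  -- The comparison is made at step `r / n`: the error there is of order `(r / n) ^ 3`, and after
  -- multiplication by `n ^ 2` it still tends to 0.
  have hn : ∀ᶠ n : ℕ in atTop, differenceEnergy b g r ≤ ENNReal.ofReal r ^ 2 * eLpNorm G 2 volume ^ 2
      + ENNReal.ofReal (2 * C * r ^ 3 / n) * eLpNorm g 2 volume ^ 2 := by
    filter_upwards [(tendsto_const_div_atTop_nhds_zero_nat r).eventually (ge_mem_nhds (half_pos hε)),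
      eventually_ne_atTop 0] with n hnε hn0
    have hnpos : (0 : ℝ) < n := by positivity
    have hrn : 0 < r / n := by positivity
    have h1 := differenceEnergy_le_of_second_differences b hfm hgm (fun x => ENNReal.toReal_nonneg) hfg
      (r := r / n) (A := C * (r / n) ^ 3) (by positivity) fun x hx =>
        poissonMaximalFrom_second_differences b hu.1 hε hfin hx hrn hnε
    have h2 : differenceEnergy b f (r / n) ≤ ENNReal.ofReal (r / n) ^ 2 * eLpNorm G 2 volume ^ 2 := by
      refine (Finset.sum_le_sum fun i _ =>
        lintegral_poissonExtensionAbs_difference_sq_le hu.1 hε hVfin _).trans ?_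
      rw [← Real.enorm_of_nonneg hrn.le]
      exact hG.sum_lintegral_difference_sq_le b (r / n)
    calc differenceEnergy b g r ≤ (n : ℝ≥0∞) ^ 2 * differenceEnergy b g (r / n) :=
          differenceEnergy_le_sq_mul b hgm.1 r hn0
      _ ≤ (n : ℝ≥0∞) ^ 2 * (ENNReal.ofReal (r / n) ^ 2 * eLpNorm G 2 volume ^ 2 +
            ENNReal.ofReal (2 * (C * (r / n) ^ 3)) * eLpNorm g 2 volume ^ 2) := by
          gcongr
          exact h1.trans (add_le_add h2 le_rfl)
      _ = _ := by
          rw [mul_add, ← mul_assoc, ← mul_assoc, ← ENNReal.ofReal_natCast, ← mul_pow,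
            ← ENNReal.ofReal_mul hnpos.le, mul_div_cancel₀ _ hnpos.ne',
            ← ENNReal.ofReal_pow hnpos.le, ← ENNReal.ofReal_mul (by positivity)]
          congr 3
          field_simp
  refine ge_of_tendsto ?_ hn
  have h3 : Tendsto (fun n : ℕ => ENNReal.ofReal (2 * C * r ^ 3 / n) * eLpNorm g 2 volume ^ 2) atTop
      (𝓝 (ENNReal.ofReal 0 * eLpNorm g 2 volume ^ 2)) :=
    ENNReal.Tendsto.mul_const (ENNReal.tendsto_ofReal (tendsto_const_div_atTop_nhds_zero_nat _))
      (.inr (ENNReal.pow_ne_top hgm.2.ne))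
  simpa using h3.const_add (ENNReal.ofReal r ^ 2 * eLpNorm G 2 volume ^ 2)

/-- Fatou's lemma as the truncation level tends to 0; the bounds for the truncations do not depend
on that level. -/
theorem differenceEnergy_poissonMaximal_le (b : OrthonormalBasis ι ℝ E) {u : E → ℝ} {G : E → E}
    (hu : MemLp u 2 volume) (hG : HasWeakGradient u G) {r : ℝ} (hr : 0 < r) :
    differenceEnergy b (fun x => (poissonMaximal u x).toReal) r ≤
      ENNReal.ofReal r ^ 2 * eLpNorm G 2 volume ^ 2 := by
  have hae := ae_poissonMaximal_lt_top ENNReal.one_lt_two (by simp) hu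
  have hε : ∀ k : ℕ, 0 < 1 / ((k : ℝ) + 1) := fun k => by positivity
  let g : ℕ → E → ℝ := fun k x => (poissonMaximalFrom u (1 / ((k : ℝ) + 1)) x).toReal
  have hgm : ∀ k, Measurable (g k) := fun k =>
    (lowerSemicontinuous_poissonMaximalFrom u (hε k)).measurable.ennreal_toReal
  have hm : ∀ k i, Measurable fun x => ‖g k (x + r • b i) - g k x‖ₑ ^ 2 := fun k i =>
    (((hgm k).comp (measurable_add_const _)).sub (hgm k)).enorm.pow_const 2
  have hlim : ∀ x, poissonMaximal u x < ⊤ →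
      Tendsto (fun k => g k x) atTop (𝓝 (poissonMaximal u x).toReal) := fun x hx =>
    (ENNReal.tendsto_toReal hx.ne).comp (tendsto_poissonMaximalFrom u x)
  have hSm : Measurable (poissonMaximal u) := (lowerSemicontinuous_poissonMaximal u).measurable
  have hSd : ∀ i, Measurable fun x =>
      ‖(poissonMaximal u (x + r • b i)).toReal - (poissonMaximal u x).toReal‖ₑ ^ 2 := fun i =>
    ((hSm.comp (measurable_add_const _)).ennreal_toReal.sub hSm.ennreal_toReal).enorm.pow_const 2
  calc differenceEnergy b (fun x => (poissonMaximal u x).toReal) r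
      = ∫⁻ x, ∑ i, ‖(poissonMaximal u (x + r • b i)).toReal - (poissonMaximal u x).toReal‖ₑ ^ 2 := by
        rw [lintegral_finsetSum _ fun i _ => hSd i]
        rfl
    _ ≤ ∫⁻ x, liminf (fun k => ∑ i, ‖g k (x + r • b i) - g k x‖ₑ ^ 2) atTop := by
        refine lintegral_mono_ae ?_
        have hsh : ∀ᵐ x, ∀ i, poissonMaximal u (x + r • b i) < ⊤ := ae_all_iff.2 fun i =>
          (measurePreserving_add_right volume (r • b i)).quasiMeasurePreserving.ae hae
        filter_upwards [hae, hsh] with x hx hxi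
        refine le_of_eq (Tendsto.liminf_eq ?_).symm
        exact tendsto_finsetSum _ fun i _ =>
          ((ENNReal.continuous_pow 2).tendsto _).comp
            (((hlim _ (hxi i)).sub (hlim x hx)).enorm)
    _ ≤ liminf (fun k => ∫⁻ x, ∑ i, ‖g k (x + r • b i) - g k x‖ₑ ^ 2) atTop :=
        lintegral_liminf_le fun k => Finset.measurable_fun_sum _ fun i _ => hm k i
    _ ≤ _ := by
        refine liminf_le_of_le (by isBoundedDefault) fun c hc => ?_
        obtain ⟨k, hk⟩ := hc.exists
        refine hk.trans ?_
        rw [lintegral_finsetSum _ fun i _ => hm k i]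
        exact differenceEnergy_poissonMaximalFrom_le b hu hG (hε k) hr

theorem poissonMaximal_memW1_two {u : E → ℝ} {G : E → E} (hu : MemLp u 2 volume)
    (hG : HasWeakGradient u G) (hGm : MemLp G 2 volume) :
    (∀ᵐ x, poissonMaximal u x < ⊤) ∧ MemW1 2 (fun x => (poissonMaximal u x).toReal) ∧
      ∃ G' : E → E, HasWeakGradient (fun x => (poissonMaximal u x).toReal) G' ∧
        eLpNorm G' 2 volume ≤ eLpNorm G 2 volume := by
  have hmax := memLp_poissonMaximal ENNReal.one_lt_two (by simp) hu
  obtain ⟨G', hG', hle⟩ := exists_hasWeakGradient_of_difference_quotients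
    (stdOrthonormalBasis ℝ E) hmax hGm.2.ne fun r hr =>
      differenceEnergy_poissonMaximal_le (stdOrthonormalBasis ℝ E) hu hG hr
  exact ⟨ae_poissonMaximal_lt_top ENNReal.one_lt_two (by simp) hu, ⟨hmax, G', hG',
    hG'.locallyIntegrable_grad.aestronglyMeasurable, hle.trans_lt hGm.2⟩, G', hG', hle⟩

end DirichletEnergy

/-! ### Independence of the choice of weak gradient, and the theorem. -/

section SobolevInvariance

variable {E : Type*} [NormedAddCommGroup E] [InnerProductSpace ℝ E] [FiniteDimensional ℝ E]
  [MeasurableSpace E] [BorelSpace E]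

theorem MemW1.memLp_of_hasWeakGradient {p : ℝ≥0∞} {u : E → ℝ} {G₀ : E → E} (hu : MemW1 p u)
    (hG₀ : HasWeakGradient u G₀) : MemLp G₀ p volume := by
  obtain ⟨-, G, hG, hGm⟩ := hu
  exact hGm.ae_eq (hG.ae_eq hG₀)

end SobolevInvariance

/-- The weak gradient is unique up to null sets, so `‖∇f‖_p` is `eLpNorm G p` for any weak gradient
`G` of `f`. The maximal function has values in `[0, ∞]`; its finiteness (everywhere in dimension
one, almost everywhere in higher dimensions) is part of the conclusion. -/
theorem theorem2 :
    -- (i) dimension one, `1 < p ≤ ∞`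
    (∀ (p : ℝ≥0∞), 1 < p → ∀ (u₀ G₀ : ℝ → ℝ), MemW1 p u₀ → HasWeakGradient u₀ G₀ →
      (∀ x, poissonMaximal u₀ x < ⊤) ∧
      MemW1 p (fun x => (poissonMaximal u₀ x).toReal) ∧
      ∃ G : ℝ → ℝ, HasWeakGradient (fun x => (poissonMaximal u₀ x).toReal) G ∧
        eLpNorm G p volume ≤ eLpNorm G₀ p volume) ∧
    -- (ii) dimension one, `p = 1`
    (∀ (u₀ G₀ : ℝ → ℝ), MemW1 1 u₀ → HasWeakGradient u₀ G₀ →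
      (∀ x, poissonMaximal u₀ x < ⊤) ∧
      MemLp (fun x => (poissonMaximal u₀ x).toReal) ⊤ volume ∧
      ∃ G : ℝ → ℝ, HasWeakGradient (fun x => (poissonMaximal u₀ x).toReal) G ∧
        eLpNorm G 1 volume ≤ eLpNorm G₀ 1 volume) ∧
    -- (iii) dimension one, bounded variation
    (∀ (u₀ : ℝ → ℝ), BoundedVariationOn u₀ univ →
      (∀ x, poissonMaximal u₀ x < ⊤) ∧
      BoundedVariationOn (fun x => (poissonMaximal u₀ x).toReal) univ ∧
      eVariationOn (fun x => (poissonMaximal u₀ x).toReal) univ ≤ eVariationOn u₀ univ) ∧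
    -- (iv) dimension `d > 1`, `p = 2` or `p = ∞`
    (∀ (d : ℕ), 1 < d → ∀ (p : ℝ≥0∞), p = 2 ∨ p = ⊤ →
      ∀ (u₀ : EuclideanSpace ℝ (Fin d) → ℝ)
        (G₀ : EuclideanSpace ℝ (Fin d) → EuclideanSpace ℝ (Fin d)),
      MemW1 p u₀ → HasWeakGradient u₀ G₀ →
      (∀ᵐ x, poissonMaximal u₀ x < ⊤) ∧
      MemW1 p (fun x => (poissonMaximal u₀ x).toReal) ∧
      ∃ G : EuclideanSpace ℝ (Fin d) → EuclideanSpace ℝ (Fin d),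
        HasWeakGradient (fun x => (poissonMaximal u₀ x).toReal) G ∧
        eLpNorm G p volume ≤ eLpNorm G₀ p volume) := by
  refine ⟨fun p hp u₀ G₀ hu hG₀ => ?_, fun u₀ G₀ hu hG₀ => ?_,
    fun u₀ hu => boundedVariation_poissonMaximal hu, fun d _ p hp u₀ G₀ hu hG₀ => ?_⟩
  · have hGm := hu.memLp_of_hasWeakGradient hG₀
    rcases eq_or_ne p ⊤ with rfl | hp'
    · exact poissonMaximal_memW1_top hu.1 hG₀ hGm
    · obtain ⟨hfin, -, G, hG, hle⟩ := poissonMaximal_weakDerivative_line hp.le hp' hu.1 hG₀ hGm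
      exact ⟨hfin, ⟨memLp_poissonMaximal hp hp' hu.1, G, hG,
        hG.locallyIntegrable_grad.aestronglyMeasurable, hle.trans_lt hGm.2⟩, G, hG, hle⟩
  · exact poissonMaximal_weakDerivative_line le_rfl ENNReal.one_ne_top hu.1 hG₀
      (hu.memLp_of_hasWeakGradient hG₀)
  · have hGm := hu.memLp_of_hasWeakGradient hG₀
    rcases hp with rfl | rfl
    · exact poissonMaximal_memW1_two hu.1 hG₀ hGm
    · obtain ⟨hfin, h⟩ := poissonMaximal_memW1_top hu.1 hG₀ hGm
      exact ⟨.of_forall hfin, h⟩
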